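/- **Theorem (Clustered product-state approximation for regular graphs).** Let $G=(V,E)$ be a (finite, simple) $D$-regular graph with $D\ge 1$ and $n=|V|\ge 1$, let $m$ be a positive integer dividing $n$, and let $\{V_1,\dots,V_{n/m}\}$ be a partition of $V$ into sets each of size $m$. For $S\subseteq V$ let $\Phi_G(S):=\Pr_{(u,v)\in E}[v\notin S\mid u\in S]$ be the expansion of $S$, where $(u,v)$ is a uniformly random edge with a uniformly random orientation, and let $\bar\Phi_G:=\frac mn\sum_{i=1}^{n/m}\Phi_G(V_i)$ be the average expansion of the blocks. Let $\rho$ be a state (positive semidefinite operator of trace one) on $(\mathbb{C}^d)^{\otimes n}$, with one $d$-dimensional system $Q_v$ for each $v\in V$. For $S\subseteq V$ write $\rho^S$ for the reduced state on the systems in $S$, $S(\tau):=-\operatorname{tr}(\tau\ln\tau)$ for the von Neumann entropy, and $I(S:V\setminus S)_\rho:=S(\rho^S)+S(\rho^{V\setminus S})-S(\rho)$. Let $\bar I:=\frac mn\sum_{i=1}^{n/m}I(V_i:V\setminus V_i)_\rho$ be the average mutual information of a block with its complement. Then there exists a state $\sigma$ on $(\mathbb{C}^d)^{\otimes n}$ such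 that 1. $\sigma$ is separable with respect to the partition $(V_1,\dots,V_{n/m})$, i.e. $\sigma=\sum_z p_z\sigma_z$ (a finite sum) for a probability distribution $p$ and states $\sigma_z$ of the form $\sigma_z=\sigma_z^{V_1}\otimes\cdots\otimes\sigma_z^{V_{n/m}}$; and 2. $$\frac1{|E|}\sum_{\{i,j\}\in E}\big\|\rho^{Q_iQ_j}-\sigma^{Q_iQ_j}\big\|_1\;\le\;9\left(\frac{d^2\,\bar\Phi_G}{D}\cdot\frac{\bar I}{m}\right)^{1/6}+\frac1m+\frac mn ,$$ where $\|X\|_1=\operatorname{tr}\sqrt{X^\dagger X}$ is the trace norm. -/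

import Mathlib

namespace QuditGraph

open scoped ComplexOrder

noncomputable section

/-- A quantum state (density matrix) on the Hilbert space with orthonormal basis `ι`:
a positive semidefinite complex matrix of unit trace. -/
structure State (ι : Type*) [Fintype ι] where
  /-- The underlying matrix. -/
  mat : Matrix ι ι ℂ
  posSemidef : mat.PosSemidef
  trace_eq_one : mat.trace = 1

/-- The trace norm `‖A‖₁ = tr √(A† A)`, i.e. the sum of the singular values of `A`. -/
def traceNorm {ι : Type*} [Fintype ι] [DecidableEq ι] (A : Matrix ι ι ℂ) : ℝ :=
  ∑ i, √((Matrix.isHermitian_conjTranspose_mul_self A).eigenvalues i)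

/-- The von Neumann entropy `S(ρ) = -tr (ρ ln ρ) = -∑ λ ln λ` over the eigenvalues `λ` of `ρ`,
in nats. -/
def State.entropy {ι : Type*} [Fintype ι] [DecidableEq ι] (ρ : State ι) : ℝ :=
  ∑ i, Real.negMulLog (ρ.posSemidef.isHermitian.eigenvalues i)

/-- The computational basis of `(ℂ^d)^{⊗ V}` consists of the functions `V → Fin d`.
`glue S a c` is the basis label that equals `a` on `S` and `c` off `S`. -/
def glue {V : Type*} [DecidableEq V] {d : ℕ} (S : Finset V)
    (a : {v // v ∈ S} → Fin d) (c : {v // v ∉ S} → Fin d) : V → Fin d :=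
  (Equiv.piEquivPiSubtypeProd (fun v => v ∈ S) (fun _ => Fin d)).symm (a, c)

/-- The marginal `ρ^S = tr_{V \ S} ρ` of a state of `d`-dimensional particles sitting at the
sites `V`. -/
def State.marginal {V : Type*} [Fintype V] [DecidableEq V] {d : ℕ} (ρ : State (V → Fin d))
    (S : Finset V) : State ({v // v ∈ S} → Fin d) where
  mat := ∑ c : {v // v ∉ S} → Fin d, ρ.mat.submatrix (fun a => glue S a c) (fun a => glue S a c)
  posSemidef := Matrix.posSemidef_sum _ fun _ _ => ρ.posSemidef.submatrix _
  trace_eq_one := by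
    rw [← ρ.trace_eq_one, Matrix.trace_sum]
    simp only [Matrix.trace, Matrix.diag_apply, Matrix.submatrix_apply]
    rw [Finset.sum_comm, ← Fintype.sum_prod_type']
    exact Equiv.sum_comp (Equiv.piEquivPiSubtypeProd (fun v => v ∈ S) (fun _ => Fin d)).symm
      (fun x => ρ.mat x x)

/-- The mutual information `I(S : V \ S)_ρ = S(ρ^S) + S(ρ^{V \ S}) - S(ρ)` of a region `S` with
its complement. -/
def State.mutualInfo {V : Type*} [Fintype V] [DecidableEq V] {d : ℕ} (ρ : State (V → Fin d))
    (S : Finset V) : ℝ :=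
  (ρ.marginal S).entropy + (ρ.marginal Sᶜ).entropy - ρ.entropy

/-- The tensor product `⨂_{p ∈ P} τ_p` of states `τ_p` of the blocks `p` of a partition `P`. -/
def blockProduct {V : Type*} [Fintype V] [DecidableEq V] {d : ℕ}
    (P : Finpartition (Finset.univ : Finset V))
    (τ : (p : {p // p ∈ P.parts}) → State ({v // v ∈ p.1} → Fin d)) :
    Matrix (V → Fin d) (V → Fin d) ℂ :=
  Matrix.of fun x y => ∏ p : {p // p ∈ P.parts}, (τ p).mat (fun v => x v.1) (fun v => y v.1)

/-- `σ` is separable with respect to the partition `P`: it is a finite convex combination of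
tensor products of states of the blocks. -/
def State.IsSeparable {V : Type*} [Fintype V] [DecidableEq V] {d : ℕ} (σ : State (V → Fin d))
    (P : Finpartition (Finset.univ : Finset V)) : Prop :=
  ∃ (K : ℕ) (w : Fin K → ℝ)
    (τ : Fin K → (p : {p // p ∈ P.parts}) → State ({v // v ∈ p.1} → Fin d)),
    (∀ z, 0 ≤ w z) ∧ ∑ z, w z = 1 ∧ σ.mat = ∑ z, (w z : ℂ) • blockProduct P (τ z)

/-- The expansion `Φ_G(S) = Pr_{(u,v) ∈ E}[v ∉ S | u ∈ S]` for a uniformly random edge with a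
uniformly random orientation `(u, v)`. -/
def expansion {V : Type*} [Fintype V] [DecidableEq V] (G : SimpleGraph V) [DecidableRel G.Adj]
    (S : Finset V) : ℝ :=
  ((G.interedges S Sᶜ).card : ℝ) / ((G.interedges S Finset.univ).card : ℝ)

/-- The average expansion of the blocks of a partition. -/
def avgExpansion {V : Type*} [Fintype V] [DecidableEq V] (G : SimpleGraph V) [DecidableRel G.Adj]
    (P : Finpartition (Finset.univ : Finset V)) : ℝ :=
  (∑ p ∈ P.parts, expansion G p) / (P.parts.card : ℝ)

/-- The average mutual information of the blocks of a partition with their complements. -/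
def State.avgMutualInfo {V : Type*} [Fintype V] [DecidableEq V] {d : ℕ} (ρ : State (V → Fin d))
    (P : Finpartition (Finset.univ : Finset V)) : ℝ :=
  (∑ p ∈ P.parts, ρ.mutualInfo p) / (P.parts.card : ℝ)

/-- The average `𝔼_{(i,j) ∈ E} ‖ρ^{Q_i Q_j} - σ^{Q_i Q_j}‖₁` over the (unordered) edges of `G`;
for an edge `e = s(i, j)`, `e.toFinset` is the set `{i, j}` of its endpoints. -/
def avgEdgeError {V : Type*} [Fintype V] [DecidableEq V] (G : SimpleGraph V) [DecidableRel G.Adj]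
    {d : ℕ} (ρ σ : State (V → Fin d)) : ℝ :=
  (∑ e ∈ G.edgeFinset,
    traceNorm ((ρ.marginal e.toFinset).mat - (σ.marginal e.toFinset).mat)) /
    (G.edgeFinset.card : ℝ)

end

end QuditGraph

/-! Every site carries the same measurement: a vector `g` with independent coordinates whose mixed
moments agree with those of a complex Gaussian up to degree two in `g` and two in its conjugate. The
operators |g⟩⟨g| average to the identity, so the product measurement turns a state into a
probability density `dens` on outcomes. The proof combines three facts about it.

Little is lost by measuring. If a two-site Hermitian operator Y has vanishing partial traces, then
⟨g⊗h|Y|g⊗h⟩ has second moment equal to the squared Frobenius norm of Y, and its fourth moment is at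
most 14² times the square of that. Interpolation bounds the norm by 14 times the mean absolute value
(`frobSq_le_expect_abs_biform`), with no dependence on d.

Outcome information is supermodular. For `outcomeInfo`, the negative entropy of the outcomes on a
set C, the mixed second difference at u, v is the mutual information of the outcomes at u and v
conditional on those in C. By Pinsker it controls the L¹ distance between the joint density and the
conditional product density (`sq_expect_abs_dens_sub_le`). Across a block and its complement, the
corresponding cut difference is a measured mutual information, hence at most the quantum one
(`outcomeInfo_cut_le_mutualInfo`).

One sparse random set serves all blocks. Each site is included independently with probability ε(t +
r), where t is common and r belongs to the site's block, both uniform. Averaging over r and t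
integrates derivatives of the multilinear extension along the block and along its complement. The
expected mixed differences across a block thus telescope to at most ε⁻² times its mutual
information, while the expected size of C is εn (`exists_sparse_set`).

The separable state (`clusterState`) arises by measuring C and replacing each post-measurement state
by the product of its block marginals. An edge touching C costs at most 2, and an edge inside a
block and off C costs nothing. An edge between blocks and off C costs at most 14d√(2·I), with I the
conditional mutual information of its ends. Using √(2I) ≤ θ/2 + I/θ, the first term is paid only by
crossing edges (expansion) and the second is summed over all crossing pairs (mutual information).
The total is 4ε + 7dΦ̄θ + 14dĪ/(mDθε²). With x = d²Φ̄Ī/(Dm), its optimum is of order x^(1/4); this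
is below 9x^(1/6) whenever the latter is below the trivial bound 2. -/

namespace QuditGraph
open scoped ComplexOrder
noncomputable section
open scoped BigOperators ComplexConjugate
open Finset

/-! ### Random measurement vectors and their Wick formula. -/

/-- The outcome alphabet of a single coordinate of the random measurement vectors. -/
abbrev Phase := Fin 2 × Fin 4

/-- The value of a random coordinate: `0` with probability `1/2`, otherwise `√2` times a uniformly
random fourth root of unity. -/
def Phase.val (γ : Phase) : ℂ := if γ.1 = 0 then 0 else (√2 : ℝ) * Complex.I ^ (γ.2 : ℕ)

lemma expect_phase_val {M : Type*} [AddCommGroup M] [Module ℝ M] [Module ℚ≥0 M] (F : ℂ → M) :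
    𝔼 γ : Phase, F γ.val = (1 / 8 : ℝ) • ((4 : ℝ) • F 0 + F (√2 : ℝ) + F ((√2 : ℝ) * Complex.I)
      + F (-(√2 : ℝ)) + F (-((√2 : ℝ) * Complex.I))) := by
  have h8 : ((8 : ℕ) : ℚ≥0)⁻¹ • (∑ γ : Phase, F γ.val) = (1 / 8 : ℝ) • ∑ γ : Phase, F γ.val := by
    have := inv_natCast_smul_eq (R := ℚ≥0) (S := ℝ) 8 (∑ γ : Phase, F γ.val)
    rw [this]; norm_num
  have hc : Fintype.card Phase = 8 := by simp [Phase]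
  rw [Finset.expect, Finset.card_univ, hc, h8]
  congr 1
  rw [Fintype.sum_prod_type, Fin.sum_univ_two]
  simp only [Fin.sum_univ_four, Phase.val]
  have h3 : Complex.I ^ 3 = -Complex.I := Complex.I_pow_three
  simp [h3]
  module

/-- Averaging over fourth roots of unity kills unequal degrees, since |j - k| < 4. The factor √2
repairs the second moment after half the mass is put at zero, and makes the fourth absolute moment
2. These are the complex Gaussian values. -/
lemma expect_phase_moments (j k : ℕ) (hj : j ≤ 2) (hk : k ≤ 2) :
    𝔼 γ : Phase, (conj γ.val) ^ j * γ.val ^ k = if j = k then (if j = 2 then 2 else 1) else (0 : ℂ) := by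
  rw [expect_phase_val (fun z => (conj z) ^ j * z ^ k)]
  have h2 : ((√2 : ℝ) : ℂ) ^ 2 = 2 := by
    rw [← Complex.ofReal_pow]; norm_num
  have hI : Complex.I ^ 2 = -1 := Complex.I_sq
  interval_cases j <;> interval_cases k <;> simp [Complex.real_smul] <;> ring_nf <;>
    simp [h2, hI] <;> norm_num
  · have : ((√2 : ℝ) : ℂ) ^ 4 = 4 := by
      rw [show (4 : ℕ) = 2 * 2 from rfl, pow_mul, h2]; norm_num
    simp [this]; norm_num

/-- The random vector with the given coordinates. -/
def vec {d : ℕ} (g : Fin d → Phase) (i : Fin d) : ℂ := (g i).val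

lemma expect_pi_prod {ι α : Type*} [Fintype ι] [DecidableEq ι] [Fintype α] (φ : ι → α → ℂ) :
    𝔼 g : ι → α, ∏ i, φ i (g i) = ∏ i, 𝔼 a, φ i a := by
  simp only [Fintype.expect_eq_sum_div_card, Finset.prod_div_distrib, Finset.prod_univ_sum]
  simp

lemma prod_pow_indicator {ι : Type*} [Fintype ι] [DecidableEq ι] (f : ι → ℂ) (a : ι) :
    ∏ i, f i ^ (if i = a then 1 else 0) = f a := by
  rw [Finset.prod_eq_single a] <;> simp +contextual

/-- By independence the mean factors over coordinates, and a coordinate contributes only if it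
occurs equally often with and without conjugation. When all four indices coincide both pairings
hold, which matches the moment value 2. -/
lemma expect_wick {d : ℕ} (a b c e : Fin d) :
    𝔼 g : Fin d → Phase, conj (vec g a) * vec g b * (conj (vec g c) * vec g e) =
      (if a = b ∧ c = e then 1 else 0) + (if a = e ∧ b = c then (1 : ℂ) else 0) := by
  set J : Fin d → ℕ := fun i => (if i = a then 1 else 0) + (if i = c then 1 else 0) with hJ
  set K : Fin d → ℕ := fun i => (if i = b then 1 else 0) + (if i = e then 1 else 0) with hK
  have h1 : ∀ g : Fin d → Phase, conj (vec g a) * vec g b * (conj (vec g c) * vec g e) =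
      ∏ i, (conj (g i).val) ^ J i * (g i).val ^ K i := by
    intro g
    simp only [hJ, hK, pow_add, Finset.prod_mul_distrib, prod_pow_indicator, vec]
    ring
  have hJ2 : ∀ i, J i ≤ 2 := by intro i; simp only [hJ]; split_ifs <;> simp
  have hK2 : ∀ i, K i ≤ 2 := by intro i; simp only [hK]; split_ifs <;> simp
  simp only [h1]
  rw [expect_pi_prod (fun i (γ : Phase) => (conj γ.val) ^ J i * γ.val ^ K i)]
  simp only [fun i => expect_phase_moments (J i) (K i) (hJ2 i) (hK2 i)]
  have zero : ∀ i, J i ≠ K i →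
      ∏ i, (if J i = K i then (if J i = 2 then 2 else 1) else (0 : ℂ)) = 0 := by
    intro i hi
    exact Finset.prod_eq_zero (Finset.mem_univ i) (by simp [hi])
  by_cases hac : a = c
  · subst hac
    by_cases hb : b = a ∧ e = a
    · obtain ⟨h1, h2⟩ := hb
      rw [h1, h2] at hK
      rw [h1, h2, Finset.prod_eq_single a]
      · simp [hJ, hK]; norm_num
      · intro i _ hi; simp [hJ, hK, hi]
      · simp
    · rw [zero a]
      · grind
      · simp only [hJ, hK]; grind
  · by_cases hbe : b = e
    · subst hbe
      rw [zero b]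
      · grind
      · simp only [hJ, hK]; grind
    · by_cases h : (a = b ∧ c = e) ∨ (a = e ∧ b = c)
      · have : ∏ i, (if J i = K i then (if J i = 2 then 2 else 1) else (0 : ℂ)) = 1 := by
          apply Finset.prod_eq_one
          intro i _
          simp only [hJ, hK]; grind
        rw [this]; grind
      · by_cases hz : J a = K a
        · rw [zero c]
          · grind
          · simp only [hJ, hK] at hz ⊢; grind
        · rw [zero a hz]; grind

lemma expect_wick_two {d : ℕ} (a b : Fin d) :
    𝔼 g : Fin d → Phase, conj (vec g a) * vec g b = if a = b then (1 : ℂ) else 0 := by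
  set J : Fin d → ℕ := fun i => (if i = a then 1 else 0) with hJ
  set K : Fin d → ℕ := fun i => (if i = b then 1 else 0) with hK
  have h1 : ∀ g : Fin d → Phase, conj (vec g a) * vec g b =
      ∏ i, (conj (g i).val) ^ J i * (g i).val ^ K i := by
    intro g
    simp only [hJ, hK, Finset.prod_mul_distrib, prod_pow_indicator, vec]
  have hJ2 : ∀ i, J i ≤ 2 := by intro i; simp only [hJ]; split_ifs <;> simp
  have hK2 : ∀ i, K i ≤ 2 := by intro i; simp only [hK]; split_ifs <;> simp
  simp only [h1]
  rw [expect_pi_prod (fun i (γ : Phase) => (conj γ.val) ^ J i * γ.val ^ K i)]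
  simp only [fun i => expect_phase_moments (J i) (K i) (hJ2 i) (hK2 i)]
  by_cases hab : a = b
  · subst hab
    rw [Finset.prod_eq_one]
    · simp
    · intro i _; by_cases hi : i = a <;> simp [hJ, hK, hi]
  · rw [Finset.prod_eq_zero (Finset.mem_univ a)]
    · simp [hab]
    · simp [hJ, hK, hab]

/-- The form `⟨g|X|g⟩`. -/
def sform {d : ℕ} (X : Matrix (Fin d) (Fin d) ℂ) (g : Fin d → Phase) : ℂ :=
  ∑ a, ∑ b, X a b * (conj (vec g a) * vec g b)

lemma expect_sform {d : ℕ} (X : Matrix (Fin d) (Fin d) ℂ) :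
    𝔼 g, sform X g = X.trace := by
  simp only [sform, Finset.expect_sum_comm, ← Finset.mul_expect, expect_wick_two]
  simp [Matrix.trace]

/-- The two Wick pairings contract the indices of X and Y either separately or crosswise. -/
lemma expect_sform_mul {d : ℕ} (X Y : Matrix (Fin d) (Fin d) ℂ) :
    𝔼 g, sform X g * sform Y g = X.trace * Y.trace + (X * Y).trace := by
  have h : ∀ g, sform X g * sform Y g = ∑ a, ∑ b, ∑ c, ∑ e, X a b * Y c e *
      (conj (vec g a) * vec g b * (conj (vec g c) * vec g e)) := by
    intro g
    simp only [sform, Finset.sum_mul]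
    simp only [Finset.mul_sum]
    refine Finset.sum_congr rfl fun a _ => Finset.sum_congr rfl fun b _ =>
      Finset.sum_congr rfl fun c _ => Finset.sum_congr rfl fun e _ => by ring
  simp only [h, Finset.expect_sum_comm, ← Finset.mul_expect, expect_wick, mul_add,
    Finset.sum_add_distrib]
  congr 1
  · simp only [ite_and, mul_ite, mul_one, mul_zero, Matrix.trace, Matrix.diag, Finset.sum_mul]
    refine Finset.sum_congr rfl fun a _ => ?_
    simp [Finset.mul_sum]
  · simp only [Matrix.trace, Matrix.diag, Matrix.mul_apply]
    refine Finset.sum_congr rfl fun a _ => Finset.sum_congr rfl fun b _ => ?_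
    simp [ite_and]
end
end QuditGraph

/-! ### Linear and centred quadratic forms in a random vector. -/

namespace QuditGraph
open scoped ComplexOrder
noncomputable section
open scoped BigOperators ComplexConjugate
open Finset

lemma re_expect {ι : Type*} [Fintype ι] (f : ι → ℂ) : (𝔼 i, f i).re = 𝔼 i, (f i).re := by
  simp only [Fintype.expect_eq_sum_div_card, Complex.div_natCast_re, Complex.re_sum]

lemma ofReal_expect {ι : Type*} [Fintype ι] (f : ι → ℝ) :
    ((𝔼 i, f i : ℝ) : ℂ) = 𝔼 i, (f i : ℂ) := by
  simp only [Fintype.expect_eq_sum_div_card]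
  push_cast
  rfl

/-- The squared Frobenius norm. -/
def frobSq {m n : Type*} [Fintype m] [Fintype n] (X : Matrix m n ℂ) : ℝ :=
  ∑ a, ∑ b, Complex.normSq (X a b)

/-- The squared Euclidean norm. -/
def vecSq {m : Type*} [Fintype m] (β : m → ℂ) : ℝ := ∑ a, Complex.normSq (β a)

lemma frobSq_nonneg {m n : Type*} [Fintype m] [Fintype n] (X : Matrix m n ℂ) : 0 ≤ frobSq X :=
  Finset.sum_nonneg fun _ _ => Finset.sum_nonneg fun _ _ => Complex.normSq_nonneg _

lemma vecSq_nonneg {m : Type*} [Fintype m] (β : m → ℂ) : 0 ≤ vecSq β :=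
  Finset.sum_nonneg fun _ _ => Complex.normSq_nonneg _

lemma trace_mul_conjTranspose {d : ℕ} (X : Matrix (Fin d) (Fin d) ℂ) :
    (X * X.conjTranspose).trace = frobSq X := by
  simp [Matrix.trace, Matrix.mul_apply, frobSq, Complex.mul_conj]

/-- The linear form `∑ β_b g_b`. -/
def lform {d : ℕ} (β : Fin d → ℂ) (g : Fin d → Phase) : ℂ := ∑ b, β b * vec g b

lemma conj_sform {d : ℕ} (X : Matrix (Fin d) (Fin d) ℂ) (g : Fin d → Phase) :
    conj (sform X g) = sform X.conjTranspose g := by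
  simp only [sform, map_sum, map_mul, Complex.conj_conj, Matrix.conjTranspose_apply]
  rw [Finset.sum_comm]
  refine Finset.sum_congr rfl fun a _ => Finset.sum_congr rfl fun b _ => ?_
  simp only [RCLike.star_def]
  ring

lemma sform_vecMulVec {d : ℕ} (β δ : Fin d → ℂ) (g : Fin d → Phase) :
    sform (Matrix.vecMulVec (fun c => conj (δ c)) β) g = lform β g * conj (lform δ g) := by
  simp only [sform, lform, map_sum, map_mul, Matrix.vecMulVec_apply, Finset.sum_mul_sum]
  rw [Finset.sum_comm]
  refine Finset.sum_congr rfl fun a _ => Finset.sum_congr rfl fun b _ => ?_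
  ring

lemma expect_normSq_sform {d : ℕ} (X : Matrix (Fin d) (Fin d) ℂ) :
    𝔼 g, Complex.normSq (sform X g - X.trace) = frobSq X := by
  have h : ∀ g, ((Complex.normSq (sform X g - X.trace) : ℝ) : ℂ) =
      sform X g * sform X.conjTranspose g - X.trace * sform X.conjTranspose g
        - sform X g * conj X.trace + X.trace * conj X.trace := by
    intro g
    rw [← Complex.mul_conj, map_sub, conj_sform]
    ring
  apply Complex.ofReal_injective
  rw [ofReal_expect]
  simp only [h, Finset.expect_add_distrib, Finset.expect_sub_distrib, ← Finset.mul_expect,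
    ← Finset.expect_mul, expect_sform, expect_sform_mul, Fintype.expect_const,
    trace_mul_conjTranspose, Matrix.trace_conjTranspose, RCLike.star_def]
  ring

lemma trace_vecMulVec_conj {d : ℕ} (β : Fin d → ℂ) :
    (Matrix.vecMulVec (fun c => conj (β c)) β).trace = vecSq β := by
  simp [Matrix.trace, Matrix.vecMulVec_apply, vecSq, Complex.normSq_eq_conj_mul_self]

lemma expect_normSq_lform {d : ℕ} (β : Fin d → ℂ) :
    𝔼 g, Complex.normSq (lform β g) = vecSq β := by
  apply Complex.ofReal_injective
  rw [ofReal_expect]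
  simp only [← Complex.mul_conj, ← sform_vecMulVec, expect_sform, trace_vecMulVec_conj]

lemma normSq_sum_mul_le {ι : Type*} [Fintype ι] (x y : ι → ℂ) :
    Complex.normSq (∑ i, x i * y i) ≤ (∑ i, Complex.normSq (x i)) * ∑ i, Complex.normSq (y i) := by
  have h1 : ‖∑ i, x i * y i‖ ≤ ∑ i, ‖x i‖ * ‖y i‖ :=
    (norm_sum_le _ _).trans (by simp)
  have h2 := Finset.sum_mul_sq_le_sq_mul_sq Finset.univ (fun i => ‖x i‖) (fun i => ‖y i‖)
  simp only [Complex.normSq_eq_norm_sq]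
  refine (pow_le_pow_left₀ (norm_nonneg _) h1 2).trans h2

lemma expect_normSq_lform_mul_conj {d : ℕ} (β δ : Fin d → ℂ) :
    Complex.normSq (𝔼 g, lform β g * conj (lform δ g)) ≤ vecSq β * vecSq δ := by
  simp only [← sform_vecMulVec, expect_sform]
  have : (Matrix.vecMulVec (fun c => conj (δ c)) β).trace = ∑ i, β i * conj (δ i) := by
    simp [Matrix.trace, Matrix.vecMulVec_apply, mul_comm]
  rw [this]
  simpa [vecSq] using normSq_sum_mul_le β (fun i => conj (δ i))

/-- |⟨β, g⟩|² is the form of a rank-one matrix, so the exact value is |β|²|δ|² plus a squared inner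
product, and Cauchy–Schwarz doubles the first term at worst. -/
lemma expect_normSq_mul_normSq_le {d : ℕ} (β δ : Fin d → ℂ) :
    𝔼 g, Complex.normSq (lform β g) * Complex.normSq (lform δ g) ≤ 2 * (vecSq β * vecSq δ) := by
  have h : ((𝔼 g, Complex.normSq (lform β g) * Complex.normSq (lform δ g) : ℝ) : ℂ) =
      ((vecSq β * vecSq δ + Complex.normSq (∑ i, β i * conj (δ i)) : ℝ) : ℂ) := by
    rw [ofReal_expect]
    simp only [Complex.ofReal_mul, ← Complex.mul_conj, ← sform_vecMulVec, expect_sform_mul,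
      trace_vecMulVec_conj, Complex.ofReal_add]
    congr 1
    rw [Matrix.vecMulVec_mul_vecMulVec, Matrix.vecMulVec_smul, Matrix.trace_smul, map_sum]
    simp [Matrix.trace, Matrix.vecMulVec_apply, dotProduct]
  rw [Complex.ofReal_injective h]
  have := normSq_sum_mul_le β (fun i => conj (δ i))
  simp only [Complex.normSq_conj] at this
  simp only [vecSq]
  linarith

/-- The centered form `⟨g|X|g⟩ - tr X`, real for Hermitian `X`. -/
def qform {d : ℕ} (X : Matrix (Fin d) (Fin d) ℂ) (g : Fin d → Phase) : ℝ :=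
  (sform X g - X.trace).re

lemma qform_eq {d : ℕ} {X : Matrix (Fin d) (Fin d) ℂ} (hX : X.IsHermitian) (g : Fin d → Phase) :
    (qform X g : ℂ) = sform X g - X.trace := by
  rw [qform, ← Complex.conj_eq_iff_re, map_sub, conj_sform, hX.eq]
  congr 1
  rw [← RCLike.star_def, ← Matrix.trace_conjTranspose, hX.eq]

lemma expect_qform {d : ℕ} (X : Matrix (Fin d) (Fin d) ℂ) : 𝔼 g, qform X g = 0 := by
  simp only [qform, ← re_expect, Finset.expect_sub_distrib, expect_sform, Fintype.expect_const,
    sub_self, Complex.zero_re]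

lemma expect_qform_sq {d : ℕ} {X : Matrix (Fin d) (Fin d) ℂ} (hX : X.IsHermitian) :
    𝔼 g, qform X g ^ 2 = frobSq X := by
  rw [← expect_normSq_sform]
  refine Finset.expect_congr rfl fun g _ => ?_
  rw [← qform_eq hX, Complex.normSq_ofReal, sq]

/-- Centring removes the disconnected pairing. What remains is X contracted with β and the conjugate
of δ. -/
lemma normSq_expect_qform_mul {d : ℕ} {X : Matrix (Fin d) (Fin d) ℂ} (hX : X.IsHermitian)
    (β δ : Fin d → ℂ) :
    Complex.normSq (𝔼 g, qform X g * (lform β g * conj (lform δ g))) ≤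
      frobSq X * (vecSq β * vecSq δ) := by
  have h : 𝔼 g, qform X g * (lform β g * conj (lform δ g)) =
      ∑ p : Fin d × Fin d, X p.1 p.2 * (conj (δ p.2) * β p.1) := by
    simp only [qform_eq hX, ← sform_vecMulVec, sub_mul, Finset.expect_sub_distrib,
      expect_sform_mul, ← Finset.mul_expect, expect_sform, add_sub_cancel_left]
    simp [Matrix.trace, Matrix.mul_apply, Matrix.vecMulVec_apply, Fintype.sum_prod_type]
  rw [h]
  refine (normSq_sum_mul_le _ _).trans (le_of_eq ?_)
  simp only [Fintype.sum_prod_type, frobSq, vecSq, map_mul, Complex.normSq_conj]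
  congr 1
  rw [Finset.sum_comm, mul_comm, Finset.sum_mul_sum]

lemma expect_cons {d : ℕ} (F : (Fin (d + 1) → Phase) → ℝ) :
    𝔼 g, F g = 𝔼 g : Fin d → Phase, 𝔼 γ : Phase, F (Fin.cons γ g) := by
  rw [Finset.expect_comm, ← Finset.expect_product' (f := fun γ g => F (Fin.cons γ g))]
  exact (Fintype.expect_equiv (Fin.consEquiv fun _ => Phase) _ _ fun _ => rfl).symm

/-- The lower right block of a matrix. -/
abbrev lowerBlock {d : ℕ} (X : Matrix (Fin (d + 1)) (Fin (d + 1)) ℂ) : Matrix (Fin d) (Fin d) ℂ :=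
  X.submatrix Fin.succ Fin.succ

lemma lform_cons {d : ℕ} (β : Fin (d + 1) → ℂ) (γ : Phase) (g : Fin d → Phase) :
    lform β (Fin.cons γ g) = lform (fun i : Fin d => β i.succ) g + β 0 * γ.val := by
  simp [lform, Fin.sum_univ_succ, vec, add_comm]

/-- Peeling off one coordinate γ exhibits the form as a polynomial in γ with coefficients
independent of it. This drives the inductions on d below. -/
lemma qform_cons {d : ℕ} {X : Matrix (Fin (d + 1)) (Fin (d + 1)) ℂ} (hX : X.IsHermitian)
    (γ : Phase) (g : Fin d → Phase) :
    qform X (Fin.cons γ g) = qform (lowerBlock X) g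
      + 2 * (conj γ.val * lform (fun i : Fin d => X 0 i.succ) g).re
      + (X 0 0).re * (Complex.normSq γ.val - 1) := by
  have h0 : ∀ i : Fin d, X i.succ 0 = conj (X 0 i.succ) := fun i => (hX.apply _ _).symm
  have h00 : (X 0 0).im = 0 := by
    have := hX.apply 0 0
    rwa [RCLike.star_def, Complex.conj_eq_iff_im] at this
  have e1 : sform X (Fin.cons γ g) = sform (lowerBlock X) g
      + conj γ.val * lform (fun i : Fin d => X 0 i.succ) g
      + conj (conj γ.val * lform (fun i : Fin d => X 0 i.succ) g) + X 0 0 * (conj γ.val * γ.val) := by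
    simp only [sform, lform, Fin.sum_univ_succ, vec, Fin.cons_zero, Fin.cons_succ, h0,
      Finset.sum_add_distrib, map_mul, map_sum, Finset.mul_sum, Matrix.submatrix_apply,
      Complex.conj_conj]
    have e2 : ∀ i, X 0 (Fin.succ i) * (conj γ.val * (g i).val) =
      conj γ.val * (X 0 (Fin.succ i) * (g i).val) := fun i => by ring
    have e3 : ∀ i, conj (X 0 (Fin.succ i)) * (conj (g i).val * γ.val) =
      γ.val * (conj (X 0 (Fin.succ i)) * conj (g i).val) := fun i => by ring
    simp only [e2, e3]
    ring
  have e4 : X.trace = X 0 0 + (lowerBlock X).trace := by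
    simp [Matrix.trace, Fin.sum_univ_succ]
  rw [qform, e1, e4, qform, ← Complex.normSq_eq_conj_mul_self]
  simp only [Complex.sub_re, Complex.add_re, Complex.conj_re, Complex.re_mul_ofReal]
  ring

lemma frobSq_cons {d : ℕ} {X : Matrix (Fin (d + 1)) (Fin (d + 1)) ℂ} (hX : X.IsHermitian) :
    frobSq X = frobSq (lowerBlock X) + 2 * vecSq (fun i : Fin d => X 0 i.succ) + (X 0 0).re ^ 2 := by
  have h0 : ∀ i : Fin d, X i.succ 0 = conj (X 0 i.succ) := fun i => (hX.apply _ _).symm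
  have h00 : (X 0 0).im = 0 := by
    have := hX.apply 0 0
    rwa [RCLike.star_def, Complex.conj_eq_iff_im] at this
  simp only [frobSq, vecSq, Fin.sum_univ_succ, h0, Complex.normSq_conj, Finset.sum_add_distrib,
    Matrix.submatrix_apply]
  rw [Complex.normSq_apply (X 0 0), h00]
  ring

lemma vecSq_cons {d : ℕ} (β : Fin (d + 1) → ℂ) :
    vecSq β = vecSq (fun i : Fin d => β i.succ) + Complex.normSq (β 0) := by
  simp [vecSq, Fin.sum_univ_succ, add_comm]

/-- Here γ enters beyond the degrees in which it imitates a Gaussian: it is only invariant under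
quarter turns, hence the term in the fourth powers of the real and imaginary parts of B. -/
lemma expect_phase_four (A x : ℝ) (B : ℂ) :
    𝔼 γ : Phase, (A + 2 * (conj γ.val * B).re + x * (Complex.normSq γ.val - 1)) ^ 4 =
      A ^ 4 + 6 * A ^ 2 * (2 * Complex.normSq B + x ^ 2) + 24 * x * (A * Complex.normSq B)
      + 16 * (B.re ^ 4 + B.im ^ 4) + 12 * x ^ 2 * Complex.normSq B + x ^ 4 := by
  rw [expect_phase_val (fun z => (A + 2 * (conj z * B).re + x * (Complex.normSq z - 1)) ^ 4)]
  have h2 : (√2 : ℝ) ^ 2 = 2 := by norm_num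
  have h4 : (√2 : ℝ) ^ 4 = 4 := by rw [show (4 : ℕ) = 2 * 2 from rfl, pow_mul, h2]; norm_num
  simp [Complex.normSq_apply]
  ring_nf
  simp only [h2, h4]
  ring

lemma expect_phase_two_two (A x : ℝ) (B L β : ℂ) :
    𝔼 γ : Phase, (A + 2 * (conj γ.val * B).re + x * (Complex.normSq γ.val - 1)) ^ 2
        * Complex.normSq (L + β * γ.val) =
      Complex.normSq L * A ^ 2 + 2 * (Complex.normSq B * Complex.normSq L)
        + x ^ 2 * Complex.normSq L + 4 * (β * (A * (B * conj L))).re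
        + 4 * x * (β * (B * conj L)).re + Complex.normSq β *
          (A ^ 2 + 2 * A * x + 4 * Complex.normSq B + x ^ 2) := by
  rw [expect_phase_val (fun z => (A + 2 * (conj z * B).re + x * (Complex.normSq z - 1)) ^ 2
        * Complex.normSq (L + β * z))]
  have h2 : (√2 : ℝ) ^ 2 = 2 := by norm_num
  have h4 : (√2 : ℝ) ^ 4 = 4 := by rw [show (4 : ℕ) = 2 * 2 from rfl, pow_mul, h2]; norm_num
  simp [Complex.normSq_apply]
  ring_nf
  simp only [h2, h4]
  ring
end
end QuditGraph

/-! ### Fourth-moment bounds and two-site operators. -/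

namespace QuditGraph
open scoped ComplexOrder
noncomputable section
open scoped BigOperators ComplexConjugate
open Finset

lemma re_mul_le_of_normSq_le {w β : ℂ} {s t : ℝ} (hs : 0 ≤ s) (ht : 0 ≤ t)
    (h : Complex.normSq w * Complex.normSq β ≤ s * t) : 2 * (β * w).re ≤ s + t := by
  have h1 : (β * w).re ^ 2 ≤ s * t := by
    calc (β * w).re ^ 2 ≤ Complex.normSq (β * w) := by
          rw [Complex.normSq_apply]; nlinarith [mul_self_nonneg (β * w).im]
      _ ≤ s * t := by rw [map_mul, mul_comm]; exact h
  refine le_of_abs_le (abs_le_of_sq_le_sq ?_ (by positivity))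
  nlinarith [sq_nonneg (s - t)]

/-- Auxiliary mixed moment for the fourth-moment induction, where β becomes the off-diagonal part of
the first row. The constant 4 is what closes its own induction: the terms in b·l add up to exactly 8
= 2·4. -/
lemma expect_qform_sq_mul_le : ∀ {d : ℕ} {X : Matrix (Fin d) (Fin d) ℂ} (_ : X.IsHermitian)
    (β : Fin d → ℂ), 𝔼 g, qform X g ^ 2 * Complex.normSq (lform β g) ≤ 4 * (frobSq X * vecSq β)
  | 0, X, _, β => by simp [lform, frobSq]
  | d + 1, X, hX, β => by
    have ih := expect_qform_sq_mul_le (hX.submatrix Fin.succ) (fun i : Fin d => β i.succ)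
    rw [expect_cons]
    simp only [qform_cons hX, lform_cons, expect_phase_two_two]
    rw [frobSq_cons hX, vecSq_cons]
    set A := qform (lowerBlock X)
    set B := lform fun i : Fin d => X 0 i.succ
    set L := lform fun i : Fin d => β i.succ
    set x := (X 0 0).re
    set b := vecSq fun i : Fin d => X 0 i.succ
    set l := vecSq fun i : Fin d => β i.succ
    set α := frobSq (lowerBlock X)
    set w1 := 𝔼 g, (A g : ℂ) * (B g * conj (L g)) with hw1
    set w2 := 𝔼 g, B g * conj (L g) with hw2
    have hA : 𝔼 g, A g = 0 := expect_qform _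
    have hA2 : 𝔼 g, A g ^ 2 = α := expect_qform_sq (hX.submatrix Fin.succ)
    have hBL : 𝔼 g, Complex.normSq (B g) * Complex.normSq (L g) ≤ 2 * (b * l) :=
      expect_normSq_mul_normSq_le _ _
    have hB : 𝔼 g, Complex.normSq (B g) = b := expect_normSq_lform _
    have hL : 𝔼 g, Complex.normSq (L g) = l := expect_normSq_lform _
    have hw1' : Complex.normSq w1 ≤ α * (b * l) :=
      normSq_expect_qform_mul (hX.submatrix Fin.succ) _ _
    have hw2' : Complex.normSq w2 ≤ b * l := expect_normSq_lform_mul_conj _ _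
    have hα : 0 ≤ α := frobSq_nonneg _
    have hb : 0 ≤ b := vecSq_nonneg _
    have hl : 0 ≤ l := vecSq_nonneg _
    set q := Complex.normSq (β 0)
    have hq : 0 ≤ q := Complex.normSq_nonneg _
    have e1 : 𝔼 g, (β 0 * ((A g : ℂ) * (B g * conj (L g)))).re = (β 0 * w1).re := by
      rw [hw1, Finset.mul_expect, re_expect]
    have e2 : 𝔼 g, (β 0 * (B g * conj (L g))).re = (β 0 * w2).re := by
      rw [hw2, Finset.mul_expect, re_expect]
    have expand : 𝔼 g, (Complex.normSq (L g) * A g ^ 2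
        + 2 * (Complex.normSq (B g) * Complex.normSq (L g))
        + x ^ 2 * Complex.normSq (L g) + 4 * (β 0 * (A g * (B g * conj (L g)))).re
        + 4 * x * (β 0 * (B g * conj (L g))).re + q *
          (A g ^ 2 + 2 * A g * x + 4 * Complex.normSq (B g) + x ^ 2)) =
      𝔼 g, A g ^ 2 * Complex.normSq (L g)
        + 2 * (𝔼 g, Complex.normSq (B g) * Complex.normSq (L g))
        + x ^ 2 * l + 4 * (β 0 * w1).re + 4 * x * (β 0 * w2).re
        + q * (α + 4 * b + x ^ 2) := by
      simp only [Finset.expect_add_distrib, ← Finset.mul_expect, ← Finset.expect_mul, e1, e2, hA,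
        hA2, hB, hL, Fintype.expect_const, mul_comm (Complex.normSq (L _)) (A _ ^ 2)]
      ring
    rw [expand]
    have b1 : 2 * (β 0 * w1).re ≤ α * q + b * l :=
      re_mul_le_of_normSq_le (by positivity) (by positivity) (by nlinarith)
    have b2 : 2 * (β 0 * ((x : ℂ) * w2)).re ≤ x ^ 2 * q + b * l := by
      refine re_mul_le_of_normSq_le (by positivity) (by positivity) ?_
      rw [map_mul, Complex.normSq_ofReal]
      nlinarith [mul_nonneg (sq_nonneg x) hq]
    have b3 : (β 0 * ((x : ℂ) * w2)).re = x * (β 0 * w2).re := by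
      rw [mul_left_comm, Complex.re_ofReal_mul]
    rw [b3] at b2
    nlinarith [mul_nonneg hα hq, mul_nonneg (sq_nonneg x) hq, mul_nonneg hb hq,
      mul_nonneg (sq_nonneg x) hl]

/-- Induction on d by averaging over the first coordinate. The terms in α·b determine the constant:
they sum to 54, and 14 allows 56. -/
lemma expect_qform_four_le : ∀ {d : ℕ} {X : Matrix (Fin d) (Fin d) ℂ} (_ : X.IsHermitian),
    𝔼 g, qform X g ^ 4 ≤ 14 * frobSq X ^ 2
  | 0, X, _ => by simp [qform, sform, frobSq, Matrix.trace]
  | d + 1, X, hX => by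
    have ih := expect_qform_four_le (hX.submatrix (Fin.succ : Fin d → Fin (d + 1)))
    have h22 := expect_qform_sq_mul_le (hX.submatrix Fin.succ) (fun i : Fin d => X 0 i.succ)
    rw [expect_cons]
    simp only [qform_cons hX, expect_phase_four]
    rw [frobSq_cons hX]
    set A := qform (lowerBlock X)
    set B := lform fun i : Fin d => X 0 i.succ
    set x := (X 0 0).re
    set b := vecSq fun i : Fin d => X 0 i.succ
    set α := frobSq (lowerBlock X)
    set w1 := 𝔼 g, (A g : ℂ) * (B g * conj (B g)) with hw1
    have hA2 : 𝔼 g, A g ^ 2 = α := expect_qform_sq (hX.submatrix Fin.succ)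
    have hBB : 𝔼 g, Complex.normSq (B g) * Complex.normSq (B g) ≤ 2 * (b * b) :=
      expect_normSq_mul_normSq_le _ _
    have hB : 𝔼 g, Complex.normSq (B g) = b := expect_normSq_lform _
    have hw1' : Complex.normSq w1 ≤ α * (b * b) :=
      normSq_expect_qform_mul (hX.submatrix Fin.succ) _ _
    have hα : 0 ≤ α := frobSq_nonneg _
    have hb : 0 ≤ b := vecSq_nonneg _
    have e1 : 𝔼 g, A g * Complex.normSq (B g) = w1.re := by
      rw [hw1, re_expect]
      simp [Complex.mul_conj]
    have h4 : 𝔼 g, ((B g).re ^ 4 + (B g).im ^ 4) ≤ 2 * (b * b) := by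
      refine le_trans (Finset.expect_le_expect fun g _ => ?_) hBB
      rw [Complex.normSq_apply]
      nlinarith [mul_nonneg (sq_nonneg (B g).re) (sq_nonneg (B g).im)]
    have expand : 𝔼 g, (A g ^ 4 + 6 * A g ^ 2 * (2 * Complex.normSq (B g) + x ^ 2)
        + 24 * x * (A g * Complex.normSq (B g)) + 16 * ((B g).re ^ 4 + (B g).im ^ 4)
        + 12 * x ^ 2 * Complex.normSq (B g) + x ^ 4) =
      𝔼 g, A g ^ 4 + 12 * (𝔼 g, A g ^ 2 * Complex.normSq (B g)) + 6 * x ^ 2 * α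
        + 24 * x * w1.re + 16 * (𝔼 g, ((B g).re ^ 4 + (B g).im ^ 4)) + 12 * x ^ 2 * b
        + x ^ 4 := by
      simp only [mul_add, mul_assoc, Finset.expect_add_distrib, ← Finset.mul_expect,
        ← Finset.expect_mul, ← e1, hA2, hB, Fintype.expect_const,
        mul_left_comm _ (2 : ℝ) (Complex.normSq _)]
      ring
    rw [expand]
    -- AM–GM with weights 6α and 24x², whose geometric mean is 12|x|√α. It adds 6 to the coefficient
    -- 12·4 of α·b already present.
    have b2 : 24 * x * w1.re ≤ b * (6 * α + 24 * x ^ 2) := by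
      have h1 : w1.re ^ 2 ≤ α * (b * b) := by
        refine le_trans ?_ hw1'
        rw [Complex.normSq_apply]; nlinarith [mul_self_nonneg w1.im]
      refine le_of_abs_le (abs_le_of_sq_le_sq ?_ (by positivity))
      have h2 : (24 * x * w1.re) ^ 2 ≤ 576 * x ^ 2 * (α * (b * b)) := by
        nlinarith [mul_le_mul_of_nonneg_left h1 (sq_nonneg x)]
      nlinarith [mul_nonneg (mul_nonneg hb hb) (sq_nonneg (6 * α - 24 * x ^ 2))]
    nlinarith [mul_nonneg hα hb, mul_nonneg hα (sq_nonneg x), mul_nonneg hb (sq_nonneg x),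
      mul_nonneg hb hb, sq_nonneg (x ^ 2)]

/-- The form `⟨g ⊗ h|Y|g ⊗ h⟩` on product vectors. -/
def biform {d : ℕ} (Y : Matrix (Fin d × Fin d) (Fin d × Fin d) ℂ) (g h : Fin d → Phase) : ℂ :=
  ∑ a, ∑ b, ∑ a', ∑ b',
    Y (a, b) (a', b') * ((conj (vec g a) * vec g a') * (conj (vec h b) * vec h b'))

/-- The partial contraction `⟨g|Y|g⟩` of the first factor. -/
def contractLeft {d : ℕ} (Y : Matrix (Fin d × Fin d) (Fin d × Fin d) ℂ) (g : Fin d → Phase) :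
    Matrix (Fin d) (Fin d) ℂ :=
  Matrix.of fun b b' => sform (Matrix.of fun a a' => Y (a, b) (a', b')) g

lemma sum_comm_four {ι M : Type*} [Fintype ι] [AddCommMonoid M] (F : ι → ι → ι → ι → M) :
    ∑ b, ∑ b', ∑ a, ∑ a', F a b a' b' = ∑ a, ∑ b, ∑ a', ∑ b', F a b a' b' := by
  calc _ = ∑ b, ∑ a, ∑ b', ∑ a', F a b a' b' :=
        Finset.sum_congr rfl fun b _ => Finset.sum_comm
    _ = ∑ a, ∑ b, ∑ b', ∑ a', F a b a' b' := Finset.sum_comm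
    _ = _ := Finset.sum_congr rfl fun a _ => Finset.sum_congr rfl fun b _ => Finset.sum_comm

lemma sform_contractLeft {d : ℕ} (Y : Matrix (Fin d × Fin d) (Fin d × Fin d) ℂ)
    (g h : Fin d → Phase) : sform (contractLeft Y g) h = biform Y g h := by
  simp only [sform, contractLeft, Matrix.of_apply, biform, Finset.sum_mul]
  rw [sum_comm_four]
  refine Finset.sum_congr rfl fun a _ => Finset.sum_congr rfl fun b _ =>
    Finset.sum_congr rfl fun a' _ => Finset.sum_congr rfl fun b' _ => by ring

lemma contractLeft_isHermitian {d : ℕ} {Y : Matrix (Fin d × Fin d) (Fin d × Fin d) ℂ}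
    (hY : Y.IsHermitian) (g : Fin d → Phase) : (contractLeft Y g).IsHermitian := by
  ext b b'
  simp only [contractLeft, Matrix.conjTranspose_apply, Matrix.of_apply, RCLike.star_def,
    conj_sform]
  congr 1
  ext a a'
  simpa using hY.apply (a, b) (a', b')

lemma trace_contractLeft {d : ℕ} {Y : Matrix (Fin d × Fin d) (Fin d × Fin d) ℂ}
    (hY : ∀ a a', ∑ b, Y (a, b) (a', b) = 0) (g : Fin d → Phase) :
    (contractLeft Y g).trace = 0 := by
  simp only [Matrix.trace, Matrix.diag, contractLeft, Matrix.of_apply, sform]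
  rw [Finset.sum_comm]
  refine Finset.sum_eq_zero fun a _ => ?_
  rw [Finset.sum_comm]
  refine Finset.sum_eq_zero fun a' _ => ?_
  rw [← Finset.sum_mul, hY, zero_mul]

/-- Fourth-against-second moment bounds tensorise: apply the bound in `k`, expand the squared inner
mean as an average over pairs `k`, `k'`, then apply Cauchy–Schwarz and the bound in `i`. Each
direction costs one factor `c`. -/
lemma expect_four_le_of_slices {ι κ : Type*} [Fintype ι] [Fintype κ] {c : ℝ} (hc : 0 ≤ c)
    (f : ι → κ → ℝ) (h1 : ∀ i, 𝔼 k, f i k ^ 4 ≤ c * (𝔼 k, f i k ^ 2) ^ 2)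
    (h2 : ∀ k, 𝔼 i, f i k ^ 4 ≤ c * (𝔼 i, f i k ^ 2) ^ 2) :
    𝔼 i, 𝔼 k, f i k ^ 4 ≤ c ^ 2 * (𝔼 i, 𝔼 k, f i k ^ 2) ^ 2 := by
  have key : 𝔼 i, (𝔼 k, f i k ^ 2) ^ 2 ≤ c * (𝔼 i, 𝔼 k, f i k ^ 2) ^ 2 := by
    have e1 : 𝔼 i, (𝔼 k, f i k ^ 2) ^ 2 = 𝔼 k, 𝔼 k', 𝔼 i, f i k ^ 2 * f i k' ^ 2 := by
      simp only [sq (𝔼 k, f _ k ^ 2), Finset.expect_mul_expect]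
      rw [Finset.expect_comm]
      refine Finset.expect_congr rfl fun k _ => ?_
      rw [Finset.expect_comm]
    have e2 : ∀ k k', 𝔼 i, f i k ^ 2 * f i k' ^ 2 ≤
        c * ((𝔼 i, f i k ^ 2) * 𝔼 i, f i k' ^ 2) := by
      intro k k'
      have p1 : 0 ≤ 𝔼 i, f i k ^ 2 := Finset.expect_nonneg fun _ _ => sq_nonneg _
      have p2 : 0 ≤ 𝔼 i, f i k' ^ 2 := Finset.expect_nonneg fun _ _ => sq_nonneg _
      refine le_of_abs_le (abs_le_of_sq_le_sq ?_ (by positivity))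
      calc _ ≤ (𝔼 i, (f i k ^ 2) ^ 2) * 𝔼 i, (f i k' ^ 2) ^ 2 :=
            Finset.expect_mul_sq_le_sq_mul_sq _ _ _
        _ = (𝔼 i, f i k ^ 4) * 𝔼 i, f i k' ^ 4 := by simp only [← pow_mul]
        _ ≤ (c * (𝔼 i, f i k ^ 2) ^ 2) * (c * (𝔼 i, f i k' ^ 2) ^ 2) :=
            mul_le_mul (h2 k) (h2 k') (Finset.expect_nonneg fun _ _ => by positivity)
              (by positivity)
        _ = _ := by ring
    rw [e1]
    calc _ ≤ 𝔼 k, 𝔼 k', c * ((𝔼 i, f i k ^ 2) * 𝔼 i, f i k' ^ 2) :=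
          Finset.expect_le_expect fun k _ => Finset.expect_le_expect fun k' _ => e2 k k'
      _ = _ := by
          simp only [← Finset.mul_expect, ← Finset.expect_mul]
          rw [Finset.expect_comm, sq]
  calc _ ≤ 𝔼 i, c * (𝔼 k, f i k ^ 2) ^ 2 := Finset.expect_le_expect fun i _ => h1 i
    _ = c * 𝔼 i, (𝔼 k, f i k ^ 2) ^ 2 := by rw [Finset.mul_expect]
    _ ≤ c * (c * (𝔼 i, 𝔼 k, f i k ^ 2) ^ 2) := mul_le_mul_of_nonneg_left key hc
    _ = _ := by ring

/-- Interpolation of L² between L¹ and L⁴: with absolute moments M₁, …, M₄, Cauchy–Schwarz gives M₂²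
≤ M₁M₃ and M₃² ≤ M₂M₄. -/
lemma expect_sq_le_of_four_le {ι : Type*} [Fintype ι] {c m : ℝ} (hm : 0 ≤ m)
    (f : ι → ℝ) (h2 : 𝔼 i, f i ^ 2 = m) (h4 : 𝔼 i, f i ^ 4 ≤ c ^ 2 * m ^ 2) :
    m ≤ (c * 𝔼 i, |f i|) ^ 2 := by
  set m1 := 𝔼 i, |f i|
  have hm1 : 0 ≤ m1 := Finset.expect_nonneg fun _ _ => abs_nonneg _
  set m3 := 𝔼 i, |f i| ^ 3
  have hm3 : 0 ≤ m3 := Finset.expect_nonneg fun _ _ => by positivity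
  have cs : ∀ u v : ι → ℝ, (∀ i, 0 ≤ u i) → (∀ i, 0 ≤ v i) →
      ∀ r : ι → ℝ, (∀ i, r i ^ 2 = u i * v i) → (𝔼 i, r i) ^ 2 ≤ (𝔼 i, u i) * 𝔼 i, v i := by
    intro u v hu hv r hr
    simp only [Fintype.expect_eq_sum_div_card, div_pow, div_mul_div_comm, ← sq]
    gcongr
    exact Finset.sum_sq_le_sum_mul_sum_of_sq_le_mul _ (fun i _ => hu i) (fun i _ => hv i)
      (fun i _ => (hr i).le)
  have h13 : m ^ 2 ≤ m1 * m3 := by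
    rw [← h2]
    refine cs _ _ (fun i => abs_nonneg _) (fun i => by positivity) _ fun i => ?_
    rw [← sq_abs (f i)]; ring
  have h24 : m3 ^ 2 ≤ m * (c ^ 2 * m ^ 2) := by
    calc m3 ^ 2 ≤ (𝔼 i, f i ^ 2) * 𝔼 i, f i ^ 4 := by
          refine cs _ _ (fun i => sq_nonneg _) (fun i => by positivity) _ fun i => ?_
          rw [← pow_mul, mul_comm 3 2, pow_mul, sq_abs]; ring
      _ ≤ _ := by rw [h2]; gcongr
  rcases hm.eq_or_lt with h0 | hpos
  · rw [← h0]; positivity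
  have : m ^ 3 * m ≤ m ^ 3 * (c * m1) ^ 2 := by
    calc m ^ 3 * m = (m ^ 2) ^ 2 := by ring
      _ ≤ (m1 * m3) ^ 2 := by gcongr
      _ = m1 ^ 2 * m3 ^ 2 := by ring
      _ ≤ m1 ^ 2 * (m * (c ^ 2 * m ^ 2)) := by gcongr
      _ = _ := by ring
  exact le_of_mul_le_mul_left this (by positivity)

/-- The exchange of the two tensor factors. -/
abbrev swapFactors {d : ℕ} (Y : Matrix (Fin d × Fin d) (Fin d × Fin d) ℂ) :
    Matrix (Fin d × Fin d) (Fin d × Fin d) ℂ :=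
  Y.submatrix Prod.swap Prod.swap

lemma biform_swap {d : ℕ} (Y : Matrix (Fin d × Fin d) (Fin d × Fin d) ℂ) (g h : Fin d → Phase) :
    biform (swapFactors Y) h g = biform Y g h := by
  simp only [biform, Matrix.submatrix_apply, Prod.swap_prod_mk]
  rw [Finset.sum_comm]
  refine Finset.sum_congr rfl fun a _ => Finset.sum_congr rfl fun b _ => ?_
  rw [Finset.sum_comm]
  refine Finset.sum_congr rfl fun a' _ => Finset.sum_congr rfl fun b' _ => by ring

lemma qform_contractLeft {d : ℕ} {Y : Matrix (Fin d × Fin d) (Fin d × Fin d) ℂ}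
    (h2 : ∀ a a', ∑ b, Y (a, b) (a', b) = 0) (g h : Fin d → Phase) :
    qform (contractLeft Y g) h = (biform Y g h).re := by
  rw [qform, trace_contractLeft h2, sub_zero, sform_contractLeft]

lemma expect_biform_four_right {d : ℕ} {Y : Matrix (Fin d × Fin d) (Fin d × Fin d) ℂ}
    (hY : Y.IsHermitian) (h2 : ∀ a a', ∑ b, Y (a, b) (a', b) = 0) (g : Fin d → Phase) :
    𝔼 h, (biform Y g h).re ^ 4 ≤ 14 * (𝔼 h, (biform Y g h).re ^ 2) ^ 2 := by
  simp only [← qform_contractLeft h2]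
  rw [expect_qform_sq (contractLeft_isHermitian hY g)]
  exact expect_qform_four_le (contractLeft_isHermitian hY g)

/-- The product measurement distorts the norm of operators with vanishing marginals by a bounded
factor only. -/
theorem frobSq_le_expect_abs_biform {d : ℕ} {Y : Matrix (Fin d × Fin d) (Fin d × Fin d) ℂ}
    (hY : Y.IsHermitian) (h1 : ∀ b b', ∑ a, Y (a, b) (a, b') = 0)
    (h2 : ∀ a a', ∑ b, Y (a, b) (a', b) = 0) :
    frobSq Y ≤ (14 * 𝔼 g, 𝔼 h, |(biform Y g h).re|) ^ 2 := by
  have hY' : (swapFactors Y).IsHermitian := hY.submatrix _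
  -- The vanishing partial traces make the form centred in each argument separately, so the two
  -- variance identities compose without lower-order terms.
  have e2 : 𝔼 g, 𝔼 h, (biform Y g h).re ^ 2 = frobSq Y := by
    simp only [← qform_contractLeft h2, expect_qform_sq (contractLeft_isHermitian hY _)]
    simp only [frobSq, contractLeft, Matrix.of_apply, Finset.expect_sum_comm]
    have : ∀ b b', 𝔼 g, Complex.normSq (sform (Matrix.of fun a a' => Y (a, b) (a', b')) g) =
        ∑ a, ∑ a', Complex.normSq (Y (a, b) (a', b')) := by
      intro b b'
      have := expect_normSq_sform (Matrix.of fun a a' => Y (a, b) (a', b'))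
      have ht : (Matrix.of fun a a' => Y (a, b) (a', b')).trace = 0 := by
        simpa [Matrix.trace] using h1 b b'
      simpa [ht, frobSq] using this
    simp only [this, Fintype.sum_prod_type]
    exact sum_comm_four fun a b a' b' => Complex.normSq (Y (a, b) (a', b'))
  have e4 := expect_four_le_of_slices (c := 14) (by norm_num) (fun g h => (biform Y g h).re)
    (expect_biform_four_right hY h2)
    (fun h => by
      simpa only [biform_swap] using expect_biform_four_right hY' (fun a a' => h1 a a') h)
  simp only [← Finset.expect_product', Finset.univ_product_univ] at e2 e4 ⊢
  rw [e2] at e4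
  exact expect_sq_le_of_four_le (frobSq_nonneg Y) _ e2 e4
end
end QuditGraph

/-! ### Monotonicity of relative entropy under a measurement. -/

namespace QuditGraph
open scoped ComplexOrder
noncomputable section
open scoped BigOperators ComplexConjugate
open Finset

/-- Bessel's inequality: the rows of `e` are orthonormal, and `w` is the residual of the orthogonal
projection onto their span. -/
lemma sum_normSq_vecMul_le {L G : Type*} [Fintype L] [Fintype G] [DecidableEq L]
    {e : Matrix L G ℂ} (he : e * e.conjTranspose = 1) (y : G → ℂ) :
    ∑ l, Complex.normSq (∑ g, y g * conj (e l g)) ≤ ∑ g, Complex.normSq (y g) := by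
  set z : L → ℂ := fun l => ∑ g, y g * conj (e l g) with hz
  set w : G → ℂ := fun g => y g - ∑ l, z l * e l g with hw
  have horth : ∀ l, ∑ g, w g * conj (e l g) = 0 := by
    intro l
    have h1 : ∀ l', ∑ g, e l' g * conj (e l g) = if l' = l then 1 else 0 := by
      intro l'
      have := congrFun (congrFun he l') l
      simpa [Matrix.mul_apply, Matrix.one_apply] using this
    simp only [hw, sub_mul, Finset.sum_sub_distrib, Finset.sum_mul, mul_assoc]
    rw [Finset.sum_comm]
    simp only [← Finset.mul_sum, h1]
    simp [hz]
  have key : ((∑ g, Complex.normSq (y g) : ℝ) : ℂ) =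
      ((∑ g, Complex.normSq (w g) + ∑ l, Complex.normSq (z l) : ℝ) : ℂ) := by
    have hy : ∀ g, y g = w g + ∑ l, z l * e l g := fun g => by simp [hw]
    have e1 : ∑ g, w g * conj (y g) = ∑ g, w g * conj (w g) := by
      have : ∑ g, w g * conj (∑ l, z l * e l g) = 0 := by
        simp only [map_sum, map_mul, Finset.mul_sum]
        rw [Finset.sum_comm]
        refine Finset.sum_eq_zero fun l _ => ?_
        rw [← mul_zero (conj (z l)), ← horth l, Finset.mul_sum]
        exact Finset.sum_congr rfl fun g _ => by ring
      calc _ = ∑ g, (w g * conj (w g) + w g * conj (∑ l, z l * e l g)) :=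
            Finset.sum_congr rfl fun g _ => by rw [← mul_add, ← map_add, ← hy]
        _ = _ := by rw [Finset.sum_add_distrib, this, add_zero]
    have e2 : ∑ g, (∑ l, z l * e l g) * conj (y g) = ∑ l, z l * conj (z l) := by
      simp only [hz, map_sum, map_mul, Complex.conj_conj, Finset.sum_mul, Finset.mul_sum]
      rw [Finset.sum_comm]
      refine Finset.sum_congr rfl fun l _ => ?_
      refine Finset.sum_congr rfl fun g _ => Finset.sum_congr rfl fun g' _ => by ring
    push_cast
    simp only [← Complex.mul_conj]
    rw [← e1, ← e2, ← Finset.sum_add_distrib]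
    exact Finset.sum_congr rfl fun g _ => by rw [← add_mul, ← hy]
  rw [Complex.ofReal_injective key]
  have : 0 ≤ ∑ g, Complex.normSq (w g) := Finset.sum_nonneg fun _ _ => Complex.normSq_nonneg _
  linarith

section Core

variable {K L G : Type*} [Fintype K] [Fintype L] [Fintype G] [DecidableEq K] [DecidableEq L]
  {c : Matrix K G ℂ} {e : Matrix L G ℂ} {U : Matrix K L ℂ}

/-- The outcome distribution of the measurement with overlaps `c` in the eigenbasis of a state with
eigenvalues `r`. -/
def outcome {K G : Type*} [Fintype K] (c : Matrix K G ℂ) (r : K → ℝ) (g : G) : ℝ :=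
  ∑ k, r k * Complex.normSq (c k g)

lemma outcome_nonneg {K G : Type*} [Fintype K] (c : Matrix K G ℂ) {r : K → ℝ} (hr : ∀ k, 0 ≤ r k)
    (g : G) : 0 ≤ outcome c r g :=
  Finset.sum_nonneg fun k _ => mul_nonneg (hr k) (Complex.normSq_nonneg _)

/-- Data processing for a χ²-type divergence, through p²/D = sup over x of 2xp − x²D. The maximiser
on the outcome side defines the operator Σ x(g)|g⟩⟨g|. Its matrix elements `ξ` between the two
eigenbases are admissible trial values on the side weighted by |U|², and Bessel's inequality bounds
the quadratic cost. -/
lemma sum_outcome_sq_div_le (hc : c * c.conjTranspose = 1) (he : e * e.conjTranspose = 1)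
    (hUe : U * e = c) {r : K → ℝ} {t : L → ℝ}
    (hr : ∀ k, 0 ≤ r k) (ht : ∀ l, 0 ≤ t l) {s : ℝ} (hs : 0 < s) :
    ∑ g, outcome c r g ^ 2 / (outcome e t g + s * outcome c r g) ≤
      ∑ k, ∑ l, Complex.normSq (U k l) * (r k ^ 2 / (t l + s * r k)) := by
  set p := outcome c r
  set q := outcome e t
  have hp : ∀ g, 0 ≤ p g := outcome_nonneg c hr
  have hq : ∀ g, 0 ≤ q g := outcome_nonneg e ht
  set x : G → ℝ := fun g => p g / (q g + s * p g) with hx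
  set ξ : K → L → ℂ := fun k l => ∑ g, (x g : ℂ) * (c k g * conj (e l g)) with hξ
  have hlin : ∀ k, ∑ l, ξ k l * conj (U k l) = ((∑ g, x g * Complex.normSq (c k g) : ℝ) : ℂ) := by
    intro k
    have h1 : ∀ g, ∑ l, conj (e l g) * conj (U k l) = conj (c k g) := by
      intro g
      rw [← hUe, Matrix.mul_apply, map_sum]
      exact Finset.sum_congr rfl fun l _ => by rw [map_mul, mul_comm]
    simp only [hξ, Finset.sum_mul]
    rw [Finset.sum_comm]
    push_cast
    refine Finset.sum_congr rfl fun g _ => ?_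
    rw [← Complex.mul_conj, ← h1 g, Finset.mul_sum, Finset.mul_sum]
    exact Finset.sum_congr rfl fun l _ => by ring
  have hq1 : ∀ k, ∑ l, Complex.normSq (ξ k l) ≤ ∑ g, x g ^ 2 * Complex.normSq (c k g) := by
    intro k
    have := sum_normSq_vecMul_le he (fun g => (x g : ℂ) * c k g)
    simpa only [map_mul, Complex.normSq_ofReal, ← sq, mul_assoc] using this
  have hq2 : ∀ l, ∑ k, Complex.normSq (ξ k l) ≤ ∑ g, x g ^ 2 * Complex.normSq (e l g) := by
    intro l
    have := sum_normSq_vecMul_le hc (fun g => (x g : ℂ) * e l g)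
    simp only [map_mul, Complex.normSq_ofReal, ← sq] at this
    refine le_trans (le_of_eq (Finset.sum_congr rfl fun k _ => ?_)) this
    rw [← Complex.normSq_conj]
    congr 1
    simp only [hξ, map_sum, map_mul, Complex.conj_conj, Complex.conj_ofReal]
    exact Finset.sum_congr rfl fun g _ => by ring
  have hterm : ∀ k l, 2 * (r k * (ξ k l * conj (U k l)).re) -
      (t l + s * r k) * Complex.normSq (ξ k l) ≤
      Complex.normSq (U k l) * (r k ^ 2 / (t l + s * r k)) := by
    intro k l
    rcases (hr k).eq_or_lt with h0 | hpos
    · rw [← h0]; simp [mul_nonneg (ht l) (Complex.normSq_nonneg _)]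
    have hD : 0 < t l + s * r k := by have := ht l; positivity
    have hre : (ξ k l * conj (U k l)).re ^ 2 ≤
        Complex.normSq (ξ k l) * Complex.normSq (U k l) := by
      rw [← Complex.normSq_conj (U k l), ← map_mul, Complex.normSq_apply]
      nlinarith [mul_self_nonneg (ξ k l * conj (U k l)).im]
    set D := t l + s * r k
    set n1 := Complex.normSq (ξ k l)
    set n2 := Complex.normSq (U k l)
    have hn1 : 0 ≤ n1 := Complex.normSq_nonneg _
    have hn2 : 0 ≤ n2 := Complex.normSq_nonneg _
    have h2 : 2 * (r k * (ξ k l * conj (U k l)).re) ≤ D * n1 + n2 * (r k ^ 2 / D) := by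
      refine le_of_abs_le (abs_le_of_sq_le_sq ?_ (by positivity))
      have e1 : (D * n1) * (n2 * (r k ^ 2 / D)) = r k ^ 2 * (n1 * n2) := by field_simp
      nlinarith [sq_nonneg (D * n1 - n2 * (r k ^ 2 / D)),
        mul_le_mul_of_nonneg_left hre (sq_nonneg (r k))]
    linarith
  have hsum : ∑ g, p g ^ 2 / (q g + s * p g) = ∑ g, (2 * x g * p g - x g ^ 2 * (q g + s * p g)) := by
    refine Finset.sum_congr rfl fun g _ => ?_
    rcases (add_nonneg (hq g) (mul_nonneg hs.le (hp g))).eq_or_lt with h0 | hpos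
    · simp [hx, ← h0]
    · simp only [hx]; field_simp; ring
  have exch : ∀ (y : G → ℝ), ∑ g, y g * p g = ∑ k, r k * ∑ g, y g * Complex.normSq (c k g) := by
    intro y
    simp only [p, outcome, Finset.mul_sum]
    rw [Finset.sum_comm]
    exact Finset.sum_congr rfl fun k _ => Finset.sum_congr rfl fun g _ => by ring
  have exch' : ∀ (y : G → ℝ), ∑ g, y g * q g = ∑ l, t l * ∑ g, y g * Complex.normSq (e l g) := by
    intro y
    simp only [q, outcome, Finset.mul_sum]
    rw [Finset.sum_comm]
    exact Finset.sum_congr rfl fun k _ => Finset.sum_congr rfl fun g _ => by ring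
  calc _ = 2 * ∑ g, x g * p g - ∑ g, x g ^ 2 * q g - s * ∑ g, x g ^ 2 * p g := by
        rw [hsum, Finset.mul_sum, Finset.mul_sum, ← Finset.sum_sub_distrib, ← Finset.sum_sub_distrib]
        exact Finset.sum_congr rfl fun g _ => by ring
    _ ≤ 2 * ∑ k, r k * (∑ l, (ξ k l * conj (U k l)).re) - ∑ l, t l * ∑ k, Complex.normSq (ξ k l)
          - s * ∑ k, r k * ∑ l, Complex.normSq (ξ k l) := by
        have a1 : ∀ k, ∑ l, (ξ k l * conj (U k l)).re = ∑ g, x g * Complex.normSq (c k g) := by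
          intro k
          rw [← Complex.re_sum, hlin, Complex.ofReal_re]
        simp only [a1, exch, exch']
        have b1 := Finset.sum_le_sum fun l (_ : l ∈ Finset.univ) =>
          mul_le_mul_of_nonneg_left (hq2 l) (ht l)
        have b2 := mul_le_mul_of_nonneg_left (Finset.sum_le_sum fun k (_ : k ∈ Finset.univ) =>
          mul_le_mul_of_nonneg_left (hq1 k) (hr k)) hs.le
        linarith
    _ = ∑ k, ∑ l, (2 * (r k * (ξ k l * conj (U k l)).re) -
          (t l + s * r k) * Complex.normSq (ξ k l)) := by
        have c1 : ∑ l, t l * ∑ k, Complex.normSq (ξ k l) =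
            ∑ k, ∑ l, t l * Complex.normSq (ξ k l) := by
          simp only [Finset.mul_sum]; rw [Finset.sum_comm]
        rw [c1]
        simp only [Finset.mul_sum, ← Finset.sum_sub_distrib]
        exact Finset.sum_congr rfl fun k _ => Finset.sum_congr rfl fun l _ => by ring
    _ ≤ _ := Finset.sum_le_sum fun k _ => Finset.sum_le_sum fun l _ => hterm k l

/-- Monotonicity of the relative entropy under a measurement. -/
lemma sum_outcome_log_le (hc : c * c.conjTranspose = 1) (he : e * e.conjTranspose = 1)
    (hUe : U * e = c) {r : K → ℝ} {t : L → ℝ}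
    (hr : ∀ k, 0 ≤ r k) (ht : ∀ l, 0 ≤ t l)
    (hsupp : ∀ k l, t l = 0 → Complex.normSq (U k l) * r k = 0)
    (hsupp' : ∀ g, outcome e t g = 0 → outcome c r g = 0)
    (hsum : ∑ k, ∑ l, Complex.normSq (U k l) * r k = 1) (hsum' : ∑ g, outcome c r g = 1) :
    ∑ g, outcome c r g * (Real.log (outcome c r g) - Real.log (outcome e t g)) ≤
      ∑ k, ∑ l, Complex.normSq (U k l) * r k * (Real.log (r k) - Real.log (t l)) := by
  set p := outcome c r with hpdef
  set q := outcome e t with hqdef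
  have hp : ∀ g, 0 ≤ p g := outcome_nonneg c hr
  have hq : ∀ g, 0 ≤ q g := outcome_nonneg e ht
  -- F interpolates the desired inequality: F vanishes at 0, its derivative is the difference in
  -- `sum_outcome_sq_div_le`, and as s → ∞ the log s terms cancel because both weights have total
  -- mass one, leaving the difference of relative entropies.
  set F : ℝ → ℝ := fun s =>
    ∑ k, ∑ l, Complex.normSq (U k l) * r k * (Real.log (t l + s * r k) - Real.log (t l)) -
      ∑ g, p g * (Real.log (q g + s * p g) - Real.log (q g)) with hF
  have term : ∀ (w x y s : ℝ), 0 ≤ x → 0 ≤ y → 0 ≤ s → (y = 0 → w * x = 0) →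
      HasDerivAt (fun s => w * x * (Real.log (y + s * x) - Real.log y)) (w * (x ^ 2 / (y + s * x))) s := by
    intro w x y s hx hy hs h0
    rcases hy.eq_or_lt with h | h
    · have h1 := h0 h.symm
      have h2 : w * (x ^ 2 / (y + s * x)) = 0 := by
        rw [sq, mul_div_assoc, ← mul_assoc, h1, zero_mul]
      rw [h2]
      simp only [h1, zero_mul]
      exact hasDerivAt_const _ _
    · have hne : y + s * x ≠ 0 := by positivity
      have h1 : HasDerivAt (fun s => y + s * x) x s := by
        simpa using ((hasDerivAt_id s).mul_const x).const_add y
      have h2 := ((h1.log hne).sub_const (Real.log y)).const_mul (w * x)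
      rw [show w * (x ^ 2 / (y + s * x)) = w * x * (x / (y + s * x)) by ring]
      exact h2
  have hderiv : ∀ s, 0 ≤ s → HasDerivAt F
      (∑ k, ∑ l, Complex.normSq (U k l) * (r k ^ 2 / (t l + s * r k)) -
        ∑ g, p g ^ 2 / (q g + s * p g)) s := by
    intro s hs
    refine HasDerivAt.sub ?_ ?_
    · refine HasDerivAt.fun_sum fun k _ => HasDerivAt.fun_sum fun l _ => ?_
      exact term _ _ _ _ (hr k) (ht l) hs (hsupp k l)
    · refine HasDerivAt.fun_sum fun g _ => ?_
      have := term 1 (p g) (q g) s (hp g) (hq g) hs (by simpa using hsupp' g)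
      simpa using this
  have hmono : MonotoneOn F (Set.Ici 0) := by
    refine monotoneOn_of_deriv_nonneg (convex_Ici 0)
      (fun s hs => (hderiv s hs).continuousAt.continuousWithinAt) ?_ ?_
    · intro s hs
      rw [interior_Ici] at hs
      exact (hderiv s (le_of_lt hs)).differentiableAt.differentiableWithinAt
    · intro s hs
      rw [interior_Ici] at hs
      rw [(hderiv s (le_of_lt hs)).deriv, sub_nonneg]
      exact sum_outcome_sq_div_le hc he hUe hr ht hs
  have hF0 : F 0 = 0 := by simp [hF]
  -- This is F(s) ≥ 0 at s = 1/δ, with log δ cancelled and the term δq dropped on the outcome side.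
  -- Then δ → 0.
  have hbound : ∀ δ : ℝ, 0 < δ →
      ∑ g, p g * (Real.log (p g) - Real.log (q g)) ≤
      ∑ k, ∑ l, Complex.normSq (U k l) * r k * (Real.log (r k + δ * t l) - Real.log (t l)) := by
    intro δ hδ
    have h1 : 0 ≤ F δ⁻¹ := by
      rw [← hF0]
      exact hmono (Set.mem_Ici.2 le_rfl) (Set.mem_Ici.2 (by positivity)) (by positivity)
    have hlog : ∀ y x : ℝ, 0 ≤ y → 0 < x →
        Real.log (y + δ⁻¹ * x) = Real.log (x + δ * y) - Real.log δ := by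
      intro y x hy hx
      rw [← Real.log_div (by positivity) (by positivity)]
      congr 1
      field_simp
      ring
    have e1 : ∑ k, ∑ l, Complex.normSq (U k l) * r k *
        (Real.log (t l + δ⁻¹ * r k) - Real.log (t l)) =
        ∑ k, ∑ l, Complex.normSq (U k l) * r k * (Real.log (r k + δ * t l) - Real.log (t l))
          - Real.log δ := by
      rw [← one_mul (Real.log δ), ← hsum, Finset.sum_mul, ← Finset.sum_sub_distrib]
      refine Finset.sum_congr rfl fun k _ => ?_
      rw [Finset.sum_mul, ← Finset.sum_sub_distrib]
      refine Finset.sum_congr rfl fun l _ => ?_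
      rcases (hr k).eq_or_lt with h | h
      · simp [← h]
      · rw [hlog _ _ (ht l) h]; ring
    have e2 : ∑ g, p g * (Real.log (p g) - Real.log (q g)) - Real.log δ ≤
        ∑ g, p g * (Real.log (q g + δ⁻¹ * p g) - Real.log (q g)) := by
      rw [← one_mul (Real.log δ), ← hsum', Finset.sum_mul, ← Finset.sum_sub_distrib]
      refine Finset.sum_le_sum fun g _ => ?_
      rcases (hp g).eq_or_lt with h | h
      · simp [← h]
      · rw [hlog _ _ (hq g) h]
        have : Real.log (p g) ≤ Real.log (p g + δ * q g) :=
          Real.log_le_log h (by have := mul_nonneg hδ.le (hq g); linarith)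
        nlinarith
    simp only [hF] at h1
    linarith
  have hlim : Filter.Tendsto (fun δ : ℝ => ∑ k, ∑ l, Complex.normSq (U k l) * r k *
      (Real.log (r k + δ * t l) - Real.log (t l))) (nhdsWithin 0 (Set.Ioi 0))
      (nhds (∑ k, ∑ l, Complex.normSq (U k l) * r k * (Real.log (r k) - Real.log (t l)))) := by
    refine tendsto_finsetSum _ fun k _ => tendsto_finsetSum _ fun l _ => ?_
    rcases (hr k).eq_or_lt with h | h
    · simp [← h]
    · refine Filter.Tendsto.const_mul _ (Filter.Tendsto.sub_const ?_ _)
      have hc : ContinuousAt (fun δ : ℝ => Real.log (r k + δ * t l)) 0 := by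
        refine ContinuousAt.log (by fun_prop) (by simpa using h.ne')
      have := hc.tendsto
      simp only [zero_mul, add_zero] at this
      exact this.mono_left nhdsWithin_le_nhds
  exact ge_of_tendsto hlim (Filter.eventually_of_mem self_mem_nhdsWithin fun δ hδ => hbound δ hδ)

end Core
end
end QuditGraph

/-! ### Measured mutual information is at most the quantum one. -/

namespace QuditGraph
open scoped ComplexOrder
noncomputable section
open scoped BigOperators ComplexConjugate
open Finset

/-- The logarithm splits wherever the weight is nonzero, since there both marginals are positive. -/
lemma sum_mul_log_mul_marginals {G H : Type*} [Fintype G] [Fintype H] {π : G × H → ℝ}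
    (hπ : ∀ x, 0 ≤ π x) {pA : G → ℝ} {pB : H → ℝ} (hA : ∀ g, ∑ h, π (g, h) = pA g)
    (hB : ∀ h, ∑ g, π (g, h) = pB h) :
    ∑ x : G × H, π x * Real.log (pA x.1 * pB x.2) =
      ∑ g, pA g * Real.log (pA g) + ∑ h, pB h * Real.log (pB h) := by
  have hle1 : ∀ g h, π (g, h) ≤ pA g := fun g h => by
    rw [← hA]
    exact Finset.single_le_sum (f := fun h => π (g, h)) (fun _ _ => hπ _) (Finset.mem_univ h)
  have hle2 : ∀ g h, π (g, h) ≤ pB h := fun g h => by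
    rw [← hB]
    exact Finset.single_le_sum (f := fun g => π (g, h)) (fun _ _ => hπ _) (Finset.mem_univ g)
  have e1 : ∀ x : G × H, π x * Real.log (pA x.1 * pB x.2) =
      π x * Real.log (pA x.1) + π x * Real.log (pB x.2) := by
    rintro ⟨g, h⟩
    rcases (hπ (g, h)).eq_or_lt with h0 | h0
    · simp [← h0]
    · rw [Real.log_mul (h0.trans_le (hle1 g h)).ne' (h0.trans_le (hle2 g h)).ne', mul_add]
  simp only [e1, Finset.sum_add_distrib, Fintype.sum_prod_type]
  congr 1
  · exact Finset.sum_congr rfl fun g _ => by rw [← Finset.sum_mul, hA]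
  · rw [Finset.sum_comm]
    exact Finset.sum_congr rfl fun h _ => by rw [← Finset.sum_mul, hB]

/-- The diagonal entries `⟨K_g|ρ|K_g⟩` for the columns `K_g` of a matrix. -/
def colForm {ι G : Type*} [Fintype ι] (ρ : Matrix ι ι ℂ) (K : Matrix ι G ℂ) (g : G) : ℝ :=
  ((K.conjTranspose * ρ * K) g g).re

lemma colForm_nonneg {ι G : Type*} [Fintype ι] {ρ : Matrix ι ι ℂ} (hρ : ρ.PosSemidef)
    (K : Matrix ι G ℂ) (g : G) : 0 ≤ colForm ρ K g := by
  have h : K.conjTranspose * ρ * K = fun g g' => star (fun x => K x g) ⬝ᵥ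
      (ρ.mulVec fun x => K x g') := by
    ext g g'
    rw [Matrix.mul_assoc]
    rfl
  rw [colForm, h]
  exact hρ.re_dotProduct_nonneg _

/-- The matrix whose columns are the tensor products of the columns of two matrices. -/
def prodCols {ι α β G H : Type*} (e : ι ≃ α × β) (φ : Matrix α G ℂ) (ψ : Matrix β H ℂ) :
    Matrix ι (G × H) ℂ :=
  Matrix.of fun x gh => φ (e x).1 gh.1 * ψ (e x).2 gh.2

lemma prodCols_mul_conjTranspose {ι α β G H : Type*} {e : ι ≃ α × β} [DecidableEq ι]
    [DecidableEq α] [DecidableEq β] [Fintype G] [Fintype H] {φ : Matrix α G ℂ} {ψ : Matrix β H ℂ}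
    (hφ : φ * φ.conjTranspose = 1) (hψ : ψ * ψ.conjTranspose = 1) :
    prodCols e φ ψ * (prodCols e φ ψ).conjTranspose = 1 := by
  ext x y
  have h1 := congrFun (congrFun hφ (e x).1) (e y).1
  have h2 := congrFun (congrFun hψ (e x).2) (e y).2
  have h3 : (prodCols e φ ψ * (prodCols e φ ψ).conjTranspose) x y =
      (φ * φ.conjTranspose) (e x).1 (e y).1 * (ψ * ψ.conjTranspose) (e x).2 (e y).2 := by
    simp only [Matrix.mul_apply, prodCols, Matrix.conjTranspose_apply, Matrix.of_apply,
      Fintype.sum_prod_type, Finset.sum_mul_sum, star_mul']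
    exact Finset.sum_congr rfl fun a _ => Finset.sum_congr rfl fun b _ => by ring
  rw [h3, h1, h2, Matrix.one_apply, Matrix.one_apply, Matrix.one_apply]
  by_cases h : x = y
  · simp [h]
  · have : ¬ ((e x).1 = (e y).1 ∧ (e x).2 = (e y).2) := fun h' =>
      h (e.injective (Prod.ext h'.1 h'.2))
    simp only [h, if_false]
    by_cases h1 : (e x).1 = (e y).1
    · have h2 : (e x).2 ≠ (e y).2 := fun h2 => this ⟨h1, h2⟩
      simp [h1, h2]
    · simp [h1]

section Bipartite

variable {ι α β G H : Type*} [Fintype ι] [Fintype α] [Fintype β] {e : ι ≃ α × β}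

lemma sum_equiv_prod (e : ι ≃ α × β) (F : ι → ℂ) : ∑ x, F x = ∑ a, ∑ b, F (e.symm (a, b)) := by
  rw [← Fintype.sum_prod_type', ← e.symm.sum_comp]

lemma prodCols_conjTranspose_mul {G' H' : Type*} (φ : Matrix α G ℂ) (ψ : Matrix β H ℂ)
    (φ' : Matrix α G' ℂ) (ψ' : Matrix β H' ℂ) (x : G × H) (y : G' × H') :
    ((prodCols e φ ψ).conjTranspose * prodCols e φ' ψ') x y =
      (φ.conjTranspose * φ') x.1 y.1 * (ψ.conjTranspose * ψ') x.2 y.2 := by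
  simp only [Matrix.mul_apply, prodCols, Matrix.conjTranspose_apply, Matrix.of_apply,
    sum_equiv_prod e, Equiv.apply_symm_apply, Finset.sum_mul_sum, star_mul']
  exact Finset.sum_congr rfl fun a _ => Finset.sum_congr rfl fun b _ => by ring

/-- The columns of `ψ` resolve the identity on β, so summing over their outcomes is a partial trace.
-/
lemma sum_colForm_prodCols_right [Fintype H] [DecidableEq β] {ρ : Matrix ι ι ℂ} {ρA : Matrix α α ℂ}
    (hA : ∀ a a', ρA a a' = ∑ b, ρ (e.symm (a, b)) (e.symm (a', b)))
    (φ : Matrix α G ℂ) {ψ : Matrix β H ℂ} (hψ : ψ * ψ.conjTranspose = 1) (g : G) :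
    ∑ h, colForm ρ (prodCols e φ ψ) (g, h) = colForm ρA φ g := by
  have hψ' : ∀ b b', ∑ h, conj (ψ b h) * ψ b' h = if b = b' then 1 else 0 := by
    intro b b'
    have := congrFun (congrFun hψ b') b
    simp only [Matrix.mul_apply, Matrix.conjTranspose_apply, RCLike.star_def,
      Matrix.one_apply] at this
    simp only [mul_comm (conj _), this, eq_comm]
  simp only [colForm, ← Complex.re_sum]
  congr 1
  simp only [Matrix.mul_apply, prodCols, Matrix.conjTranspose_apply, Matrix.of_apply,
    sum_equiv_prod e, Equiv.apply_symm_apply, hA, Finset.sum_mul, Finset.mul_sum, star_mul',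
    RCLike.star_def]
  calc _ = ∑ a', ∑ b', ∑ a, ∑ b, conj (φ a g) * ρ (e.symm (a, b)) (e.symm (a', b')) * φ a' g *
        ∑ h, conj (ψ b h) * ψ b' h := by
        rw [Finset.sum_comm]
        refine Finset.sum_congr rfl fun a' _ => ?_
        rw [Finset.sum_comm]
        refine Finset.sum_congr rfl fun b' _ => ?_
        rw [Finset.sum_comm]
        refine Finset.sum_congr rfl fun a _ => ?_
        rw [Finset.sum_comm]
        refine Finset.sum_congr rfl fun b _ => ?_
        rw [Finset.mul_sum]
        exact Finset.sum_congr rfl fun h _ => by ring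
    _ = _ := by
        simp only [hψ', mul_ite, mul_one, mul_zero, Finset.sum_ite_eq', Finset.mem_univ, if_true]
        exact Finset.sum_congr rfl fun a' _ => Finset.sum_comm

lemma sum_colForm_prodCols_left [Fintype G] [DecidableEq α] {ρ : Matrix ι ι ℂ} {ρB : Matrix β β ℂ}
    (hB : ∀ b b', ρB b b' = ∑ a, ρ (e.symm (a, b)) (e.symm (a, b')))
    {φ : Matrix α G ℂ} (ψ : Matrix β H ℂ) (hφ : φ * φ.conjTranspose = 1) (h : H) :
    ∑ g, colForm ρ (prodCols e φ ψ) (g, h) = colForm ρB ψ h := by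
  rw [← sum_colForm_prodCols_right (e := e.trans (Equiv.prodComm α β)) (ρ := ρ) (by simpa using hB)
    ψ hφ h]
  refine Finset.sum_congr rfl fun g _ => ?_
  simp only [colForm, Matrix.mul_apply, prodCols, Matrix.conjTranspose_apply, Matrix.of_apply,
    Equiv.trans_apply, Equiv.prodComm_apply, Prod.fst_swap, Prod.snd_swap, mul_comm (φ _ _)]

variable [DecidableEq ι]

lemma sum_normSq_row {X : Type*} [Fintype X] {M : Matrix ι X ℂ} (hM : M * M.conjTranspose = 1)
    (k : ι) : ∑ l, Complex.normSq (M k l) = 1 := by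
  have := congrFun (congrFun hM k) k
  simp only [Matrix.mul_apply, Matrix.conjTranspose_apply, RCLike.star_def, Complex.mul_conj,
    Matrix.one_apply_eq] at this
  exact_mod_cast this

lemma exists_spectral (ρ : State ι) : ∃ V : Matrix ι ι ℂ, V * V.conjTranspose = 1 ∧
    V.conjTranspose * V = 1 ∧
    V.conjTranspose * ρ.mat * V =
      Matrix.diagonal fun i => ((ρ.posSemidef.isHermitian.eigenvalues i : ℝ) : ℂ) := by
  refine ⟨ρ.posSemidef.isHermitian.eigenvectorUnitary, ?_, ?_, ?_⟩
  · exact Unitary.coe_mul_star_self _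
  · exact Unitary.coe_star_mul_self _
  · have := ρ.posSemidef.isHermitian.conjStarAlgAut_star_eigenvectorUnitary
    rw [Unitary.conjStarAlgAut_star_apply] at this
    exact this

lemma colForm_eq_outcome {ρ V : Matrix ι ι ℂ} {r : ι → ℝ} (hV : V * V.conjTranspose = 1)
    (hρ : V.conjTranspose * ρ * V = Matrix.diagonal fun i => (r i : ℂ)) (K : Matrix ι G ℂ)
    (g : G) : colForm ρ K g = outcome (V.conjTranspose * K) r g := by
  have h : K.conjTranspose * ρ * K = (V.conjTranspose * K).conjTranspose *
      (Matrix.diagonal fun i => (r i : ℂ)) * (V.conjTranspose * K) := by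
    rw [← hρ, Matrix.conjTranspose_mul, Matrix.conjTranspose_conjTranspose]
    calc _ = K.conjTranspose * (V * V.conjTranspose) * ρ * ((V * V.conjTranspose) * K) := by
          rw [hV]; simp
      _ = _ := by simp only [Matrix.mul_assoc]
  rw [colForm, h, Matrix.mul_apply, Complex.re_sum, outcome]
  refine Finset.sum_congr rfl fun k _ => ?_
  rw [Matrix.mul_diagonal, Matrix.conjTranspose_apply, RCLike.star_def, mul_right_comm,
    ← Complex.normSq_eq_conj_mul_self, ← Complex.ofReal_mul, Complex.ofReal_re, mul_comm]

/-- The mutual information does not increase when both subsystems are measured. -/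
theorem measured_mutualInfo_le [DecidableEq α] [DecidableEq β] [Fintype G] [Fintype H] (ρ : State ι) (ρA : State α) (ρB : State β)
    (hA : ∀ a a', ρA.mat a a' = ∑ b, ρ.mat (e.symm (a, b)) (e.symm (a', b)))
    (hB : ∀ b b', ρB.mat b b' = ∑ a, ρ.mat (e.symm (a, b)) (e.symm (a, b')))
    {φ : Matrix α G ℂ} {ψ : Matrix β H ℂ} (hφ : φ * φ.conjTranspose = 1)
    (hψ : ψ * ψ.conjTranspose = 1) :
    ∑ x, colForm ρ.mat (prodCols e φ ψ) x * Real.log (colForm ρ.mat (prodCols e φ ψ) x)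
      - ∑ g, colForm ρA.mat φ g * Real.log (colForm ρA.mat φ g)
      - ∑ h, colForm ρB.mat ψ h * Real.log (colForm ρB.mat ψ h)
      ≤ ρA.entropy + ρB.entropy - ρ.entropy := by
  obtain ⟨V, hV, hV', hVρ⟩ := exists_spectral ρ
  obtain ⟨VA, hVA, hVA', hVρA⟩ := exists_spectral ρA
  obtain ⟨VB, hVB, hVB', hVρB⟩ := exists_spectral ρB
  set r := ρ.posSemidef.isHermitian.eigenvalues with hr
  set tA := ρA.posSemidef.isHermitian.eigenvalues with htA
  set tB := ρB.posSemidef.isHermitian.eigenvalues with htB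
  have hr0 : ∀ k, 0 ≤ r k := ρ.posSemidef.eigenvalues_nonneg
  have htA0 : ∀ k, 0 ≤ tA k := ρA.posSemidef.eigenvalues_nonneg
  have htB0 : ∀ k, 0 ≤ tB k := ρB.posSemidef.eigenvalues_nonneg
  set K := prodCols e φ ψ with hK
  set W := prodCols e VA VB with hW
  -- Mutual information is the relative entropy to the product of the marginals; `t` and `W` are the
  -- spectrum and eigenbasis of that product.
  set t : α × β → ℝ := fun l => tA l.1 * tB l.2 with ht
  have hKK : K * K.conjTranspose = 1 := prodCols_mul_conjTranspose hφ hψ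
  have hWW : W * W.conjTranspose = 1 := prodCols_mul_conjTranspose hVA hVB
  have hWW' : W.conjTranspose * W = 1 := by
    ext x y
    rw [hW, prodCols_conjTranspose_mul, hVA', hVB', Matrix.one_apply, Matrix.one_apply,
      Matrix.one_apply]
    simp only [Prod.ext_iff, ite_and, ite_mul, one_mul, zero_mul]
  set c := V.conjTranspose * K with hc
  set f := W.conjTranspose * K with hf
  set U := V.conjTranspose * W with hU
  have hcc : c * c.conjTranspose = 1 := by
    calc c * c.conjTranspose = V.conjTranspose * (K * K.conjTranspose) * V := by
          rw [hc, Matrix.conjTranspose_mul, Matrix.conjTranspose_conjTranspose]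
          simp only [Matrix.mul_assoc]
      _ = 1 := by rw [hKK, Matrix.mul_one, hV']
  have hff : f * f.conjTranspose = 1 := by
    calc f * f.conjTranspose = W.conjTranspose * (K * K.conjTranspose) * W := by
          rw [hf, Matrix.conjTranspose_mul, Matrix.conjTranspose_conjTranspose]
          simp only [Matrix.mul_assoc]
      _ = 1 := by rw [hKK, Matrix.mul_one, hWW']
  have hUf : U * f = c := by
    calc U * f = V.conjTranspose * (W * W.conjTranspose) * K := by
          rw [hU, hf]; simp only [Matrix.mul_assoc]
      _ = c := by rw [hWW, Matrix.mul_one]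
  have hp : ∀ x, colForm ρ.mat K x = outcome c r x := fun x => colForm_eq_outcome hV hVρ K x
  have hπ : ∀ l, colForm ρ.mat W l = outcome U r l := fun l => colForm_eq_outcome hV hVρ W l
  have hpA : ∀ g, colForm ρA.mat φ g = outcome (VA.conjTranspose * φ) tA g :=
    fun g => colForm_eq_outcome hVA hVρA φ g
  have hpB : ∀ g, colForm ρB.mat ψ g = outcome (VB.conjTranspose * ψ) tB g :=
    fun g => colForm_eq_outcome hVB hVρB ψ g
  have hq : ∀ x, outcome f t x = colForm ρA.mat φ x.1 * colForm ρB.mat ψ x.2 := by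
    intro x
    rw [hpA, hpB, outcome, outcome, outcome, Finset.sum_mul_sum, Fintype.sum_prod_type]
    refine Finset.sum_congr rfl fun a _ => Finset.sum_congr rfl fun b _ => ?_
    rw [hf, hW, hK, prodCols_conjTranspose_mul, Complex.normSq_mul]
    ring
  have mA : ∀ g, ∑ h, colForm ρ.mat K (g, h) = colForm ρA.mat φ g :=
    sum_colForm_prodCols_right hA φ hψ
  have mB : ∀ h, ∑ g, colForm ρ.mat K (g, h) = colForm ρB.mat ψ h :=
    sum_colForm_prodCols_left hB ψ hφ
  have eA : ∀ a, colForm ρA.mat VA a = tA a := fun a => by simp [colForm, hVρA]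
  have eB : ∀ b, colForm ρB.mat VB b = tB b := fun b => by simp [colForm, hVρB]
  have nA : ∀ a, ∑ b, colForm ρ.mat W (a, b) = tA a := fun a => by
    rw [← eA]; exact sum_colForm_prodCols_right hA VA hVB a
  have nB : ∀ b, ∑ a, colForm ρ.mat W (a, b) = tB b := fun b => by
    rw [← eB]; exact sum_colForm_prodCols_left hB VB hVA b
  have hW0 : ∀ l, 0 ≤ colForm ρ.mat W l := colForm_nonneg ρ.posSemidef W
  have hK0 : ∀ l, 0 ≤ colForm ρ.mat K l := colForm_nonneg ρ.posSemidef K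
  have hUU : U * U.conjTranspose = 1 := by
    calc U * U.conjTranspose = V.conjTranspose * (W * W.conjTranspose) * V := by
          rw [hU, Matrix.conjTranspose_mul, Matrix.conjTranspose_conjTranspose]
          simp only [Matrix.mul_assoc]
      _ = 1 := by rw [hWW, Matrix.mul_one, hV']
  have hrsum : ∑ k, r k = 1 := by
    have h1 : (V.conjTranspose * ρ.mat * V).trace = 1 := by
      rw [Matrix.trace_mul_comm, ← Matrix.mul_assoc, hV, Matrix.one_mul, ρ.trace_eq_one]
    rw [hVρ, Matrix.trace_diagonal] at h1
    exact_mod_cast h1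
  have hsum : ∑ k, ∑ l, Complex.normSq (U k l) * r k = 1 := by
    have h : ∀ k, ∑ l, Complex.normSq (U k l) * r k = r k := fun k => by
      rw [← Finset.sum_mul, sum_normSq_row hUU, one_mul]
    simp only [h, hrsum]
  have hsum' : ∑ x, outcome c r x = 1 := by
    simp only [outcome]
    rw [Finset.sum_comm]
    simp only [← Finset.mul_sum, sum_normSq_row hcc, mul_one, hrsum]
  -- A zero eigenvalue of a marginal forces the corresponding diagonal entries of ρ in the basis `W`
  -- to vanish, as these are nonnegative and sum to that eigenvalue.
  have hsupp : ∀ k l, t l = 0 → Complex.normSq (U k l) * r k = 0 := by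
    rintro k ⟨a, b⟩ hl
    have h0 : colForm ρ.mat W (a, b) = 0 := by
      rcases mul_eq_zero.1 hl with h | h
      · rw [← nA a] at h
        exact (Finset.sum_eq_zero_iff_of_nonneg fun _ _ => hW0 _).1 h b (Finset.mem_univ _)
      · rw [← nB b] at h
        exact (Finset.sum_eq_zero_iff_of_nonneg fun _ _ => hW0 _).1 h a (Finset.mem_univ _)
    rw [hπ, outcome] at h0
    have := (Finset.sum_eq_zero_iff_of_nonneg fun k _ =>
      mul_nonneg (hr0 k) (Complex.normSq_nonneg _)).1 h0 k (Finset.mem_univ _)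
    rw [mul_comm]; exact this
  have hsupp' : ∀ x, outcome f t x = 0 → outcome c r x = 0 := by
    rintro ⟨g, h⟩ hx
    rw [hq] at hx
    rw [← hp]
    rcases mul_eq_zero.1 hx with h' | h'
    · rw [← mA] at h'
      exact (Finset.sum_eq_zero_iff_of_nonneg fun _ _ => hK0 _).1 h' h (Finset.mem_univ _)
    · rw [← mB] at h'
      exact (Finset.sum_eq_zero_iff_of_nonneg fun _ _ => hK0 _).1 h' g (Finset.mem_univ _)
  have main := sum_outcome_log_le (t := t) hcc hff hUf hr0
    (fun l => mul_nonneg (htA0 _) (htB0 _))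
    hsupp hsupp' hsum hsum'
  simp only [hq, ← hp, mul_sub, Finset.sum_sub_distrib] at main
  rw [sum_mul_log_mul_marginals hK0 mA mB] at main
  have s1 : ∑ k, ∑ l, Complex.normSq (U k l) * r k * Real.log (r k) = - ρ.entropy := by
    rw [State.entropy, ← Finset.sum_neg_distrib]
    refine Finset.sum_congr rfl fun k _ => ?_
    rw [← Finset.sum_mul, ← Finset.sum_mul, sum_normSq_row hUU, one_mul, Real.negMulLog]
    ring
  -- The diagonal of ρ in the basis `W` has the spectra of ρA and ρB as marginals, so the cross term
  -- is exactly minus the sum of their entropies.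
  have s2 : ∑ k, ∑ l, Complex.normSq (U k l) * r k * Real.log (t l) =
      - ρA.entropy - ρB.entropy := by
    rw [Finset.sum_comm]
    have : ∀ l, ∑ k, Complex.normSq (U k l) * r k * Real.log (t l) =
        colForm ρ.mat W l * Real.log (tA l.1 * tB l.2) := by
      intro l
      rw [← Finset.sum_mul, hπ, outcome]
      simp only [mul_comm (Complex.normSq _), ht]
    simp only [this]
    rw [sum_mul_log_mul_marginals hW0 nA nB]
    simp only [State.entropy, Real.negMulLog, ← htA, ← htB, neg_mul, Finset.sum_neg_distrib]
    ring
  rw [s1, s2] at main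
  linarith

end Bipartite
end
end QuditGraph

/-! ### Pinsker's inequality. -/

namespace QuditGraph
open scoped ComplexOrder
noncomputable section
open scoped BigOperators ComplexConjugate
open Finset

/-- The difference of the two sides vanishes at 1 and has derivative (s − 1)³/(s²(s + 2)²), so 1 is
its minimum. -/
lemma log_ge_rational {t : ℝ} (ht : 0 < t) :
    (5 * t ^ 2 - 4 * t - 1) / (2 * t ^ 2 + 4 * t) ≤ Real.log t := by
  set ψ : ℝ → ℝ := fun t => Real.log t - (5 * t ^ 2 - 4 * t - 1) / (2 * t ^ 2 + 4 * t) with hψ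
  have hd : ∀ s, 0 < s → HasDerivAt ψ ((s - 1) ^ 3 / (s ^ 2 * (s + 2) ^ 2)) s := by
    intro s hs
    have hM : 2 * s ^ 2 + 4 * s ≠ 0 := by positivity
    have h1 : HasDerivAt (fun t : ℝ => 5 * t ^ 2 - 4 * t - 1) (10 * s - 4) s := by
      have := (((hasDerivAt_pow 2 s).const_mul 5).sub ((hasDerivAt_id s).const_mul 4)).sub_const 1
      refine this.congr_deriv ?_
      simp; ring
    have h2 : HasDerivAt (fun t : ℝ => 2 * t ^ 2 + 4 * t) (4 * s + 4) s := by
      have := ((hasDerivAt_pow 2 s).const_mul 2).add ((hasDerivAt_id s).const_mul 4)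
      refine this.congr_deriv ?_
      simp; ring
    refine ((Real.hasDerivAt_log hs.ne').sub (h1.div h2 hM)).congr_deriv ?_
    have : s + 2 ≠ 0 := by positivity
    field_simp
    ring
  suffices h : ψ 1 ≤ ψ t by
    simp only [hψ, Real.log_one] at h
    norm_num at h
    linarith
  rcases le_total t 1 with h | h
  · have : AntitoneOn ψ (Set.Icc t 1) := by
      refine antitoneOn_of_deriv_nonpos (convex_Icc t 1)
        (fun s hs => (hd s (ht.trans_le hs.1)).continuousAt.continuousWithinAt) ?_ ?_
      · intro s hs
        rw [interior_Icc] at hs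
        exact (hd s (ht.trans hs.1)).differentiableAt.differentiableWithinAt
      · intro s hs
        rw [interior_Icc] at hs
        rw [(hd s (ht.trans hs.1)).deriv]
        refine div_nonpos_of_nonpos_of_nonneg ?_ (by positivity)
        have : 0 ≤ (1 - s) ^ 3 := pow_nonneg (by linarith [hs.2]) 3
        nlinarith
    exact this ⟨le_rfl, h⟩ ⟨h, le_rfl⟩ h
  · have : MonotoneOn ψ (Set.Icc 1 t) := by
      refine monotoneOn_of_deriv_nonneg (convex_Icc 1 t)
        (fun s hs => (hd s (one_pos.trans_le hs.1)).continuousAt.continuousWithinAt) ?_ ?_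
      · intro s hs
        rw [interior_Icc] at hs
        exact (hd s (one_pos.trans hs.1)).differentiableAt.differentiableWithinAt
      · intro s hs
        rw [interior_Icc] at hs
        rw [(hd s (one_pos.trans hs.1)).deriv]
        exact div_nonneg (pow_nonneg (by linarith [hs.1]) 3) (by positivity)
    exact this ⟨le_rfl, h⟩ ⟨h, le_rfl⟩ h

/-- The pointwise form of Pinsker: putting the rational bound for log(p/q) in the last factor gives
an equality. -/
lemma sq_sub_le_mul_log {p q : ℝ} (hp : 0 ≤ p) (hq : 0 ≤ q) (h : q = 0 → p = 0) :
    (p - q) ^ 2 ≤ (2 * p + 4 * q) / 3 * (p * (Real.log p - Real.log q) - p + q) := by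
  rcases hq.eq_or_lt with h0 | hq
  · rw [← h0, h h0.symm]; simp
  rcases hp.eq_or_lt with h0 | hp
  · rw [← h0]; ring_nf; nlinarith [sq_nonneg q]
  have h1 := log_ge_rational (div_pos hp hq)
  rw [Real.log_div hp.ne' hq.ne'] at h1
  have h2 : (5 * (p / q) ^ 2 - 4 * (p / q) - 1) / (2 * (p / q) ^ 2 + 4 * (p / q)) =
      (p - q) * (5 * p + q) / (2 * p * (p + 2 * q)) := by
    field_simp
    ring
  rw [h2] at h1
  have h3 : (p - q) ^ 2 = (2 * p + 4 * q) / 3 *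
      (p * ((p - q) * (5 * p + q) / (2 * p * (p + 2 * q))) - p + q) := by
    field_simp
    ring
  rw [h3]
  gcongr

/-- Pinsker's inequality for densities with respect to the uniform distribution. -/
theorem pinsker {ι : Type*} [Fintype ι] {p q : ι → ℝ} (hp : ∀ i, 0 ≤ p i) (hq : ∀ i, 0 ≤ q i)
    (h : ∀ i, q i = 0 → p i = 0) (hp1 : 𝔼 i, p i = 1) (hq1 : 𝔼 i, q i = 1) :
    (𝔼 i, |p i - q i|) ^ 2 ≤ 2 * 𝔼 i, p i * (Real.log (p i) - Real.log (q i)) := by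
  have hpt : ∀ i, (p i - q i) ^ 2 ≤
      (2 * p i + 4 * q i) / 3 * (p i * (Real.log (p i) - Real.log (q i)) - p i + q i) :=
    fun i => sq_sub_le_mul_log (hp i) (hq i) (h i)
  -- Cauchy–Schwarz is applied with this weight; its mean 2 is the constant of the inequality.
  have hE : 𝔼 i, (2 * p i + 4 * q i) / 3 = 2 := by
    rw [← Finset.expect_div, Finset.expect_add_distrib, ← Finset.mul_expect, ← Finset.mul_expect,
      hp1, hq1]
    norm_num
  have hE' : 𝔼 i, (p i * (Real.log (p i) - Real.log (q i)) - p i + q i) =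
      𝔼 i, p i * (Real.log (p i) - Real.log (q i)) := by
    rw [Finset.expect_add_distrib, Finset.expect_sub_distrib, hp1, hq1]
    ring
  rw [← hE, ← hE']
  simp only [Fintype.expect_eq_sum_div_card, div_pow, div_mul_div_comm, ← sq]
  gcongr
  refine Finset.sum_sq_le_sum_mul_sum_of_sq_le_mul _ (fun i _ => ?_) (fun i _ => ?_)
    (fun i _ => by rw [sq_abs]; exact hpt i)
  · have := hp i; have := hq i; positivity
  -- Nonnegativity of the divergence integrand is read off the pointwise inequality: a nonnegative
  -- square is bounded by it times a nonnegative weight, which vanishes only when p = q = 0.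
  · by_contra hneg
    push Not at hneg
    have h0 := hpt i
    rcases (add_nonneg (mul_nonneg zero_le_two (hp i))
      (mul_nonneg zero_le_four (hq i))).eq_or_lt with hz | hz
    · have h1 : p i = 0 := by linarith [hp i, hq i]
      have h2 : q i = 0 := by linarith [hp i, hq i]
      simp [h1, h2] at hneg
    · nlinarith [sq_nonneg (p i - q i)]

/-! ### Multilinear extensions of set functions. -/

lemma symmDiff_singleton_of_mem {V : Type*} [DecidableEq V] {v : V} {S : Finset V} (h : v ∈ S) :
    symmDiff S {v} = S.erase v := by
  ext w; simp only [Finset.mem_symmDiff, Finset.mem_singleton, Finset.mem_erase]; grind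

lemma symmDiff_singleton_of_notMem {V : Type*} [DecidableEq V] {v : V} {S : Finset V} (h : v ∉ S) :
    symmDiff S {v} = insert v S := by
  ext w; simp only [Finset.mem_symmDiff, Finset.mem_singleton, Finset.mem_insert]; grind

/-- Segments in a box of coordinates. -/
lemma segment_mem_Icc {V : Type*} {x y : V → ℝ} (hx : ∀ v, x v ∈ Set.Icc (0 : ℝ) 1)
    (hy : ∀ v, y v ∈ Set.Icc (0 : ℝ) 1) {s : ℝ} (hs : s ∈ Set.Icc (0 : ℝ) 1) (v : V) :
    x v + s * (y v - x v) ∈ Set.Icc (0 : ℝ) 1 := by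
  have := (convex_Icc (0 : ℝ) 1) (hx v) (hy v) (by linarith [hs.2] : 0 ≤ 1 - s) hs.1 (by ring)
  simp only [smul_eq_mul] at this
  convert this using 1
  ring

lemma le_of_hasDerivAt_nonneg {F F' : ℝ → ℝ} (h : ∀ s, HasDerivAt F (F' s) s)
    (h0 : ∀ s ∈ Set.Icc (0 : ℝ) 1, 0 ≤ F' s) : F 0 ≤ F 1 := by
  have : MonotoneOn F (Set.Icc 0 1) := by
    refine monotoneOn_of_deriv_nonneg (convex_Icc 0 1)
      (fun s _ => (h s).continuousAt.continuousWithinAt)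
      (fun s _ => (h s).differentiableAt.differentiableWithinAt) fun s hs => ?_
    rw [(h s).deriv]
    exact h0 s (interior_subset hs)
  exact this (by simp) (by simp) zero_le_one

lemma hasDerivAt_segment {V : Type*} (x y : V → ℝ) (s : ℝ) (v : V) :
    HasDerivAt (fun s => x v + s * (y v - x v)) (y v - x v) s := by
  simpa using ((hasDerivAt_id s).mul_const (y v - x v)).const_add (x v)

/-- The point with all coordinates in `p` equal to `a` and the others given by `z`. -/
def mixPt {V : Type*} [DecidableEq V] (p : Finset V) (a : ℝ) (z : V → ℝ) (v : V) : ℝ := if v ∈ p then a else z v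

lemma mixPt_mem {V : Type*} [DecidableEq V] {p : Finset V} {a : ℝ} {z : V → ℝ} (ha : a ∈ Set.Icc (0 : ℝ) 1)
    (hz : ∀ v, z v ∈ Set.Icc (0 : ℝ) 1) (v : V) : mixPt p a z v ∈ Set.Icc (0 : ℝ) 1 := by
  unfold mixPt; split_ifs
  · exact ha
  · exact hz v

section Multilinear

variable {V : Type*} [Fintype V] [DecidableEq V]

/-- The multilinear extension of a set function: the expectation of `f` over a random set that
contains `v` with probability `x v`, independently. -/
def mext (f : Finset V → ℝ) (x : V → ℝ) : ℝ :=
  ∑ S, f S * ∏ v, if v ∈ S then x v else 1 - x v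

/-- The discrete derivative of a set function. -/
def discDeriv (v : V) (f : Finset V → ℝ) (S : Finset V) : ℝ := f (insert v S) - f (S.erase v)

lemma prod_mem_ite_eq_one (x : V → ℝ) : ∑ S : Finset V, ∏ v, (if v ∈ S then x v else 1 - x v) = 1 := by
  have h := Finset.prod_add x (fun v => 1 - x v) (Finset.univ : Finset V)
  simp only [add_sub_cancel, Finset.prod_const_one, Finset.powerset_univ] at h
  refine Eq.trans (Finset.sum_congr rfl fun S _ => ?_) h.symm
  rw [Finset.prod_ite]
  congr 2
  · ext; simp
  · ext; simp

lemma mext_const (a : ℝ) (x : V → ℝ) : mext (fun _ => a) x = a := by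
  rw [mext, ← Finset.mul_sum, prod_mem_ite_eq_one, mul_one]

lemma mext_add (f g : Finset V → ℝ) (x : V → ℝ) :
    mext (fun S => f S + g S) x = mext f x + mext g x := by
  simp only [mext, add_mul, Finset.sum_add_distrib]

lemma mext_const_mul (a : ℝ) (f : Finset V → ℝ) (x : V → ℝ) :
    mext (fun S => a * f S) x = a * mext f x := by
  simp only [mext, mul_assoc, Finset.mul_sum]

lemma mext_sum {κ : Type*} (s : Finset κ) (f : κ → Finset V → ℝ) (x : V → ℝ) :
    mext (fun S => ∑ k ∈ s, f k S) x = ∑ k ∈ s, mext (f k) x := by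
  simp only [mext, Finset.sum_mul]
  rw [Finset.sum_comm]

lemma mext_mono_fun {f g : Finset V → ℝ} (h : ∀ S, f S ≤ g S) {x : V → ℝ}
    (hx : ∀ v, x v ∈ Set.Icc (0 : ℝ) 1) : mext f x ≤ mext g x := by
  refine Finset.sum_le_sum fun S _ => mul_le_mul_of_nonneg_right (h S) ?_
  refine Finset.prod_nonneg fun v _ => ?_
  split_ifs
  · exact (hx v).1
  · linarith [(hx v).2]

lemma mext_nonneg {f : Finset V → ℝ} (h : ∀ S, 0 ≤ f S) {x : V → ℝ}
    (hx : ∀ v, x v ∈ Set.Icc (0 : ℝ) 1) : 0 ≤ mext f x := by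
  simpa [mext_const] using mext_mono_fun (f := fun _ => 0) h hx

lemma mext_indicator (f : Finset V → ℝ) (S : Finset V) :
    mext f (fun v => if v ∈ S then 1 else 0) = f S := by
  rw [mext, Finset.sum_eq_single S]
  · rw [Finset.prod_eq_one, mul_one]
    intro v _
    split_ifs <;> simp
  · intro T _ hT
    have : ∃ v, ¬ (v ∈ T ↔ v ∈ S) := by
      by_contra hcon
      push Not at hcon
      exact hT (Finset.ext hcon)
    obtain ⟨v, hv⟩ := this
    rw [Finset.prod_eq_zero (Finset.mem_univ v), mul_zero]
    by_cases h1 : v ∈ T <;> by_cases h2 : v ∈ S <;> simp_all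
  · simp

lemma continuous_mext (f : Finset V → ℝ) : Continuous (mext f) := by
  unfold mext
  refine continuous_finsetSum _ fun S _ => continuous_const.mul ?_
  refine continuous_finsetProd _ fun v _ => ?_
  split_ifs <;> fun_prop

lemma sum_toggle (v : V) (F : Finset V → ℝ) : ∑ S, F (symmDiff S {v}) = ∑ S, F S :=
  Equiv.sum_comp (Function.Involutive.toPerm (fun S : Finset V => symmDiff S {v})
    fun S => by simp) F

/-- Pair S with S Δ {v}: the product over the other sites is unchanged while the sign flips, which
produces the discrete derivative. Hence partial derivatives of a multilinear extension are
extensions of discrete derivatives. -/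
lemma sum_sign_mul_prod_erase (f : Finset V → ℝ) (x : V → ℝ) (v : V) :
    ∑ S, f S * ((∏ w ∈ univ.erase v, if w ∈ S then x w else 1 - x w) *
      (if v ∈ S then 1 else -1)) = mext (discDeriv v f) x := by
  set π : Finset V → ℝ := fun S => ∏ w ∈ univ.erase v, if w ∈ S then x w else 1 - x w with hπ
  have hinv : ∀ S, π (symmDiff S {v}) = π S := by
    intro S
    refine Finset.prod_congr rfl fun w hw => ?_
    have hw' : w ≠ v := Finset.ne_of_mem_erase hw
    simp [Finset.mem_symmDiff, hw']
  have e1 : 2 * ∑ S, f S * (π S * (if v ∈ S then 1 else -1)) = ∑ S, discDeriv v f S * π S := by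
    rw [two_mul]
    nth_rewrite 1 [← sum_toggle v]
    rw [← Finset.sum_add_distrib]
    refine Finset.sum_congr rfl fun S _ => ?_
    rw [hinv]
    by_cases h : v ∈ S
    · rw [symmDiff_singleton_of_mem h]
      simp only [discDeriv, h, Finset.insert_eq_of_mem, Finset.mem_erase, ne_eq, not_true, false_and,
        if_true, if_false]
      ring
    · rw [symmDiff_singleton_of_notMem h]
      simp only [discDeriv, h, Finset.erase_eq_of_notMem, not_false_eq_true, Finset.mem_insert,
        true_or, if_true, if_false]
      ring
  have e2 : 2 * mext (discDeriv v f) x = ∑ S, discDeriv v f S * π S := by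
    rw [two_mul, mext]
    nth_rewrite 1 [← sum_toggle v]
    rw [← Finset.sum_add_distrib]
    refine Finset.sum_congr rfl fun S _ => ?_
    rw [← Finset.mul_prod_erase univ _ (Finset.mem_univ v),
      ← Finset.mul_prod_erase univ (fun w => if w ∈ S then x w else 1 - x w) (Finset.mem_univ v)]
    have h1 : ∏ w ∈ univ.erase v, (if w ∈ symmDiff S {v} then x w else 1 - x w) = π S := hinv S
    rw [h1]
    change _ + discDeriv v f S * (_ * π S) = _
    by_cases h : v ∈ S
    · rw [symmDiff_singleton_of_mem h]
      simp only [discDeriv, h, Finset.insert_eq_of_mem, Finset.mem_erase, ne_eq, not_true, false_and,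
        if_true, if_false, Finset.insert_erase, Finset.erase_idem]
      ring
    · rw [symmDiff_singleton_of_notMem h]
      simp only [discDeriv, h, Finset.erase_eq_of_notMem, not_false_eq_true, Finset.mem_insert,
        true_or, if_true, if_false, Finset.insert_idem, Finset.erase_insert]
      ring
  linarith

lemma hasDerivAt_mext (f : Finset V → ℝ) {x : ℝ → V → ℝ} {x' : V → ℝ} {s : ℝ}
    (hx : ∀ v, HasDerivAt (fun s => x s v) (x' v) s) :
    HasDerivAt (fun s => mext f (x s)) (∑ v, x' v * mext (discDeriv v f) (x s)) s := by
  have h1 : ∀ S : Finset V, HasDerivAt (fun s => ∏ v, if v ∈ S then x s v else 1 - x s v)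
      (∑ v, (∏ w ∈ univ.erase v, if w ∈ S then x s w else 1 - x s w) •
        (if v ∈ S then x' v else - x' v)) s := by
    intro S
    refine HasDerivAt.fun_finsetProd fun v _ => ?_
    split_ifs
    · exact hx v
    · exact (hx v).const_sub 1
  refine (HasDerivAt.fun_sum fun S _ => (h1 S).const_mul (f S)).congr_deriv ?_
  simp only [← sum_sign_mul_prod_erase, Finset.mul_sum]
  rw [Finset.sum_comm]
  refine Finset.sum_congr rfl fun v _ => Finset.sum_congr rfl fun S _ => ?_
  rw [smul_eq_mul]
  split_ifs <;> ring

lemma mext_mono {f : Finset V → ℝ} {x y : V → ℝ} (hx : ∀ v, x v ∈ Set.Icc (0 : ℝ) 1)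
    (hy : ∀ v, y v ∈ Set.Icc (0 : ℝ) 1) (hxy : ∀ v, x v ≤ y v)
    (hf : ∀ v, x v ≠ y v → ∀ S, 0 ≤ discDeriv v f S) : mext f x ≤ mext f y := by
  have := le_of_hasDerivAt_nonneg (F := fun s => mext f fun v => x v + s * (y v - x v))
    (fun s => hasDerivAt_mext f (hasDerivAt_segment x y s)) (fun s hs =>
      Finset.sum_nonneg fun v _ => by
        by_cases h : x v = y v
        · simp [h]
        · exact mul_nonneg (sub_nonneg.2 (hxy v))
            (mext_nonneg (hf v h) (segment_mem_Icc hx hy hs)))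
  simpa using this

lemma mext_mixPt_mono {f : Finset V → ℝ} {p : Finset V} (hf : ∀ u ∈ p, ∀ S, 0 ≤ discDeriv u f S)
    {a b : ℝ} (ha : a ∈ Set.Icc (0 : ℝ) 1) (hb : b ∈ Set.Icc (0 : ℝ) 1) (hab : a ≤ b)
    {z : V → ℝ} (hz : ∀ v, z v ∈ Set.Icc (0 : ℝ) 1) :
    mext f (mixPt p a z) ≤ mext f (mixPt p b z) := by
  refine mext_mono (mixPt_mem ha hz) (mixPt_mem hb hz) (fun v => ?_) fun v hv => ?_
  · unfold mixPt; split_ifs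
    · exact hab
    · exact le_rfl
  · refine hf v ?_
    by_contra hvp
    simp [mixPt, hvp] at hv

/-- Increasing differences: along the segment from `z` to `y`, the derivative of each side is an
extension of first differences at sites outside `p`, and those increase with the probabilities in
`p`. -/
lemma mext_mixPt_sub_mono {h : Finset V → ℝ} {p : Finset V}
    (hh : ∀ u ∈ p, ∀ v ∉ p, ∀ S, 0 ≤ discDeriv u (discDeriv v h) S)
    {z y : V → ℝ} (hz : ∀ v, z v ∈ Set.Icc (0 : ℝ) 1) (hy : ∀ v, y v ∈ Set.Icc (0 : ℝ) 1)
    (hzy : ∀ v, z v ≤ y v) :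
    mext h (mixPt p 1 z) - mext h (mixPt p 0 z) ≤ mext h (mixPt p 1 y) - mext h (mixPt p 0 y) := by
  have hd : ∀ a s, HasDerivAt (fun s => mext h (mixPt p a fun v => z v + s * (y v - z v)))
      (∑ v, (if v ∈ p then 0 else y v - z v) *
        mext (discDeriv v h) (mixPt p a fun v => z v + s * (y v - z v))) s := by
    intro a s
    refine hasDerivAt_mext h fun v => ?_
    unfold mixPt
    split_ifs
    · exact hasDerivAt_const _ _
    · exact hasDerivAt_segment z y s v
  have := le_of_hasDerivAt_nonneg (fun s => (hd 1 s).sub (hd 0 s)) (fun s hs => by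
    rw [sub_nonneg]
    refine Finset.sum_le_sum fun v _ => ?_
    split_ifs with hv
    · simp
    · exact mul_le_mul_of_nonneg_left (mext_mixPt_mono (fun u hu => hh u hu v hv)
        (by simp) (by simp) zero_le_one (segment_mem_Icc hz hy hs)) (sub_nonneg.2 (hzy v)))
  simpa using this

end Multilinear
end
end QuditGraph

/-! ### Random thresholds and the choice of a sparse set. -/

namespace QuditGraph
open scoped ComplexOrder
noncomputable section
open scoped BigOperators ComplexConjugate
open Finset MeasureTheory

section Averaging

variable {V : Type*} [Fintype V] [DecidableEq V]

/-- The sum of the mixed second differences across `p`. -/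
def crossDiff (h : Finset V → ℝ) (p : Finset V) (S : Finset V) : ℝ :=
  ∑ u ∈ p, ∑ v ∈ pᶜ, discDeriv u (discDeriv v h) S

lemma mext_crossDiff (h : Finset V → ℝ) (p : Finset V) (x : V → ℝ) :
    mext (crossDiff h p) x = ∑ u ∈ p, mext (discDeriv u fun S => ∑ v ∈ pᶜ, discDeriv v h S) x := by
  rw [← mext_sum]
  congr 1
  ext S
  simp only [crossDiff, discDeriv, Finset.sum_sub_distrib]

lemma hasDerivAt_mext_mixPt (f : Finset V → ℝ) (p : Finset V) (z : V → ℝ) (a : ℝ) :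
    HasDerivAt (fun a => mext f (mixPt p a z)) (∑ u ∈ p, mext (discDeriv u f) (mixPt p a z)) a := by
  refine (hasDerivAt_mext f (x' := fun v => if v ∈ p then 1 else 0) fun v => ?_).congr_deriv ?_
  · unfold mixPt; split_ifs
    · exact hasDerivAt_id a
    · exact hasDerivAt_const _ _
  · simp

lemma continuous_mixPt (p : Finset V) : Continuous fun az : ℝ × (V → ℝ) => mixPt p az.1 az.2 := by
  refine continuous_pi fun v => ?_
  unfold mixPt; split_ifs <;> fun_prop

/-- Moving only the block's own threshold α, the integrand is ε⁻¹ times a derivative. The integral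
telescopes, and monotonicity widens the range of the block probability from [εt, ε(t + 1)] to [0,
1]. -/
lemma intervalIntegral_crossDiff_le {h : Finset V → ℝ} {p : Finset V}
    (hh : ∀ u ∈ p, ∀ v ∉ p, ∀ S, 0 ≤ discDeriv u (discDeriv v h) S)
    {ε : ℝ} (hε : 0 < ε) (hε' : ε ≤ 1 / 2) {t : ℝ} (ht : t ∈ Set.Icc (0 : ℝ) 1)
    {z : V → ℝ} (hz : ∀ v, z v ∈ Set.Icc (0 : ℝ) 1) :
    ∫ α in (0 : ℝ)..1, mext (crossDiff h p) (mixPt p (ε * (t + α)) z) ≤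
      ε⁻¹ * (mext (fun S => ∑ v ∈ pᶜ, discDeriv v h S) (mixPt p 1 z) -
        mext (fun S => ∑ v ∈ pᶜ, discDeriv v h S) (mixPt p 0 z)) := by
  set f : Finset V → ℝ := fun S => ∑ v ∈ pᶜ, discDeriv v h S with hf
  have hd : ∀ α : ℝ, HasDerivAt (fun α => ε⁻¹ * mext f (mixPt p (ε * (t + α)) z))
      (mext (crossDiff h p) (mixPt p (ε * (t + α)) z)) α := by
    intro α
    have h1 : HasDerivAt (fun α : ℝ => ε * (t + α)) ε α := by
      simpa using ((hasDerivAt_id α).const_add t).const_mul ε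
    have h2 := ((hasDerivAt_mext_mixPt f p z (ε * (t + α))).comp α h1).const_mul ε⁻¹
    refine h2.congr_deriv ?_
    rw [mext_crossDiff, mul_comm _ ε, inv_mul_cancel_left₀ hε.ne']
  have hcont : Continuous fun α : ℝ => mext (crossDiff h p) (mixPt p (ε * (t + α)) z) :=
    (continuous_mext _).comp ((continuous_mixPt p).comp
      (f := fun α : ℝ => (ε * (t + α), z)) (by fun_prop))
  rw [intervalIntegral.integral_eq_sub_of_hasDerivAt (fun α _ => hd α)
    (hcont.intervalIntegrable _ _), ← mul_sub]
  have hfp : ∀ u ∈ p, ∀ S, 0 ≤ discDeriv u f S := by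
    intro u hu S
    have : discDeriv u f S = ∑ v ∈ pᶜ, discDeriv u (discDeriv v h) S := by
      simp only [hf, discDeriv, Finset.sum_sub_distrib]
    rw [this]
    exact Finset.sum_nonneg fun v hv => hh u hu v (Finset.mem_compl.1 hv) S
  refine mul_le_mul_of_nonneg_left (sub_le_sub ?_ ?_) (by positivity)
  · exact mext_mixPt_mono hfp ⟨by have := ht.1; positivity, by nlinarith [ht.2]⟩ (by simp)
      (by nlinarith [ht.2]) hz
  · exact mext_mixPt_mono hfp (by simp) ⟨by have := ht.1; positivity, by nlinarith [ht.2]⟩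
      (by have := ht.1; positivity) hz

lemma mext_mixPt_zero_one (h : Finset V → ℝ) (p : Finset V) :
    mext h (mixPt p 1 fun _ => 1) - mext h (mixPt p 0 fun _ => 1)
      - (mext h (mixPt p 1 fun _ => 0) - mext h (mixPt p 0 fun _ => 0)) =
    h univ - h p - h pᶜ + h ∅ := by
  have h1 : (mixPt p 1 fun _ => 1) = fun v => if v ∈ (univ : Finset V) then (1 : ℝ) else 0 := by
    ext v; simp [mixPt]
  have h2 : (mixPt p 0 fun _ => 1) = fun v => if v ∈ pᶜ then (1 : ℝ) else 0 := by
    ext v; by_cases hv : v ∈ p <;> simp [mixPt, hv]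
  have h3 : (mixPt p 1 fun _ => 0) = fun v => if v ∈ p then (1 : ℝ) else 0 := by
    ext v; simp [mixPt]
  have h4 : (mixPt p 0 fun _ => 0) = fun v => if v ∈ (∅ : Finset V) then (1 : ℝ) else 0 := by
    ext v; simp [mixPt]
  rw [h1, h2, h3, h4, mext_indicator, mext_indicator, mext_indicator, mext_indicator]
  ring

/-- With the block frozen at 0 or 1, the common threshold t moves all other sites together and the
remaining first differences are again a derivative in t, for another ε⁻¹. Supermodularity then
widens the outside probabilities to 0 and 1. -/
lemma double_integral_crossDiff_le {h : Finset V → ℝ} {p : Finset V}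
    (hh : ∀ u ∈ p, ∀ v ∉ p, ∀ S, 0 ≤ discDeriv u (discDeriv v h) S)
    {ε : ℝ} (hε : 0 < ε) (hε' : ε ≤ 1 / 2) {r : V → ℝ} (hr : ∀ v, r v ∈ Set.Icc (0 : ℝ) 1) :
    ∫ t in (0 : ℝ)..1, ∫ α in (0 : ℝ)..1, mext (crossDiff h p)
        (mixPt p (ε * (t + α)) fun v => ε * (t + r v)) ≤
      (ε ^ 2)⁻¹ * (h univ - h p - h pᶜ + h ∅) := by
  set f : Finset V → ℝ := fun S => ∑ v ∈ pᶜ, discDeriv v h S with hf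
  set z : ℝ → V → ℝ := fun t v => ε * (t + r v) with hz
  have hzm : ∀ t ∈ Set.Icc (0 : ℝ) 1, ∀ v, z t v ∈ Set.Icc (0 : ℝ) 1 := by
    intro t ht v
    exact ⟨mul_nonneg hε.le (add_nonneg ht.1 (hr v).1), by
      simp only [hz]; nlinarith [ht.2, (hr v).2]⟩
  have hzc : Continuous z := continuous_pi fun v => by simp only [hz]; fun_prop
  have hd : ∀ a t, HasDerivAt (fun t => ε⁻¹ * mext h (mixPt p a (z t)))
      (mext f (mixPt p a (z t))) t := by
    intro a t
    have h1 := (hasDerivAt_mext h (x := fun t => mixPt p a (z t)) (s := t)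
      (x' := fun v => if v ∈ p then 0 else ε) fun v => by
        unfold mixPt
        split_ifs
        · exact hasDerivAt_const _ _
        · simpa using ((hasDerivAt_id t).add_const (r v)).const_mul ε).const_mul ε⁻¹
    refine h1.congr_deriv ?_
    rw [hf, mext_sum, Finset.mul_sum, ← Finset.sum_add_sum_compl p, Finset.sum_eq_zero, zero_add]
    · refine Finset.sum_congr rfl fun v hv => ?_
      rw [if_neg (Finset.mem_compl.1 hv)]
      field_simp
    · intro v hv; simp [hv]
  have hc : ∀ a, Continuous fun t => mext f (mixPt p a (z t)) := fun a =>
    (continuous_mext _).comp ((continuous_mixPt p).comp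
      (f := fun t : ℝ => (a, z t)) (by fun_prop))
  have hc2 : Continuous fun t : ℝ => ∫ α in (0 : ℝ)..1, mext (crossDiff h p)
      (mixPt p (ε * (t + α)) (z t)) := by
    refine intervalIntegral.continuous_parametric_intervalIntegral_of_continuous' ?_ _ _
    exact (continuous_mext _).comp ((continuous_mixPt p).comp
      (f := fun x : ℝ × ℝ => (ε * (x.1 + x.2), z x.1)) (by fun_prop))
  calc _ ≤ ∫ t in (0 : ℝ)..1, ε⁻¹ * (mext f (mixPt p 1 (z t)) - mext f (mixPt p 0 (z t))) := by
        refine intervalIntegral.integral_mono_on zero_le_one (hc2.intervalIntegrable _ _)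
          (Continuous.intervalIntegrable (((hc 1).sub (hc 0)).const_smul ε⁻¹) _ _) fun t ht => ?_
        exact intervalIntegral_crossDiff_le hh hε hε' ht (hzm t ht)
    _ = (ε ^ 2)⁻¹ * (mext h (mixPt p 1 (z 1)) - mext h (mixPt p 0 (z 1))
          - (mext h (mixPt p 1 (z 0)) - mext h (mixPt p 0 (z 0)))) := by
        rw [intervalIntegral.integral_const_mul,
          intervalIntegral.integral_sub ((hc 1).intervalIntegrable _ _)
            ((hc 0).intervalIntegrable _ _),
          intervalIntegral.integral_eq_sub_of_hasDerivAt (fun t _ => hd 1 t)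
            ((hc 1).intervalIntegrable _ _),
          intervalIntegral.integral_eq_sub_of_hasDerivAt (fun t _ => hd 0 t)
            ((hc 0).intervalIntegrable _ _)]
        field_simp
        ring
    _ ≤ _ := by
        rw [← mext_mixPt_zero_one]
        refine mul_le_mul_of_nonneg_left (sub_le_sub ?_ ?_) (by positivity)
        · exact mext_mixPt_sub_mono hh (hzm 1 (by simp)) (by simp)
            (fun v => (hzm 1 (by simp) v).2)
        · exact mext_mixPt_sub_mono hh (by simp) (hzm 0 (by simp))
            (fun v => (hzm 0 (by simp) v).1)

/-- In the coordinate at `v` the extension vanishes at 0 and has slope one. -/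
lemma mext_mem (v : V) (x : V → ℝ) : mext (fun S => if v ∈ S then 1 else 0) x = x v := by
  have hd : ∀ s, HasDerivAt (fun s => mext (fun S => if v ∈ S then 1 else 0)
      (Function.update x v s)) 1 s := by
    intro s
    refine (hasDerivAt_mext _ (x' := fun w => if w = v then 1 else 0) fun w => ?_).congr_deriv ?_
    · by_cases hw : w = v
      · subst hw; simpa using hasDerivAt_id' s
      · simpa [hw] using hasDerivAt_const s (x w)
    · have : discDeriv v (fun S => if v ∈ S then (1 : ℝ) else 0) = fun _ => 1 := by
        ext S; simp [discDeriv]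
      simp [this, mext_const]
  have h2 : ∀ s, HasDerivAt (fun s => mext (fun S => if v ∈ S then 1 else 0)
      (Function.update x v s) - s) 0 s := fun s =>
    ((hd s).sub (hasDerivAt_id' s)).congr_deriv (sub_self 1)
  have h0 : mext (fun S => if v ∈ S then 1 else 0) (Function.update x v 0) = 0 := by
    refine Finset.sum_eq_zero fun S _ => ?_
    by_cases hv : v ∈ S
    · rw [Finset.prod_eq_zero (Finset.mem_univ v) (by simp [hv]), mul_zero]
    · simp [hv]
  have h3 := is_const_of_deriv_eq_zero (fun s => (h2 s).differentiableAt) (fun s => (h2 s).deriv)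
    (x v) 0
  simp only [Function.update_eq_self, h0] at h3
  linarith

lemma mext_card (x : V → ℝ) : mext (fun S => (S.card : ℝ)) x = ∑ v, x v := by
  have : (fun S : Finset V => (S.card : ℝ)) = fun S => ∑ v, if v ∈ S then (1 : ℝ) else 0 := by
    ext S; simp
  rw [this, mext_sum]
  exact Finset.sum_congr rfl fun v _ => mext_mem v x

end Averaging

section Resample

variable {κ : Type*} [Fintype κ] [DecidableEq κ]

lemma measurePreserving_update (i : κ) :
    MeasurePreserving (fun ra : (κ → unitInterval) × unitInterval => Function.update ra.1 i ra.2)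
      (volume.prod volume) volume := by
  have hm : Measurable fun ra : (κ → unitInterval) × unitInterval =>
      Function.update ra.1 i ra.2 := by
    refine measurable_pi_lambda _ fun j => ?_
    by_cases h : j = i
    · subst h; simpa using measurable_snd
    · simpa [h, Function.comp_def] using (measurable_pi_apply j).comp measurable_fst
  refine ⟨hm, ?_⟩
  refine (Measure.pi_eq fun s hs => ?_).symm
  rw [Measure.map_apply hm (MeasurableSet.univ_pi hs)]
  have : (fun ra : (κ → unitInterval) × unitInterval => Function.update ra.1 i ra.2) ⁻¹'
      (Set.univ.pi s) = (Set.univ.pi (Function.update s i Set.univ)) ×ˢ s i := by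
    ext ⟨r, a⟩
    simp only [Set.mem_preimage, Set.mem_pi, Set.mem_univ, true_implies, Set.mem_prod]
    constructor
    · intro h
      refine ⟨fun j => ?_, by simpa using h i⟩
      by_cases hj : j = i
      · subst hj; simp
      · simpa [hj] using h j
    · rintro ⟨h1, h2⟩ j
      by_cases hj : j = i
      · subst hj; simpa using h2
      · simpa [hj] using h1 j
  rw [this, Measure.prod_prod, volume_pi, Measure.pi_pi, ← Finset.mul_prod_erase _ _ (Finset.mem_univ i),
    ← Finset.mul_prod_erase _ (fun j => volume (s j)) (Finset.mem_univ i)]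
  simp only [Function.update_self, measure_univ, one_mul]
  rw [mul_comm]
  congr 1
  refine Finset.prod_congr rfl fun j hj => ?_
  rw [Function.update_of_ne (Finset.ne_of_mem_erase hj)]

lemma integrable_of_continuous {X : Type*} [TopologicalSpace X] [CompactSpace X]
    [MeasurableSpace X] [OpensMeasurableSpace X] (μ : Measure X) [IsFiniteMeasure μ]
    {F : X → ℝ} (hF : Continuous F) : Integrable F μ :=
  hF.integrable_of_hasCompactSupport (HasCompactSupport.of_compactSpace F)

lemma integral_resample {F : (κ → unitInterval) → ℝ} (hF : Continuous F) (i : κ) :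
    ∫ r, F r = ∫ r : κ → unitInterval, ∫ a : unitInterval, F (Function.update r i a) := by
  have hmp := measurePreserving_update (κ := κ) i
  rw [← hmp.map_eq, integral_map hmp.measurable.aemeasurable (by
    rw [hmp.map_eq]; exact hF.aestronglyMeasurable)]
  have hc : Continuous fun ra : (κ → unitInterval) × unitInterval =>
      F (Function.update ra.1 i ra.2) := hF.comp (continuous_fst.update i continuous_snd)
  rw [integral_prod _ (integrable_of_continuous _ hc), hmp.map_eq]

lemma integral_unitInterval (f : ℝ → ℝ) : ∫ a : unitInterval, f a = ∫ a in (0 : ℝ)..1, f a := by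
  rw [intervalIntegral.integral_of_le zero_le_one, ← integral_Icc_eq_integral_Ioc]
  exact integral_subtype measurableSet_Icc f

end Resample

section RandomThreshold

variable {V κ : Type*} [Fintype V] [DecidableEq V] [Fintype κ] [DecidableEq κ]

/-- The set of vertices in a block. -/
abbrev fiber (blk : V → κ) (i : κ) : Finset V := univ.filter fun v => blk v = i

/-- Sampling probabilities: a common threshold plus an individual one for each block. -/
def threshold (blk : V → κ) (ε t : ℝ) (r : κ → unitInterval) (v : V) : ℝ :=
  ε * (t + r (blk v))

lemma threshold_mem (blk : V → κ) {ε : ℝ} (hε : 0 < ε) (hε' : ε ≤ 1 / 2) (t : unitInterval)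
    (r : κ → unitInterval) (v : V) : threshold blk ε t r v ∈ Set.Icc (0 : ℝ) 1 := by
  have h1 := t.2.1
  have h2 := t.2.2
  have h3 := (r (blk v)).2.1
  have h4 := (r (blk v)).2.2
  refine ⟨mul_nonneg hε.le (add_nonneg h1 h3), ?_⟩
  simp only [threshold]
  nlinarith

lemma threshold_update (blk : V → κ) (ε t : ℝ) (r : κ → unitInterval) (i : κ) (a : unitInterval) :
    threshold blk ε t (Function.update r i a) =
      mixPt (fiber blk i) (ε * (t + a)) fun v => ε * (t + r (blk v)) := by
  ext v
  by_cases h : blk v = i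
  · simp [threshold, mixPt, h]
  · simp [threshold, mixPt, h]

lemma continuous_mext_threshold (blk : V → κ) (ε : ℝ) (f : Finset V → ℝ) :
    Continuous fun rt : (κ → unitInterval) × unitInterval =>
      mext f (threshold blk ε rt.2 rt.1) := by
  refine (continuous_mext f).comp (continuous_pi fun v => ?_)
  unfold threshold
  fun_prop

/-- Resampling the threshold of block `i` separates it from the others. For fixed remaining
thresholds the bound holds already after averaging over `a` and `t`, so one sampling law serves all
blocks. -/
lemma integral_mext_crossDiff_le (blk : V → κ) {h : Finset V → ℝ}
    (hh : ∀ u v, u ≠ v → ∀ S, 0 ≤ discDeriv u (discDeriv v h) S)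
    {ε : ℝ} (hε : 0 < ε) (hε' : ε ≤ 1 / 2) (i : κ) :
    ∫ rt : (κ → unitInterval) × unitInterval,
        mext (crossDiff h (fiber blk i)) (threshold blk ε rt.2 rt.1) ≤
      (ε ^ 2)⁻¹ * (h univ - h (fiber blk i) - h (fiber blk i)ᶜ + h ∅) := by
  set p := fiber blk i
  have hc := continuous_mext_threshold blk ε (crossDiff h p)
  set F : (κ → unitInterval) → ℝ := fun r =>
    ∫ t : unitInterval, mext (crossDiff h p) (threshold blk ε t r) with hF
  have hFc : Continuous F := by
    have := continuous_parametric_integral_of_continuous (μ := (volume : Measure unitInterval))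
      (f := fun (r : κ → unitInterval) (t : unitInterval) =>
        mext (crossDiff h p) (threshold blk ε t r)) hc (s := Set.univ) isCompact_univ
    simpa only [Measure.restrict_univ] using this
  have h1 : ∫ rt : (κ → unitInterval) × unitInterval,
      mext (crossDiff h p) (threshold blk ε rt.2 rt.1) = ∫ r, F r :=
    integral_prod _ (integrable_of_continuous _ hc)
  have h2 : ∀ r, ∫ a : unitInterval, F (Function.update r i a) ≤
      (ε ^ 2)⁻¹ * (h univ - h p - h pᶜ + h ∅) := by
    intro r
    have h3 := double_integral_crossDiff_le (h := h) (p := p)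
      (fun u hu v hv S => hh u v (fun huv => hv (huv ▸ hu)) S) hε hε'
      (r := fun v => (r (blk v) : ℝ)) (fun v => (r (blk v)).2)
    rw [← integral_unitInterval] at h3
    simp only [← integral_unitInterval] at h3
    refine le_trans (le_of_eq ?_) h3
    simp only [hF, threshold_update]
    refine integral_integral_swap (integrable_of_continuous _ ?_)
    refine (continuous_mext _).comp ((continuous_mixPt p).comp
      (f := fun x : unitInterval × unitInterval =>
        (ε * ((x.2 : ℝ) + x.1), fun v => ε * ((x.2 : ℝ) + r (blk v)))) ?_)
    fun_prop
  rw [h1, integral_resample hFc i]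
  have hFu : Continuous fun r => ∫ a : unitInterval, F (Function.update r i a) := by
    have := continuous_parametric_integral_of_continuous (μ := (volume : Measure unitInterval))
      (f := fun (r : κ → unitInterval) (a : unitInterval) => F (Function.update r i a))
      (hFc.comp (continuous_fst.update i continuous_snd)) (s := Set.univ) isCompact_univ
    simpa only [Measure.restrict_univ] using this
  refine (integral_mono (integrable_of_continuous _ hFu) (integrable_const _) h2).trans ?_
  simp

lemma integral_coe_unitInterval : ∫ t : unitInterval, (t : ℝ) = 1 / 2 := by
  rw [integral_unitInterval fun x => x, integral_id]
  norm_num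

lemma integral_mext_card (blk : V → κ) (ε : ℝ) :
    ∫ rt : (κ → unitInterval) × unitInterval,
      mext (fun S => (S.card : ℝ)) (threshold blk ε rt.2 rt.1) = ε * Fintype.card V := by
  simp only [mext_card, threshold]
  rw [integral_finsetSum _ fun v _ => integrable_of_continuous _ (by fun_prop)]
  have h1 : ∀ v, ∫ rt : (κ → unitInterval) × unitInterval, ε * ((rt.2 : ℝ) + rt.1 (blk v)) = ε := by
    intro v
    rw [integral_const_mul, integral_add (integrable_of_continuous _ (by fun_prop))
      (integrable_of_continuous _ (by fun_prop))]
    have e1 : ∫ rt : (κ → unitInterval) × unitInterval, (rt.2 : ℝ) = 1 / 2 := by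
      have := integral_fun_snd (μ := (volume : Measure (κ → unitInterval)))
        (ν := (volume : Measure unitInterval)) (fun t => (t : ℝ))
      rw [Measure.volume_eq_prod, this]
      simp [integral_coe_unitInterval]
    have e2 : ∫ rt : (κ → unitInterval) × unitInterval, ((rt.1 (blk v) : unitInterval) : ℝ) =
        1 / 2 := by
      have := integral_fun_fst (μ := (volume : Measure (κ → unitInterval)))
        (ν := (volume : Measure unitInterval)) (fun r => ((r (blk v) : unitInterval) : ℝ))
      have h3 : ∫ r : κ → unitInterval, ((r (blk v) : unitInterval) : ℝ) = 1 / 2 := by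
        rw [integral_resample (by fun_prop) (blk v)]
        simp [integral_coe_unitInterval]
      rw [Measure.volume_eq_prod, this, h3]
      simp
    rw [e1, e2]
    ring
  simp [h1, mul_comm]

/-- A sparse set of vertices for which the mixed second differences of a supermodular function
across the blocks are small on average. -/
theorem exists_sparse_set (blk : V → κ) {h : Finset V → ℝ}
    (hh : ∀ u v, u ≠ v → ∀ S, 0 ≤ discDeriv u (discDeriv v h) S)
    {ε : ℝ} (hε : 0 < ε) (hε' : ε ≤ 1 / 2) {c₁ c₂ : ℝ} (hc₂ : 0 ≤ c₂) :
    ∃ C : Finset V, c₁ * C.card + c₂ * ∑ i, crossDiff h (fiber blk i) C ≤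
      c₁ * (ε * Fintype.card V) +
        c₂ * ((ε ^ 2)⁻¹ * ∑ i, (h univ - h (fiber blk i) - h (fiber blk i)ᶜ + h ∅)) := by
  set L : Finset V → ℝ := fun C => c₁ * C.card + c₂ * ∑ i, crossDiff h (fiber blk i) C with hL
  -- The minimum of L is at most its mean under the random choice of set.
  obtain ⟨C, hC⟩ := Finite.exists_min L
  refine ⟨C, ?_⟩
  change L C ≤ _
  have h1 : ∀ rt : (κ → unitInterval) × unitInterval, L C ≤
      c₁ * mext (fun S => (S.card : ℝ)) (threshold blk ε rt.2 rt.1) +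
      c₂ * ∑ i, mext (crossDiff h (fiber blk i)) (threshold blk ε rt.2 rt.1) := by
    intro rt
    have := mext_mono_fun (f := fun _ => L C) hC (threshold_mem blk hε hε' rt.2 rt.1)
    rw [mext_const] at this
    refine this.trans (le_of_eq ?_)
    rw [← mext_sum, ← mext_const_mul, ← mext_const_mul, ← mext_add]
  have hI : ∀ f : Finset V → ℝ, Integrable (fun rt : (κ → unitInterval) × unitInterval =>
      mext f (threshold blk ε rt.2 rt.1)) volume := fun f =>
    integrable_of_continuous _ (continuous_mext_threshold blk ε f)
  have h2 := integral_mono (μ := (volume : Measure ((κ → unitInterval) × unitInterval)))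
    (integrable_const (L C)) (((hI _).const_mul c₁).add
      ((integrable_finsetSum univ fun i _ => hI (crossDiff h (fiber blk i))).const_mul c₂)) h1
  simp only [Pi.add_apply] at h2
  rw [integral_const, probReal_univ, one_smul, integral_add ((hI _).const_mul c₁)
    ((integrable_finsetSum univ fun i _ => hI _).const_mul c₂), integral_const_mul,
    integral_const_mul, integral_mext_card, integral_finsetSum _ fun i _ => hI _] at h2
  refine h2.trans ?_
  rw [Finset.mul_sum univ _ (ε ^ 2)⁻¹]
  gcongr
  exact integral_mext_crossDiff_le blk hh hε hε' _

end RandomThreshold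
end
end QuditGraph

/-! ### Product operators, marginals and block products. -/

namespace QuditGraph
open scoped ComplexOrder
noncomputable section
open scoped BigOperators ComplexConjugate
open Finset

section Tensor

variable {V : Type*} [Fintype V] {d : ℕ}

/-- The tensor product of one-site operators. -/
def tens (O : V → Matrix (Fin d) (Fin d) ℂ) : Matrix (V → Fin d) (V → Fin d) ℂ :=
  Matrix.of fun x y => ∏ v, O v (x v) (y v)

/-- The expectation `tr (M ⨂ O)` of a product of one-site operators. -/
def ev [DecidableEq V] (M : Matrix (V → Fin d) (V → Fin d) ℂ)
    (O : V → Matrix (Fin d) (Fin d) ℂ) : ℂ :=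
  ∑ x, ∑ y, M x y * ∏ v, O v (y v) (x v)

variable [DecidableEq V]

lemma ev_eq_trace (M : Matrix (V → Fin d) (V → Fin d) ℂ) (O : V → Matrix (Fin d) (Fin d) ℂ) :
    ev M O = (M * tens O).trace := by
  simp [ev, Matrix.trace, Matrix.mul_apply, tens]

lemma tens_mul (O O' : V → Matrix (Fin d) (Fin d) ℂ) :
    tens O * tens O' = tens fun v => O v * O' v := by
  ext x y
  simp only [tens, Matrix.mul_apply, Matrix.of_apply, ← Finset.prod_mul_distrib]
  rw [Finset.prod_univ_sum, Fintype.piFinset_univ]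

lemma tens_one : tens (fun _ : V => (1 : Matrix (Fin d) (Fin d) ℂ)) = 1 := by
  ext x y
  simp only [tens, Matrix.of_apply, Matrix.one_apply, funext_iff]
  by_cases h : ∀ v, x v = y v
  · simp [h]
  · rw [if_neg h]
    push Not at h
    obtain ⟨v, hv⟩ := h
    exact Finset.prod_eq_zero (Finset.mem_univ v) (by simp [hv])

lemma conjTranspose_tens (O : V → Matrix (Fin d) (Fin d) ℂ) :
    (tens O).conjTranspose = tens fun v => (O v).conjTranspose := by
  ext x y
  simp [tens, Matrix.conjTranspose_apply]

lemma ev_one (M : Matrix (V → Fin d) (V → Fin d) ℂ) : ev M (fun _ => 1) = M.trace := by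
  rw [ev_eq_trace, tens_one, mul_one]

lemma ev_conj (κ : V → Matrix (Fin d) (Fin d) ℂ) (M : Matrix (V → Fin d) (V → Fin d) ℂ)
    (O : V → Matrix (Fin d) (Fin d) ℂ) :
    ev (tens κ * M * (tens κ).conjTranspose) O =
      ev M fun v => (κ v).conjTranspose * O v * κ v := by
  rw [ev_eq_trace, ev_eq_trace, conjTranspose_tens, mul_assoc, mul_assoc, Matrix.trace_mul_comm,
    mul_assoc, mul_assoc, tens_mul, tens_mul]
  simp only [mul_assoc]

lemma star_ev {M : Matrix (V → Fin d) (V → Fin d) ℂ} (hM : M.IsHermitian)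
    (O : V → Matrix (Fin d) (Fin d) ℂ) :
    conj (ev M O) = ev M fun v => (O v).conjTranspose := by
  rw [ev_eq_trace, ev_eq_trace, ← conjTranspose_tens, ← RCLike.star_def,
    ← Matrix.trace_conjTranspose, Matrix.conjTranspose_mul, hM.eq, Matrix.trace_mul_comm]

lemma ev_ofReal {M : Matrix (V → Fin d) (V → Fin d) ℂ} (hM : M.IsHermitian)
    {O : V → Matrix (Fin d) (Fin d) ℂ} (hO : ∀ v, (O v).IsHermitian) :
    ((ev M O).re : ℂ) = ev M O := by
  rw [← Complex.conj_eq_iff_re, star_ev hM]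
  congr 1
  ext v : 1
  exact hO v

/-- Matrix units read off entries, so a matrix is determined by its values on product operators. -/
lemma ev_single (M : Matrix (V → Fin d) (V → Fin d) ℂ) (x y : V → Fin d) :
    ev M (fun v => Matrix.single (y v) (x v) 1) = M x y := by
  have h : ∀ x' y' : V → Fin d,
      ∏ v, Matrix.single (y v) (x v) (1 : ℂ) (y' v) (x' v) = if x = x' ∧ y = y' then 1 else 0 := by
    intro x' y'
    simp only [Matrix.single_apply]
    rw [Finset.prod_ite_zero]
    simp [funext_iff, forall_and, and_comm]
  simp only [ev, h, ite_and, mul_ite, mul_one, mul_zero]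
  rw [Finset.sum_eq_single x (by intro b _ hb; simp [hb.symm]) (by simp)]
  simp

lemma ev_sub (M N : Matrix (V → Fin d) (V → Fin d) ℂ) (O : V → Matrix (Fin d) (Fin d) ℂ) :
    ev (M - N) O = ev M O - ev N O := by
  simp [ev_eq_trace, sub_mul, Matrix.trace_sub]

lemma ev_smul (c : ℂ) (M : Matrix (V → Fin d) (V → Fin d) ℂ) (O : V → Matrix (Fin d) (Fin d) ℂ) :
    ev (c • M) O = c * ev M O := by
  simp [ev_eq_trace]

lemma ev_zero (O : V → Matrix (Fin d) (Fin d) ℂ) : ev 0 O = 0 := by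
  simp [ev]

lemma ev_sum {ι : Type*} (s : Finset ι) (M : ι → Matrix (V → Fin d) (V → Fin d) ℂ)
    (O : V → Matrix (Fin d) (Fin d) ℂ) : ev (∑ i ∈ s, M i) O = ∑ i ∈ s, ev (M i) O := by
  simp [ev_eq_trace, Finset.sum_mul, Matrix.trace_sum]

lemma matrix_eq_of_ev {M N : Matrix (V → Fin d) (V → Fin d) ℂ} (h : ∀ O, ev M O = ev N O) :
    M = N := by
  ext x y
  rw [← ev_single M x y, h, ev_single]

lemma prod_update_entries (O : V → Matrix (Fin d) (Fin d) ℂ) (v : V)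
    (Z : Matrix (Fin d) (Fin d) ℂ) (x y : V → Fin d) :
    ∏ w, Function.update O v Z w (y w) (x w) =
      Z (y v) (x v) * ∏ w ∈ univ.erase v, O w (y w) (x w) := by
  rw [← Finset.mul_prod_erase _ _ (Finset.mem_univ v), Function.update_self]
  congr 1
  exact Finset.prod_congr rfl fun w hw => by
    rw [Function.update_of_ne (Finset.ne_of_mem_erase hw)]

/-- The linear dependence of `ev` on the operator at one site. -/
def evAt (M : Matrix (V → Fin d) (V → Fin d) ℂ) (O : V → Matrix (Fin d) (Fin d) ℂ) (v : V) :
    Matrix (Fin d) (Fin d) ℂ →ₗ[ℂ] ℂ where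
  toFun X := ev M (Function.update O v X)
  map_add' X Y := by
    simp only [ev, prod_update_entries, ← Finset.sum_add_distrib, Matrix.add_apply]
    simp only [add_mul, mul_add]
  map_smul' c X := by
    simp only [ev, prod_update_entries, Matrix.smul_apply, smul_eq_mul, RingHom.id_apply, Finset.mul_sum]
    exact Finset.sum_congr rfl fun x _ => Finset.sum_congr rfl fun y _ => by ring

lemma evAt_apply (M : Matrix (V → Fin d) (V → Fin d) ℂ) (O : V → Matrix (Fin d) (Fin d) ℂ) (v : V)
    (X : Matrix (Fin d) (Fin d) ℂ) : evAt M O v X = ev M (Function.update O v X) := rfl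

/-- Partial trace is dual to padding with identities. Afterwards marginals are handled only through
this formula. -/
lemma ev_marginal (ρ : State (V → Fin d)) (S : Finset V)
    (O : {v // v ∈ S} → Matrix (Fin d) (Fin d) ℂ) :
    ev (ρ.marginal S).mat O = ev ρ.mat fun v => if h : v ∈ S then O ⟨v, h⟩ else 1 := by
  have hg1 : ∀ a c (v : V) (h : v ∈ S), glue (d := d) S a c v = a ⟨v, h⟩ := by
    intro a c v h; simp [glue, Equiv.piEquivPiSubtypeProd, h]
  have hg2 : ∀ a c (v : V) (h : v ∉ S), glue (d := d) S a c v = c ⟨v, h⟩ := by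
    intro a c v h; simp [glue, Equiv.piEquivPiSubtypeProd, h]
  have hsum : ∀ F : (V → Fin d) → ℂ, ∑ x, F x = ∑ a, ∑ c, F (glue S a c) := by
    intro F
    rw [← Fintype.sum_prod_type']
    exact (Equiv.sum_comp (Equiv.piEquivPiSubtypeProd (fun v => v ∈ S) (fun _ => Fin d)).symm
      F).symm
  have hprod : ∀ a c a' c', ∏ v, (if h : v ∈ S then O ⟨v, h⟩ else 1) (glue S a' c' v)
      (glue S a c v) = (∏ v, O v (a' v) (a v)) * if c = c' then 1 else 0 := by
    intro a c a' c'
    rw [← Fintype.prod_subtype_mul_prod_subtype (fun v => v ∈ S)]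
    congr 1
    · refine Finset.prod_congr (by ext; simp) fun v _ => ?_
      rw [hg1 _ _ _ v.2, hg1 _ _ _ v.2, dif_pos v.2]
    · have : ∀ v : {v // v ∉ S}, (if h : v.1 ∈ S then O ⟨v.1, h⟩ else 1) (glue S a' c' v)
          (glue S a c v) = if c v = c' v then 1 else 0 := by
        intro v
        rw [hg2 _ _ _ v.2, hg2 _ _ _ v.2, dif_neg v.2, Matrix.one_apply]
        simp only [eq_comm]
      simp only [this]
      rw [Finset.prod_ite_zero]
      simp [funext_iff]
  simp only [ev, State.marginal, Matrix.sum_apply, Matrix.submatrix_apply]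
  rw [hsum]
  refine Finset.sum_congr rfl fun a _ => ?_
  simp only [hsum (fun y => ρ.mat _ y * _), hprod]
  rw [Finset.sum_comm]
  refine Finset.sum_congr rfl fun a' _ => ?_
  rw [Finset.sum_mul]
  refine Finset.sum_congr rfl fun c _ => ?_
  simp

lemma prod_parts (P : Finpartition (univ : Finset V)) (f : V → ℂ) :
    ∏ v, f v = ∏ p : {p // p ∈ P.parts}, ∏ v : {v // v ∈ p.1}, f v := by
  have h1 : ∏ v ∈ P.parts.biUnion id, f v = ∏ p ∈ P.parts, ∏ v ∈ p, f v :=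
    Finset.prod_biUnion P.disjoint
  rw [P.biUnion_parts] at h1
  rw [h1, ← Finset.prod_coe_sort P.parts]
  exact Finset.prod_congr rfl fun p _ => (Finset.prod_coe_sort p.1 f).symm

/-- Configurations are families of configurations of the blocks. -/
def restrictParts (P : Finpartition (univ : Finset V)) :
    (V → Fin d) ≃ ((p : {p // p ∈ P.parts}) → {v // v ∈ p.1} → Fin d) :=
  Equiv.ofBijective (fun x _ v => x v) <| by
    constructor
    · intro x y h
      ext v : 1
      have hv := P.mem_part (Finset.mem_univ v)
      exact congrFun (congrFun h ⟨P.part v, P.part_mem.2 (Finset.mem_univ v)⟩) ⟨v, hv⟩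
    · intro f
      refine ⟨fun v => f ⟨P.part v, P.part_mem.2 (Finset.mem_univ v)⟩
        ⟨v, P.mem_part (Finset.mem_univ v)⟩, ?_⟩
      ext ⟨p, hp⟩ ⟨v, hv⟩ : 2
      have h : P.part v = p := P.part_eq_of_mem hp hv
      subst h
      rfl

lemma ev_blockProduct (P : Finpartition (univ : Finset V))
    (τ : (p : {p // p ∈ P.parts}) → State ({v // v ∈ p.1} → Fin d))
    (O : V → Matrix (Fin d) (Fin d) ℂ) :
    ev (blockProduct P τ) O = ∏ p, ev (τ p).mat fun v => O v := by
  set F : (p : {p // p ∈ P.parts}) → ({v // v ∈ p.1} → Fin d) → ({v // v ∈ p.1} → Fin d) → ℂ :=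
    fun p a b => (τ p).mat a b * ∏ v : {v // v ∈ p.1}, O v.1 (b v) (a v) with hF
  have h : ∀ x y : V → Fin d, blockProduct P τ x y * ∏ v, O v (y v) (x v) =
      ∏ p, F p (restrictParts P x p) (restrictParts P y p) := by
    intro x y
    rw [prod_parts P, blockProduct, Matrix.of_apply, ← Finset.prod_mul_distrib]
    rfl
  simp only [ev, h]
  rw [(restrictParts P).sum_comp fun a => ∑ y, ∏ p, F p (a p) (restrictParts P y p)]
  have h2 : ∀ a : (p : {p // p ∈ P.parts}) → {v // v ∈ p.1} → Fin d,
      ∑ y, ∏ p, F p (a p) (restrictParts P y p) = ∏ p, ∑ b, F p (a p) b := by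
    intro a
    rw [(restrictParts P).sum_comp fun b => ∏ p, F p (a p) (b p), Finset.prod_univ_sum,
      Fintype.piFinset_univ]
  simp only [h2]
  change _ = ∏ p, ∑ a, ∑ b, F p a b
  rw [Finset.prod_univ_sum, Fintype.piFinset_univ]

/-- In the computational basis the tensor product is an entrywise product of pullbacks, so Schur's
product theorem applies block by block. -/
lemma blockProduct_posSemidef (P : Finpartition (univ : Finset V))
    (τ : (p : {p // p ∈ P.parts}) → State ({v // v ∈ p.1} → Fin d)) :
    (blockProduct P τ).PosSemidef := by
  have h : ∀ s : Finset {p // p ∈ P.parts}, (Matrix.of fun x y : V → Fin d =>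
      ∏ p ∈ s, (τ p).mat (fun v => x v.1) (fun v => y v.1)).PosSemidef := by
    intro s
    induction s using Finset.induction_on with
    | empty =>
      convert Matrix.posSemidef_vecMulVec_self_star (fun _ : V → Fin d => (1 : ℂ)) using 1
      ext x y
      simp [Matrix.vecMulVec_apply]
    | insert p s hp ih =>
      have := ((τ p).posSemidef.submatrix fun (x : V → Fin d) (v : {v // v ∈ p.1}) => x v).hadamard ih
      have heq : (Matrix.of fun x y : V → Fin d =>
          ∏ p ∈ insert p s, (τ p).mat (fun v => x v.1) (fun v => y v.1)) =
          ((τ p).mat.submatrix (fun x v => x ↑v) fun x v => x ↑v).hadamard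
            (Matrix.of fun x y => ∏ p ∈ s, (τ p).mat (fun v => x ↑v) fun v => y ↑v) := by
        ext x y
        simp [Finset.prod_insert hp, Matrix.hadamard_apply]
      rw [heq]
      exact this
  exact h univ

end Tensor

end
end QuditGraph

/-! ### Outcome densities and conditional mutual information. -/

namespace QuditGraph
open scoped ComplexOrder
noncomputable section
open scoped BigOperators ComplexConjugate
open Finset

section Resampling

variable {V : Type*} [Fintype V] [DecidableEq V] {Γ : Type*} [Fintype Γ] [Nonempty Γ]

/-- Exchanging `z v` with an independent copy `a` is an involution on pairs. -/
lemma expect_resample (v : V) (F : (V → Γ) → ℝ) :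
    𝔼 z, F z = 𝔼 z, 𝔼 a, F (Function.update z v a) := by
  set e : (V → Γ) × Γ ≃ (V → Γ) × Γ :=
    { toFun := fun x => (Function.update x.1 v x.2, x.1 v)
      invFun := fun x => (Function.update x.1 v x.2, x.1 v)
      left_inv := fun x => by simp
      right_inv := fun x => by simp } with he
  have h1 : 𝔼 x : (V → Γ) × Γ, F x.1 = 𝔼 x : (V → Γ) × Γ, F (Function.update x.1 v x.2) :=
    (Fintype.expect_equiv e _ _ fun x => rfl).symm
  have h2 : 𝔼 x : (V → Γ) × Γ, F x.1 = 𝔼 z, F z := by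
    rw [← Finset.univ_product_univ, Finset.expect_product]
    exact Finset.expect_congr rfl fun z _ => Fintype.expect_const (F z)
  rw [← h2, h1, ← Finset.univ_product_univ, Finset.expect_product]

end Resampling

section Measure

variable {V : Type*} [Fintype V] [DecidableEq V] {d : ℕ}

lemma expect_ev {Γ : Type*} [Fintype Γ] (M : Matrix (V → Fin d) (V → Fin d) ℂ)
    {Q : V → Γ → Matrix (Fin d) (Fin d) ℂ} {Q' : V → Matrix (Fin d) (Fin d) ℂ}
    (hQ : ∀ v i j, 𝔼 a, Q v a i j = Q' v i j) :
    𝔼 z : V → Γ, ev M (fun v => Q v (z v)) = ev M Q' := by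
  simp only [ev]
  rw [Finset.expect_sum_comm]
  refine Finset.sum_congr rfl fun x _ => ?_
  rw [Finset.expect_sum_comm]
  refine Finset.sum_congr rfl fun y _ => ?_
  rw [← Finset.mul_expect, expect_pi_prod fun v a => Q v a (y v) (x v)]
  simp only [hQ]

lemma expect_ev_update {Γ : Type*} [Fintype Γ] (M : Matrix (V → Fin d) (V → Fin d) ℂ)
    (O : V → Matrix (Fin d) (Fin d) ℂ) (v : V)
    {Q : Γ → Matrix (Fin d) (Fin d) ℂ} {Q' : Matrix (Fin d) (Fin d) ℂ}
    (hQ : ∀ i j, 𝔼 a, Q a i j = Q' i j) :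
    𝔼 a, ev M (Function.update O v (Q a)) = ev M (Function.update O v Q') := by
  have h : Q' = (Fintype.card Γ : ℂ)⁻¹ • ∑ a, Q a := by
    ext i j
    rw [← hQ, Fintype.expect_eq_sum_div_card, Matrix.smul_apply, Matrix.sum_apply, smul_eq_mul,
      div_eq_inv_mul]
  rw [h, ← evAt_apply, map_smul, map_sum, Fintype.expect_eq_sum_div_card, smul_eq_mul,
    div_eq_inv_mul]
  rfl

/-- The unnormalised projector onto the random vector with parameters `g`. -/
def gop (g : Fin d → Phase) : Matrix (Fin d) (Fin d) ℂ :=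
  Matrix.of fun a b => vec g a * conj (vec g b)

lemma isHermitian_gop (g : Fin d → Phase) : (gop g).IsHermitian := by
  ext a b
  simp [gop, Matrix.conjTranspose_apply, mul_comm]

lemma expect_gop (i j : Fin d) : 𝔼 g, gop g i j = (1 : Matrix (Fin d) (Fin d) ℂ) i j := by
  rw [Matrix.one_apply]
  simp only [gop, Matrix.of_apply]
  rw [← ite_congr (propext eq_comm) (fun _ => rfl) (fun _ => rfl), ← expect_wick_two]
  exact Finset.expect_congr rfl fun g _ => mul_comm _ _

/-- `gop (z v)` at the sites of `C`, and `O v` elsewhere. -/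
def measOn (C : Finset V) (z : V → Fin d → Phase) (O : V → Matrix (Fin d) (Fin d) ℂ) (v : V) :
    Matrix (Fin d) (Fin d) ℂ := if v ∈ C then gop (z v) else O v

/-- The density of the outcomes `z` of measuring the sites in `C`. -/
def dens (ρ : State (V → Fin d)) (C : Finset V) (z : V → Fin d → Phase) : ℝ :=
  (ev ρ.mat (measOn C z fun _ => 1)).re

lemma isHermitian_measOn (C : Finset V) (z : V → Fin d → Phase)
    {O : V → Matrix (Fin d) (Fin d) ℂ} (hO : ∀ v, (O v).IsHermitian) (v : V) :
    (measOn C z O v).IsHermitian := by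
  unfold measOn
  split_ifs
  · exact isHermitian_gop _
  · exact hO v

lemma ofReal_dens (ρ : State (V → Fin d)) (C : Finset V) (z : V → Fin d → Phase) :
    (dens ρ C z : ℂ) = ev ρ.mat (measOn C z fun _ => 1) :=
  ev_ofReal ρ.posSemidef.isHermitian
    (isHermitian_measOn C z fun _ => Matrix.isHermitian_one)

/-- The Kraus operators of the measurement, which leave the measured sites in the state `o`. -/
def kraus (o : Fin d) (C : Finset V) (z : V → Fin d → Phase) (v : V) :
    Matrix (Fin d) (Fin d) ℂ :=
  if v ∈ C then Matrix.of fun a b => if a = o then conj (vec (z v) b) else 0 else 1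

/-- The unnormalised state after measuring the sites of `C` with the outcomes `z`. -/
def post (ρ : State (V → Fin d)) (o : Fin d) (C : Finset V) (z : V → Fin d → Phase) :
    Matrix (V → Fin d) (V → Fin d) ℂ :=
  tens (kraus o C z) * ρ.mat * (tens (kraus o C z)).conjTranspose

lemma post_posSemidef (ρ : State (V → Fin d)) (o : Fin d) (C : Finset V) (z : V → Fin d → Phase) :
    (post ρ o C z).PosSemidef := ρ.posSemidef.mul_mul_conjTranspose_same _

/-- A measured site is reset to the basis vector `o`, so an operator there contributes only its `o`,
`o` entry. Keeping the site makes the post-measurement state live on the original system. -/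
lemma ev_post (ρ : State (V → Fin d)) (o : Fin d) (C : Finset V) (z : V → Fin d → Phase)
    (O : V → Matrix (Fin d) (Fin d) ℂ) :
    ev (post ρ o C z) O =
      ev ρ.mat fun v => if v ∈ C then O v o o • gop (z v) else O v := by
  rw [post, ev_conj]
  congr 1
  ext v : 1
  unfold kraus
  split_ifs with h
  · ext a b
    simp only [Matrix.mul_apply, Matrix.conjTranspose_apply, gop, Matrix.smul_apply,
      Matrix.of_apply, smul_eq_mul, apply_ite star, star_zero, ite_mul, mul_ite, zero_mul, mul_zero,
      Finset.sum_ite_eq', Finset.mem_univ, if_true, RCLike.star_def, Complex.conj_conj]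
    ring
  · simp

lemma ev_post_of_one (ρ : State (V → Fin d)) (o : Fin d) (C : Finset V) (z : V → Fin d → Phase)
    {O : V → Matrix (Fin d) (Fin d) ℂ} (hO : ∀ v ∈ C, O v o o = 1) :
    ev (post ρ o C z) O = ev ρ.mat (measOn C z O) := by
  rw [ev_post]
  congr 1
  ext v : 1
  unfold measOn
  split_ifs with h
  · rw [hO v h, one_smul]
  · rfl

lemma trace_post (ρ : State (V → Fin d)) (o : Fin d) (C : Finset V) (z : V → Fin d → Phase) :
    (post ρ o C z).trace = dens ρ C z := by
  rw [ofReal_dens, ← ev_one, ev_post_of_one]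
  simp

lemma nonempty_site_of_state (ρ : State (V → Fin d)) (v : V) : Nonempty (Fin d) := by
  by_contra h
  have h0 : IsEmpty (V → Fin d) := ⟨fun x => h ⟨x v⟩⟩
  have := ρ.trace_eq_one
  simp [Matrix.trace] at this

lemma dens_empty (ρ : State (V → Fin d)) (z : V → Fin d → Phase) : dens ρ ∅ z = 1 := by
  have : measOn ∅ z (fun _ => 1) = fun _ => (1 : Matrix (Fin d) (Fin d) ℂ) := by
    ext v : 1
    simp [measOn]
  rw [dens, this, ev_one, ρ.trace_eq_one, Complex.one_re]

lemma dens_nonneg (ρ : State (V → Fin d)) (C : Finset V) (z : V → Fin d → Phase) :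
    0 ≤ dens ρ C z := by
  rcases isEmpty_or_nonempty V with hV | ⟨⟨v⟩⟩
  · rw [Finset.eq_empty_of_isEmpty C, dens_empty]
    exact zero_le_one
  · obtain ⟨o⟩ := nonempty_site_of_state ρ v
    have := (post_posSemidef ρ o C z).trace_nonneg
    rw [trace_post] at this
    exact_mod_cast this

lemma post_eq_zero {ρ : State (V → Fin d)} (o : Fin d) {C : Finset V} {z : V → Fin d → Phase}
    (h : dens ρ C z = 0) : post ρ o C z = 0 := by
  rw [← (post_posSemidef ρ o C z).trace_eq_zero_iff, trace_post, h, Complex.ofReal_zero]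

/-- An outcome of density zero leaves a positive semidefinite matrix of trace zero, hence zero, so
every correlation with it vanishes. This makes divisions by the density harmless. -/
lemma ev_measOn_eq_zero {ρ : State (V → Fin d)} {C : Finset V} {z : V → Fin d → Phase}
    (h : dens ρ C z = 0) (O : V → Matrix (Fin d) (Fin d) ℂ) : ev ρ.mat (measOn C z O) = 0 := by
  rcases isEmpty_or_nonempty V with hV | ⟨⟨v⟩⟩
  · rw [Finset.eq_empty_of_isEmpty C, dens_empty] at h
    exact absurd h one_ne_zero
  · obtain ⟨o⟩ := nonempty_site_of_state ρ v
    have h2 : ev ρ.mat (measOn C z O) = ev (post ρ o C z) (fun v => if v ∈ C then 1 else O v) := by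
      rw [ev_post_of_one _ _ _ _ (by simp +contextual)]
      congr 1
      ext v : 1
      by_cases hv : v ∈ C <;> simp [measOn, hv]
    rw [h2, post_eq_zero o h, ev_zero]

lemma dens_eq_zero_mono {ρ : State (V → Fin d)} {C C' : Finset V} {z : V → Fin d → Phase}
    (hC : C ⊆ C') (h : dens ρ C z = 0) : dens ρ C' z = 0 := by
  have : measOn C' z (fun _ => 1) = measOn C z (measOn C' z fun _ => 1) := by
    ext v : 1
    by_cases hv : v ∈ C
    · simp [measOn, hv, hC hv]
    · simp [measOn, hv]
  rw [dens, this, ev_measOn_eq_zero h, Complex.zero_re]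

lemma dens_update_of_notMem (ρ : State (V → Fin d)) {C : Finset V} {v : V} (hv : v ∉ C)
    (z : V → Fin d → Phase) (g : Fin d → Phase) :
    dens ρ C (Function.update z v g) = dens ρ C z := by
  unfold dens
  congr 2
  ext w : 1
  unfold measOn
  split_ifs with h
  · rw [Function.update_of_ne (ne_of_mem_of_not_mem h hv)]
  · rfl

lemma measOn_insert_update {C : Finset V} {v : V} (hv : v ∉ C)
    (z : V → Fin d → Phase) (g : Fin d → Phase) (O : V → Matrix (Fin d) (Fin d) ℂ) :
    measOn (insert v C) (Function.update z v g) O =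
      Function.update (measOn C z O) v (gop g) := by
  ext w : 1
  by_cases hw : w = v
  · subst hw; simp [measOn]
  · simp [measOn, hw]

lemma expect_dens_insert (ρ : State (V → Fin d)) {C : Finset V} {v : V} (hv : v ∉ C)
    (z : V → Fin d → Phase) :
    𝔼 g, dens ρ (insert v C) (Function.update z v g) = dens ρ C z := by
  have h : ∀ g, dens ρ (insert v C) (Function.update z v g) =
      (ev ρ.mat (Function.update (measOn C z fun _ => 1) v (gop g))).re := by
    intro g
    rw [dens, measOn_insert_update hv]
  simp only [h]
  rw [← re_expect, expect_ev_update _ _ _ expect_gop, dens]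
  congr 2
  ext w : 1
  by_cases hw : w = v
  · subst hw; simp [measOn, hv]
  · simp [hw]

/-- Marginalisation: the outcome at `v` averages out against a function that ignores it. -/
lemma expect_dens_insert_mul (ρ : State (V → Fin d)) {C : Finset V} {v : V} (hv : v ∉ C)
    {φ : (V → Fin d → Phase) → ℝ} (hφ : ∀ z g, φ (Function.update z v g) = φ z) :
    𝔼 z, dens ρ (insert v C) z * φ z = 𝔼 z, dens ρ C z * φ z := by
  rw [expect_resample v]
  refine Finset.expect_congr rfl fun z _ => ?_
  simp only [hφ]
  rw [← Finset.expect_mul, expect_dens_insert ρ hv]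

lemma expect_dens (ρ : State (V → Fin d)) (C : Finset V) : 𝔼 z, dens ρ C z = 1 := by
  induction C using Finset.induction_on with
  | empty => simp [dens_empty]
  | insert v C hv ih =>
    have := expect_dens_insert_mul ρ hv (φ := fun _ => 1) (fun _ _ => rfl)
    simpa [ih] using this

/-- The negative differential entropy of the outcomes of measuring the sites in `C`. -/
def outcomeInfo (ρ : State (V → Fin d)) (C : Finset V) : ℝ :=
  𝔼 z, dens ρ C z * Real.log (dens ρ C z)

/-- The product density of the outcomes at `u` and `v` conditional on the outcomes in `C`. -/
def prodDens (ρ : State (V → Fin d)) (C : Finset V) (u v : V) (z : V → Fin d → Phase) : ℝ :=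
  dens ρ (insert u C) z * dens ρ (insert v C) z / dens ρ C z

lemma sq_expect_abs_dens_sub_le (ρ : State (V → Fin d)) {C : Finset V} {u v : V} (huv : u ≠ v)
    (hu : u ∉ C) (hv : v ∉ C) :
    (𝔼 z, |dens ρ (insert u (insert v C)) z - prodDens ρ C u v z|) ^ 2 ≤
      2 * (outcomeInfo ρ (insert u (insert v C)) - outcomeInfo ρ (insert u C) -
        outcomeInfo ρ (insert v C) + outcomeInfo ρ C) := by
  have huv' : u ∉ insert v C := by simp [huv, hu]
  have hvu' : v ∉ insert u C := by simp [huv.symm, hv]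
  have hz : ∀ z, prodDens ρ C u v z = 0 → dens ρ (insert u (insert v C)) z = 0 := by
    intro z h
    rw [prodDens, div_eq_zero_iff, mul_eq_zero] at h
    rcases h with (h | h) | h
    · exact dens_eq_zero_mono (Finset.insert_subset_insert _ (Finset.subset_insert _ _)) h
    · exact dens_eq_zero_mono (Finset.subset_insert _ _) h
    · exact dens_eq_zero_mono ((Finset.subset_insert _ _).trans (Finset.subset_insert _ _)) h
  -- Integrating out the outcome at `u` leaves the density on `insert v C`; where the density on `C`
  -- vanishes, so does this one.
  have hq : 𝔼 z, prodDens ρ C u v z = 1 := by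
    have h1 : ∀ z, prodDens ρ C u v z =
        dens ρ (insert u C) z * (dens ρ (insert v C) z / dens ρ C z) := fun z => mul_div_assoc _ _ _
    simp only [h1]
    rw [expect_dens_insert_mul ρ hu fun z g => by
      rw [dens_update_of_notMem ρ huv', dens_update_of_notMem ρ hu], ← expect_dens ρ (insert v C)]
    refine Finset.expect_congr rfl fun z _ => ?_
    by_cases h : dens ρ C z = 0
    · rw [h, zero_mul, dens_eq_zero_mono (Finset.subset_insert _ _) h]
    · field_simp
  have hnn : ∀ z, 0 ≤ prodDens ρ C u v z := fun z =>
    div_nonneg (mul_nonneg (dens_nonneg ρ _ z) (dens_nonneg ρ _ z)) (dens_nonneg ρ _ z)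
  refine (pinsker (fun z => dens_nonneg ρ _ z) hnn hz (expect_dens ρ _) hq).trans (le_of_eq ?_)
  congr 1
  have hlog : ∀ z, dens ρ (insert u (insert v C)) z * (Real.log (dens ρ (insert u (insert v C)) z) -
      Real.log (prodDens ρ C u v z)) =
      dens ρ (insert u (insert v C)) z * Real.log (dens ρ (insert u (insert v C)) z) -
      dens ρ (insert v (insert u C)) z * Real.log (dens ρ (insert u C) z) -
      dens ρ (insert u (insert v C)) z * Real.log (dens ρ (insert v C) z) +
      dens ρ (insert u (insert v C)) z * Real.log (dens ρ C z) := by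
    intro z
    rw [Finset.insert_comm v u]
    by_cases h : dens ρ (insert u (insert v C)) z = 0
    · simp [h]
    · have h' := mt (hz z) h
      rw [prodDens, div_eq_zero_iff, mul_eq_zero] at h'
      push Not at h'
      rw [prodDens, Real.log_div (mul_ne_zero h'.1.1 h'.1.2) h'.2, Real.log_mul h'.1.1 h'.1.2]
      ring
  simp only [hlog]
  rw [Finset.expect_add_distrib, Finset.expect_sub_distrib, Finset.expect_sub_distrib,
    expect_dens_insert_mul ρ hvu' (φ := fun z => Real.log (dens ρ (insert u C) z)) (fun z g => by
      rw [dens_update_of_notMem ρ hvu']),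
    expect_dens_insert_mul ρ huv' (φ := fun z => Real.log (dens ρ (insert v C) z)) (fun z g => by
      rw [dens_update_of_notMem ρ huv']),
    expect_dens_insert_mul ρ huv' (φ := fun z => Real.log (dens ρ C z)) (fun z g => by
      rw [dens_update_of_notMem ρ hu]),
    expect_dens_insert_mul ρ hv (φ := fun z => Real.log (dens ρ C z)) (fun z g => by
      rw [dens_update_of_notMem ρ hv])]
  rfl

lemma discDeriv_discDeriv_outcomeInfo (ρ : State (V → Fin d)) {C : Finset V} {u v : V}
    (huv : u ≠ v) (hu : u ∉ C) (hv : v ∉ C) :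
    discDeriv u (discDeriv v (outcomeInfo ρ)) C =
      outcomeInfo ρ (insert u (insert v C)) - outcomeInfo ρ (insert u C) -
        outcomeInfo ρ (insert v C) + outcomeInfo ρ C := by
  have h1 : (insert u C).erase v = insert u C := Finset.erase_eq_of_notMem (by simp [huv.symm, hv])
  simp only [discDeriv, Finset.erase_eq_of_notMem hu, Finset.erase_eq_of_notMem hv, h1,
    Finset.insert_comm v u]
  ring

lemma sq_expect_abs_dens_sub_le_discDeriv (ρ : State (V → Fin d)) {C : Finset V} {u v : V}
    (huv : u ≠ v) (hu : u ∉ C) (hv : v ∉ C) :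
    (𝔼 z, |dens ρ (insert u (insert v C)) z - prodDens ρ C u v z|) ^ 2 ≤
      2 * discDeriv u (discDeriv v (outcomeInfo ρ)) C := by
  rw [discDeriv_discDeriv_outcomeInfo ρ huv hu hv]
  exact sq_expect_abs_dens_sub_le ρ huv hu hv

/-- The mixed difference does not depend on whether u or v lies in S. After removing both, it is at
least half of a square by Pinsker. -/
lemma discDeriv_discDeriv_outcomeInfo_nonneg (ρ : State (V → Fin d)) {u v : V} (huv : u ≠ v)
    (S : Finset V) : 0 ≤ discDeriv u (discDeriv v (outcomeInfo ρ)) S := by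
  have h1 := sq_expect_abs_dens_sub_le_discDeriv ρ (C := (S.erase u).erase v) huv (by simp)
    (by simp)
  have h2 : discDeriv u (discDeriv v (outcomeInfo ρ)) S =
      discDeriv u (discDeriv v (outcomeInfo ρ)) ((S.erase u).erase v) := by
    have e1 : insert v (insert u S) = insert v (insert u ((S.erase u).erase v)) := by
      ext w; simp only [Finset.mem_insert, Finset.mem_erase]; tauto
    have e2 : (insert u S).erase v = (insert u ((S.erase u).erase v)).erase v := by
      ext w; simp only [Finset.mem_insert, Finset.mem_erase]; tauto
    have e3 : insert v (S.erase u) = insert v (((S.erase u).erase v).erase u) := by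
      ext w; simp only [Finset.mem_insert, Finset.mem_erase]; tauto
    have e4 : (S.erase u).erase v = (((S.erase u).erase v).erase u).erase v := by
      ext w; simp only [Finset.mem_erase]; tauto
    simp only [discDeriv]
    rw [e1, e2, e3, ← e4]
  rw [h2]
  nlinarith [sq_nonneg (𝔼 z, |dens ρ (insert u (insert v ((S.erase u).erase v))) z -
    prodDens ρ ((S.erase u).erase v) u v z|)]

end Measure

end
end QuditGraph

/-! ### Comparing outcome information with quantum mutual information. -/

namespace QuditGraph
open scoped ComplexOrder
noncomputable section
open scoped BigOperators ComplexConjugate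
open Finset

section OutcomeColumns

variable {W : Type*} [Fintype W] [DecidableEq W] {d : ℕ}

/-- The number of joint measurement outcomes at the sites `W`. -/
def numOutcomes (W : Type*) [Fintype W] [DecidableEq W] (d : ℕ) : ℝ :=
  Fintype.card (W → Fin d → Phase)

lemma numOutcomes_pos : 0 < numOutcomes W d := by
  unfold numOutcomes
  exact_mod_cast Fintype.card_pos

/-- The normalised measurement vectors at the sites `W`, as columns. -/
def outcomeCols (W : Type*) [Fintype W] [DecidableEq W] (d : ℕ) :
    Matrix (W → Fin d) (W → Fin d → Phase) ℂ :=
  Matrix.of fun x g => (((√(numOutcomes W d))⁻¹ : ℝ) : ℂ) * ∏ w, vec (g w) (x w)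

lemma inv_sqrt_mul_inv_sqrt {x : ℝ} (hx : 0 < x) :
    (((√x)⁻¹ : ℝ) : ℂ) * (((√x)⁻¹ : ℝ) : ℂ) = (x : ℂ)⁻¹ := by
  rw [← Complex.ofReal_mul, ← mul_inv, Real.mul_self_sqrt hx.le, Complex.ofReal_inv]

lemma outcomeCols_mul_conjTranspose :
    outcomeCols W d * (outcomeCols W d).conjTranspose = 1 := by
  ext x y
  have h : ∀ g, outcomeCols W d x g * (outcomeCols W d).conjTranspose g y =
      (numOutcomes W d : ℂ)⁻¹ * ∏ w, gop (g w) (x w) (y w) := by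
    intro g
    rw [← inv_sqrt_mul_inv_sqrt numOutcomes_pos]
    simp only [Matrix.conjTranspose_apply, outcomeCols, Matrix.of_apply, gop, star_mul', star_prod,
      RCLike.star_def, Complex.conj_ofReal, Finset.prod_mul_distrib]
    ring
  rw [Matrix.mul_apply, Finset.sum_congr rfl fun g _ => h g, ← Finset.mul_sum]
  have h2 := expect_pi_prod fun (w : W) (g : Fin d → Phase) => gop g (x w) (y w)
  rw [Fintype.expect_eq_sum_div_card, div_eq_inv_mul] at h2
  have h3 : ((numOutcomes W d : ℝ) : ℂ) = (Fintype.card (W → Fin d → Phase) : ℂ) := by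
    simp [numOutcomes]
  rw [h3, h2]
  simp only [expect_gop]
  rw [← tens_one]
  rfl

lemma colForm_outcomeCols (M : Matrix (W → Fin d) (W → Fin d) ℂ) (g : W → Fin d → Phase) :
    colForm M (outcomeCols W d) g = (ev M fun w => gop (g w)).re / numOutcomes W d := by
  have h : ((outcomeCols W d).conjTranspose * M * outcomeCols W d) g g =
      (numOutcomes W d : ℂ)⁻¹ * ev M fun w => gop (g w) := by
    rw [Matrix.mul_assoc, ← inv_sqrt_mul_inv_sqrt numOutcomes_pos]
    simp only [Matrix.mul_apply, Matrix.conjTranspose_apply, outcomeCols, Matrix.of_apply, ev, gop,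
      star_mul', star_prod, RCLike.star_def, Complex.conj_ofReal, Finset.prod_mul_distrib,
      Finset.mul_sum]
    exact Finset.sum_congr rfl fun x _ => Finset.sum_congr rfl fun y _ => by ring
  rw [colForm, h, ← Complex.ofReal_inv, Complex.re_ofReal_mul, div_eq_inv_mul]

/-- Passing from densities relative to the uniform law to probabilities shifts the entropy by the
log of the number of outcomes. -/
lemma sum_colForm_outcomeCols_mul_log {M : Matrix (W → Fin d) (W → Fin d) ℂ}
    (hM : 𝔼 g : W → Fin d → Phase, (ev M fun w => gop (g w)).re = 1) :
    ∑ g, colForm M (outcomeCols W d) g * Real.log (colForm M (outcomeCols W d) g) =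
      (𝔼 g : W → Fin d → Phase, (ev M fun w => gop (g w)).re *
        Real.log (ev M fun w => gop (g w)).re) - Real.log (numOutcomes W d) := by
  have hN := (numOutcomes_pos (W := W) (d := d))
  have h : ∀ g, colForm M (outcomeCols W d) g * Real.log (colForm M (outcomeCols W d) g) =
      ((ev M fun w => gop (g w)).re * Real.log (ev M fun w => gop (g w)).re -
        (ev M fun w => gop (g w)).re * Real.log (numOutcomes W d)) / numOutcomes W d := by
    intro g
    rw [colForm_outcomeCols]
    by_cases h0 : (ev M fun w => gop (g w)).re = 0
    · simp [h0]
    · rw [Real.log_div h0 hN.ne']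
      ring
  rw [Finset.sum_congr rfl fun g _ => h g, ← Finset.sum_div]
  have h2 := Fintype.expect_eq_sum_div_card fun g : W → Fin d → Phase =>
    ((ev M fun w => gop (g w)).re * Real.log (ev M fun w => gop (g w)).re -
        (ev M fun w => gop (g w)).re * Real.log (numOutcomes W d))
  rw [numOutcomes] at h2 ⊢
  rw [← h2, Finset.expect_sub_distrib, ← Finset.expect_mul, hM, one_mul]

end OutcomeColumns

section MutualInfo

variable {V : Type*} [Fintype V] [DecidableEq V] {d : ℕ}

/-- A configuration is a pair of configurations on `p` and on its complement. -/
def splitAt (X : Type*) (p : Finset V) :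
    (V → X) ≃ ({v // v ∈ p} → X) × ({v // v ∈ pᶜ} → X) :=
  (Equiv.piEquivPiSubtypeProd (fun v => v ∈ p) fun _ => X).trans
    (Equiv.prodCongr (Equiv.refl _)
      (Equiv.arrowCongr (Equiv.subtypeEquivRight fun v => by simp) (Equiv.refl _)))

lemma splitAt_apply_fst {X : Type*} (p : Finset V) (x : V → X) (v : {v // v ∈ p}) :
    (splitAt X p x).1 v = x v := rfl

lemma splitAt_apply_snd {X : Type*} (p : Finset V) (x : V → X) (v : {v // v ∈ pᶜ}) :
    (splitAt X p x).2 v = x v := rfl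

lemma prod_split (p : Finset V) (f : V → ℂ) :
    ∏ v, f v = (∏ v : {v // v ∈ p}, f v) * ∏ v : {v // v ∈ pᶜ}, f v := by
  rw [Finset.prod_coe_sort p, Finset.prod_coe_sort pᶜ, Finset.prod_mul_prod_compl]

lemma numOutcomes_split (p : Finset V) :
    numOutcomes V d = numOutcomes {v // v ∈ p} d * numOutcomes {v // v ∈ pᶜ} d := by
  unfold numOutcomes
  rw [Fintype.card_congr (splitAt (Fin d → Phase) p), Fintype.card_prod, Nat.cast_mul]

lemma prodCols_outcomeCols (p : Finset V) (x : V → Fin d)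
    (gh : ({v // v ∈ p} → Fin d → Phase) × ({v // v ∈ pᶜ} → Fin d → Phase)) :
    prodCols (splitAt (Fin d) p) (outcomeCols _ d) (outcomeCols _ d) x gh =
      outcomeCols V d x ((splitAt _ p).symm gh) := by
  obtain ⟨z, rfl⟩ := (splitAt _ p).surjective gh
  simp only [prodCols, outcomeCols, Matrix.of_apply, Equiv.symm_apply_apply, numOutcomes_split p,
    prod_split p, splitAt_apply_fst, splitAt_apply_snd]
  rw [Real.sqrt_mul numOutcomes_pos.le, mul_inv, Complex.ofReal_mul]
  ring

lemma colForm_prodCols_outcomeCols (p : Finset V) (M : Matrix (V → Fin d) (V → Fin d) ℂ)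
    (gh : ({v // v ∈ p} → Fin d → Phase) × ({v // v ∈ pᶜ} → Fin d → Phase)) :
    colForm M (prodCols (splitAt (Fin d) p) (outcomeCols _ d) (outcomeCols _ d)) gh =
      colForm M (outcomeCols V d) ((splitAt _ p).symm gh) := by
  simp only [colForm, Matrix.mul_apply, Matrix.conjTranspose_apply, prodCols_outcomeCols]

lemma ev_marginal_gop (ρ : State (V → Fin d)) (S : Finset V) (z : V → Fin d → Phase) :
    (ev (ρ.marginal S).mat fun v => gop (z v)).re = dens ρ S z := by
  rw [ev_marginal, dens]
  congr 2

lemma ev_gop (ρ : State (V → Fin d)) (z : V → Fin d → Phase) :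
    (ev ρ.mat fun v => gop (z v)).re = dens ρ univ z := by
  rw [dens]
  congr 2
  ext v : 1
  simp [measOn]

lemma expect_restrict (S : Finset V) (F : ({v // v ∈ S} → Fin d → Phase) → ℝ) :
    𝔼 z : V → Fin d → Phase, F (fun v => z v) = 𝔼 g, F g := by
  rw [Fintype.expect_equiv (splitAt (Fin d → Phase) S) (fun z => F fun v => z v)
    (fun gh => F gh.1) fun z => rfl, ← Finset.univ_product_univ, Finset.expect_product]
  exact Finset.expect_congr rfl fun z _ => Fintype.expect_const (F z)

lemma expect_ev_marginal_gop (ρ : State (V → Fin d)) (S : Finset V) :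
    𝔼 g : {v // v ∈ S} → Fin d → Phase, (ev (ρ.marginal S).mat fun v => gop (g v)).re = 1 := by
  rw [← expect_restrict, ← expect_dens ρ S]
  exact Finset.expect_congr rfl fun z _ => ev_marginal_gop ρ S z

lemma expect_ev_marginal_gop_log (ρ : State (V → Fin d)) (S : Finset V) :
    𝔼 g : {v // v ∈ S} → Fin d → Phase, (ev (ρ.marginal S).mat fun v => gop (g v)).re *
      Real.log (ev (ρ.marginal S).mat fun v => gop (g v)).re = outcomeInfo ρ S := by
  rw [← expect_restrict]
  exact Finset.expect_congr rfl fun z _ => by rw [ev_marginal_gop]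

lemma outcomeInfo_empty (ρ : State (V → Fin d)) : outcomeInfo ρ ∅ = 0 := by
  simp [outcomeInfo, dens_empty]

lemma glue_eq_splitAt_symm (p : Finset V) (a : {v // v ∈ p} → Fin d) (c : {v // v ∉ p} → Fin d) :
    glue p a c = (splitAt (Fin d) p).symm (a, fun v => c ⟨v, Finset.mem_compl.1 v.2⟩) := by
  rw [Equiv.eq_symm_apply]
  refine Prod.ext ?_ ?_
  · ext v : 1
    rw [splitAt_apply_fst]
    simp [glue, Equiv.piEquivPiSubtypeProd]
  · ext v : 1
    rw [splitAt_apply_snd]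
    have := Finset.mem_compl.1 v.2
    simp [glue, Equiv.piEquivPiSubtypeProd, this]

lemma marginal_apply (ρ : State (V → Fin d)) (p : Finset V) (a a' : {v // v ∈ p} → Fin d) :
    (ρ.marginal p).mat a a' = ∑ b, ρ.mat ((splitAt (Fin d) p).symm (a, b))
      ((splitAt (Fin d) p).symm (a', b)) := by
  simp only [State.marginal, Matrix.sum_apply, Matrix.submatrix_apply, glue_eq_splitAt_symm]
  exact Fintype.sum_equiv (Equiv.arrowCongr (Equiv.subtypeEquivRight fun v => by simp)
    (Equiv.refl (Fin d))) _ _ fun c => rfl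

lemma marginal_compl_apply (ρ : State (V → Fin d)) (p : Finset V)
    (b b' : {v // v ∈ pᶜ} → Fin d) :
    (ρ.marginal pᶜ).mat b b' = ∑ a, ρ.mat ((splitAt (Fin d) p).symm (a, b))
      ((splitAt (Fin d) p).symm (a, b')) := by
  simp only [State.marginal, Matrix.sum_apply, Matrix.submatrix_apply]
  have h : ∀ (b : {v // v ∈ pᶜ} → Fin d) (c : {v // v ∉ pᶜ} → Fin d), glue pᶜ b c =
      (splitAt (Fin d) p).symm (fun v => c ⟨v, by simp [v.2]⟩, b) := by
    intro b c
    rw [Equiv.eq_symm_apply]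
    refine Prod.ext ?_ ?_
    · ext v : 1
      rw [splitAt_apply_fst]
      simp [glue, Equiv.piEquivPiSubtypeProd]
    · ext v : 1
      rw [splitAt_apply_snd]
      have := Finset.mem_compl.1 v.2
      simp [glue, Equiv.piEquivPiSubtypeProd, this]
  simp only [h]
  exact Fintype.sum_equiv (Equiv.arrowCongr (Equiv.subtypeEquivRight fun v => by simp)
    (Equiv.refl (Fin d))) _ _ fun c => rfl

/-- The normalised product vectors resolve the identity on the block and on its complement, so data
processing applies. The numbers of outcomes multiply across the cut and their logarithms cancel. -/
theorem outcomeInfo_cut_le_mutualInfo (ρ : State (V → Fin d)) (p : Finset V) :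
    outcomeInfo ρ univ - outcomeInfo ρ p - outcomeInfo ρ pᶜ + outcomeInfo ρ ∅ ≤ ρ.mutualInfo p := by
  have h := measured_mutualInfo_le ρ (ρ.marginal p) (ρ.marginal pᶜ) (marginal_apply ρ p)
    (marginal_compl_apply ρ p) outcomeCols_mul_conjTranspose outcomeCols_mul_conjTranspose
  have hρ : 𝔼 z : V → Fin d → Phase, (ev ρ.mat fun v => gop (z v)).re = 1 := by
    simp only [ev_gop, expect_dens]
  have h1 : (𝔼 z : V → Fin d → Phase, (ev ρ.mat fun v => gop (z v)).re *
      Real.log (ev ρ.mat fun v => gop (z v)).re) = outcomeInfo ρ univ := by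
    simp only [ev_gop, outcomeInfo]
  simp only [colForm_prodCols_outcomeCols] at h
  rw [(splitAt (Fin d → Phase) p).symm.sum_comp fun z => colForm ρ.mat (outcomeCols V d) z *
      Real.log (colForm ρ.mat (outcomeCols V d) z), sum_colForm_outcomeCols_mul_log hρ,
    sum_colForm_outcomeCols_mul_log (expect_ev_marginal_gop ρ p),
    sum_colForm_outcomeCols_mul_log (expect_ev_marginal_gop ρ pᶜ), h1,
    expect_ev_marginal_gop_log, expect_ev_marginal_gop_log, numOutcomes_split p,
    Real.log_mul numOutcomes_pos.ne' numOutcomes_pos.ne'] at h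
  rw [outcomeInfo_empty, State.mutualInfo]
  linarith

end MutualInfo

end
end QuditGraph

/-! ### Trace norm estimates. -/

namespace QuditGraph
open scoped ComplexOrder
noncomputable section
open scoped BigOperators ComplexConjugate
open Finset

section TraceNorm

variable {ι : Type*} [Fintype ι] [DecidableEq ι]

lemma sum_eigenvalues_conjTranspose_mul_self (A : Matrix ι ι ℂ) :
    ∑ i, (Matrix.isHermitian_conjTranspose_mul_self A).eigenvalues i = frobSq A := by
  have h := (Matrix.isHermitian_conjTranspose_mul_self A).trace_eq_sum_eigenvalues
  have h2 : (A * A.conjTranspose).trace = frobSq A := by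
    simp [Matrix.trace, Matrix.mul_apply, frobSq, Complex.mul_conj]
  rw [Matrix.trace_mul_comm, h2] at h
  exact Complex.ofReal_injective (by rw [h]; push_cast; rfl)

/-- Cauchy–Schwarz over the singular values. -/
lemma traceNorm_le_sqrt (A : Matrix ι ι ℂ) :
    traceNorm A ≤ √(Fintype.card ι * frobSq A) := by
  refine Real.le_sqrt_of_sq_le ?_
  refine (sq_sum_le_card_mul_sum_sq).trans (le_of_eq ?_)
  rw [Finset.card_univ, ← sum_eigenvalues_conjTranspose_mul_self]
  congr 1
  exact Finset.sum_congr rfl fun i _ =>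
    Real.sq_sqrt ((Matrix.posSemidef_conjTranspose_mul_self A).eigenvalues_nonneg i)

lemma traceNorm_zero : traceNorm (0 : Matrix ι ι ℂ) = 0 := by
  refine le_antisymm ((traceNorm_le_sqrt 0).trans ?_)
    (Finset.sum_nonneg fun i _ => Real.sqrt_nonneg _)
  simp [frobSq]

/-- The matrix A†A is unitarily equivalent to the diagonal of the squares. Equal characteristic
polynomials give equal multisets of eigenvalues, which is enough for a symmetric sum. -/
lemma traceNorm_eq_sum_abs {A U : Matrix ι ι ℂ} {a : ι → ℝ} (hU : U * U.conjTranspose = 1)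
    (hA : U.conjTranspose * A * U = Matrix.diagonal fun i => (a i : ℂ)) :
    traceNorm A = ∑ i, |a i| := by
  have hU' : U.conjTranspose * U = 1 := mul_eq_one_comm.1 hU
  set B := A.conjTranspose * A
  have hB : U.conjTranspose * B * U = Matrix.diagonal fun i => ((a i ^ 2 : ℝ) : ℂ) := by
    have h1 : U.conjTranspose * B * U =
        (U.conjTranspose * A * U).conjTranspose * (U.conjTranspose * A * U) := by
      simp only [Matrix.conjTranspose_mul, Matrix.conjTranspose_conjTranspose, B]
      calc _ = U.conjTranspose * A.conjTranspose * 1 * A * U := by simp only [mul_assoc, one_mul]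
        _ = _ := by rw [← hU]; simp only [mul_assoc]
    rw [h1, hA, Matrix.diagonal_conjTranspose, Matrix.diagonal_mul_diagonal]
    congr 1
    ext i
    simp [sq]
  have hc : B.charpoly = (Matrix.diagonal fun i => ((a i ^ 2 : ℝ) : ℂ)).charpoly := by
    rw [← hB, Matrix.charpoly_mul_comm _ U, ← mul_assoc, ← mul_assoc, hU, one_mul]
  have hr := (Matrix.isHermitian_conjTranspose_mul_self A).roots_charpoly_eq_eigenvalues
  change B.charpoly.roots = _ at hr
  rw [hc, Matrix.charpoly_diagonal, Polynomial.roots_prod _ _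
    (Finset.prod_ne_zero_iff.2 fun i _ => Polynomial.X_sub_C_ne_zero _)] at hr
  simp only [Polynomial.roots_X_sub_C, Multiset.bind_singleton] at hr
  have hr2 := congrArg (fun s : Multiset ℂ => (s.map fun z => √z.re).sum) hr
  simp only [Multiset.map_map, Function.comp_def] at hr2
  have h3 : ∑ i, √(((a i ^ 2 : ℝ) : ℂ).re) = ∑ i, √((RCLike.ofReal
      ((Matrix.isHermitian_conjTranspose_mul_self A).eigenvalues i) : ℂ).re) := hr2
  simp only [Complex.ofReal_re, Real.sqrt_sq_eq_abs] at h3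
  rw [h3]
  rfl

/-- In an eigenbasis of the difference, each |eigenvalue| is at most the sum of the two diagonal
entries, and each diagonal sums to one. -/
lemma traceNorm_sub_le_two (ρ σ : State ι) : traceNorm (ρ.mat - σ.mat) ≤ 2 := by
  have hH : (ρ.mat - σ.mat).IsHermitian := ρ.posSemidef.isHermitian.sub σ.posSemidef.isHermitian
  set U : Matrix ι ι ℂ := hH.eigenvectorUnitary.1
  have hU : U * U.conjTranspose = 1 := Unitary.coe_mul_star_self _
  have hA : U.conjTranspose * (ρ.mat - σ.mat) * U =
      Matrix.diagonal fun i => ((hH.eigenvalues i : ℝ) : ℂ) := by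
    have := hH.conjStarAlgAut_star_eigenvectorUnitary
    rw [Unitary.conjStarAlgAut_star_apply] at this
    exact this
  rw [traceNorm_eq_sum_abs hU hA]
  have htr : ∀ τ : State ι, ∑ i, ((U.conjTranspose * τ.mat * U) i i).re = 1 := by
    intro τ
    rw [← Complex.re_sum]
    change Complex.re (Matrix.trace (U.conjTranspose * τ.mat * U)) = 1
    rw [Matrix.trace_mul_comm, ← mul_assoc, hU, one_mul, τ.trace_eq_one, Complex.one_re]
  have hnn : ∀ (τ : State ι) i, 0 ≤ ((U.conjTranspose * τ.mat * U) i i).re := fun τ i =>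
    colForm_nonneg τ.posSemidef U i
  have hi : ∀ i, hH.eigenvalues i = ((U.conjTranspose * ρ.mat * U) i i).re -
      ((U.conjTranspose * σ.mat * U) i i).re := by
    intro i
    have := congrArg Complex.re (congrFun (congrFun hA i) i)
    rw [mul_sub, sub_mul, Matrix.sub_apply, Complex.sub_re, Matrix.diagonal_apply_eq,
      Complex.ofReal_re] at this
    exact this.symm
  calc ∑ i, |hH.eigenvalues i| ≤ ∑ i, (((U.conjTranspose * ρ.mat * U) i i).re +
      ((U.conjTranspose * σ.mat * U) i i).re) := by
        refine Finset.sum_le_sum fun i _ => ?_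
        rw [hi, abs_le]
        constructor <;> linarith [hnn ρ i, hnn σ i]
    _ = 2 := by rw [Finset.sum_add_distrib, htr, htr]; norm_num

end TraceNorm

end
end QuditGraph

/-! ### Two-site reductions and the clustered separable state. -/

namespace QuditGraph
open scoped ComplexOrder
noncomputable section
open scoped BigOperators ComplexConjugate
open Finset

section Resampling

variable {V : Type*} [Fintype V] [DecidableEq V] {Γ : Type*} [Fintype Γ] [Nonempty Γ]

lemma expect_resample_two (u v : V) (F : (V → Γ) → ℝ) :
    𝔼 g, 𝔼 h, 𝔼 z, F (Function.update (Function.update z v h) u g) = 𝔼 z, F z := by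
  have h1 : ∀ g, 𝔼 h, 𝔼 z, F (Function.update (Function.update z v h) u g) =
      𝔼 z, F (Function.update z u g) := fun g => by
    rw [Finset.expect_comm, ← expect_resample v fun z => F (Function.update z u g)]
  simp only [h1]
  rw [Finset.expect_comm, ← expect_resample u F]

end Resampling

section Pairs

variable {V : Type*} [Fintype V] [DecidableEq V] {d : ℕ}

/-- The product operator acting as `X` at `u` and as `Y` at `v`. -/
def pairOp (u v : V) (X Y : Matrix (Fin d) (Fin d) ℂ) : V → Matrix (Fin d) (Fin d) ℂ :=
  Function.update (Function.update (fun _ => 1) u X) v Y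

/-- The two-site reduced matrix at `u` and `v`. -/
def pairMat (M : Matrix (V → Fin d) (V → Fin d) ℂ) (u v : V) :
    Matrix (Fin d × Fin d) (Fin d × Fin d) ℂ :=
  Matrix.of fun x y => ev M (pairOp u v (Matrix.single y.1 x.1 1) (Matrix.single y.2 x.2 1))

lemma map_matrix_eq_sum (L : Matrix (Fin d) (Fin d) ℂ →ₗ[ℂ] ℂ) (X : Matrix (Fin d) (Fin d) ℂ) :
    L X = ∑ a, ∑ a', X a' a * L (Matrix.single a' a 1) := by
  conv_lhs => rw [Matrix.matrix_eq_sum_single X]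
  rw [Finset.sum_comm, map_sum]
  refine Finset.sum_congr rfl fun a _ => ?_
  rw [map_sum]
  refine Finset.sum_congr rfl fun a' _ => ?_
  rw [← smul_eq_mul, ← map_smul, Matrix.smul_single, smul_eq_mul, mul_one]

lemma ev_pairOp_left {u v : V} (huv : u ≠ v) (M : Matrix (V → Fin d) (V → Fin d) ℂ)
    (X Y : Matrix (Fin d) (Fin d) ℂ) :
    ev M (pairOp u v X Y) = ∑ a, ∑ a', X a' a * ev M (pairOp u v (Matrix.single a' a 1) Y) := by
  have := map_matrix_eq_sum (evAt M (Function.update (fun _ => 1) v Y) u) X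
  simpa only [evAt_apply, pairOp, Function.update_comm huv] using this

lemma ev_pairOp_right (u v : V) (M : Matrix (V → Fin d) (V → Fin d) ℂ)
    (X Y : Matrix (Fin d) (Fin d) ℂ) :
    ev M (pairOp u v X Y) = ∑ b, ∑ b', Y b' b * ev M (pairOp u v X (Matrix.single b' b 1)) :=
  map_matrix_eq_sum (evAt M (Function.update (fun _ => 1) u X) v) Y

lemma biform_pairMat {u v : V} (huv : u ≠ v) (M : Matrix (V → Fin d) (V → Fin d) ℂ)
    (g h : Fin d → Phase) : biform (pairMat M u v) g h = ev M (pairOp u v (gop g) (gop h)) := by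
  rw [ev_pairOp_left huv, biform]
  refine Finset.sum_congr rfl fun a _ => ?_
  rw [Finset.sum_comm]
  refine Finset.sum_congr rfl fun a' _ => ?_
  rw [ev_pairOp_right, Finset.mul_sum]
  refine Finset.sum_congr rfl fun b _ => ?_
  rw [Finset.mul_sum]
  refine Finset.sum_congr rfl fun b' _ => ?_
  simp only [pairMat, gop, Matrix.of_apply]
  ring

lemma sum_pairMat_left {u v : V} (huv : u ≠ v) (M : Matrix (V → Fin d) (V → Fin d) ℂ)
    (b b' : Fin d) : ∑ a, pairMat M u v (a, b) (a, b') =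
      ev M (Function.update (fun _ => 1) v (Matrix.single b' b 1)) := by
  have h : Function.update (fun _ => 1) v (Matrix.single b' b 1) =
      pairOp u v (1 : Matrix (Fin d) (Fin d) ℂ) (Matrix.single b' b 1) := by
    rw [pairOp, Function.update_eq_self_iff.2 rfl]
  rw [h, ev_pairOp_left huv]
  refine Finset.sum_congr rfl fun a _ => ?_
  simp [Matrix.one_apply, pairMat]

lemma sum_pairMat_right (u v : V) (M : Matrix (V → Fin d) (V → Fin d) ℂ)
    (huv : u ≠ v) (a a' : Fin d) : ∑ b, pairMat M u v (a, b) (a', b) =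
      ev M (Function.update (fun _ => 1) u (Matrix.single a' a 1)) := by
  have h : Function.update (fun _ => 1) u (Matrix.single a' a 1) =
      pairOp u v (Matrix.single a' a 1) (1 : Matrix (Fin d) (Fin d) ℂ) := by
    ext w : 1
    by_cases hw : w = v
    · subst hw; simp [pairOp, huv.symm]
    · simp [pairOp, hw]
  rw [h, ev_pairOp_right]
  refine Finset.sum_congr rfl fun b _ => ?_
  simp [Matrix.one_apply, pairMat]

lemma isHermitian_pairMat {M : Matrix (V → Fin d) (V → Fin d) ℂ} (hM : M.IsHermitian) (u v : V) :
    (pairMat M u v).IsHermitian := by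
  ext x y
  rw [Matrix.conjTranspose_apply, pairMat, Matrix.of_apply, Matrix.of_apply, RCLike.star_def,
    star_ev hM]
  congr 1
  ext w : 1
  by_cases hv : w = v
  · subst hv; simp [pairOp]
  · by_cases hu : w = u
    · subst hu; simp [pairOp, hv]
    · simp [pairOp, hv, hu]

lemma pairMat_sub (M N : Matrix (V → Fin d) (V → Fin d) ℂ) (u v : V) :
    pairMat (M - N) u v = pairMat M u v - pairMat N u v := by
  ext x y
  simp [pairMat, ev_sub]

/-- Configurations of a pair of sites. -/
def pairEquiv {u v : V} (huv : u ≠ v) (X : Type*) :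
    ({w // w ∈ ({u, v} : Finset V)} → X) ≃ X × X :=
  Equiv.ofBijective (fun x => (x ⟨u, by simp⟩, x ⟨v, by simp⟩)) <| by
    constructor
    · intro x y h
      rw [Prod.mk.injEq] at h
      ext ⟨w, hw⟩ : 1
      rcases Finset.mem_insert.1 hw with rfl | hw'
      · exact h.1
      · obtain rfl := Finset.mem_singleton.1 hw'
        exact h.2
    · rintro ⟨a, b⟩
      exact ⟨fun w => if w.1 = u then a else b, by simp [huv.symm]⟩

lemma pairEquiv_apply {u v : V} (huv : u ≠ v) {X : Type*}
    (x : {w // w ∈ ({u, v} : Finset V)} → X) :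
    pairEquiv huv X x = (x ⟨u, by simp⟩, x ⟨v, by simp⟩) := rfl

lemma marginal_pair_apply {u v : V} (huv : u ≠ v) (ρ : State (V → Fin d))
    (x y : {w // w ∈ ({u, v} : Finset V)} → Fin d) :
    (ρ.marginal {u, v}).mat x y =
      pairMat ρ.mat u v (pairEquiv huv _ x) (pairEquiv huv _ y) := by
  rw [← ev_single (ρ.marginal {u, v}).mat x y, ev_marginal, pairMat, Matrix.of_apply]
  congr 1
  ext w : 1
  by_cases hv : w = v
  · subst hv; simp [pairOp, pairEquiv_apply]
  · by_cases hu : w = u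
    · subst hu; simp [pairOp, pairEquiv_apply, hv]
    · simp [pairOp, hv, hu]

/-- The pair has dimension d², so passing from Frobenius to trace norm costs d. -/
lemma traceNorm_marginal_pair_le {u v : V} (huv : u ≠ v) (ρ σ : State (V → Fin d)) :
    traceNorm ((ρ.marginal {u, v}).mat - (σ.marginal {u, v}).mat) ≤
      d * √(frobSq (pairMat (ρ.mat - σ.mat) u v)) := by
  refine (traceNorm_le_sqrt _).trans (le_of_eq ?_)
  have h1 : frobSq ((ρ.marginal {u, v}).mat - (σ.marginal {u, v}).mat) =
      frobSq (pairMat (ρ.mat - σ.mat) u v) := by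
    simp only [frobSq, Matrix.sub_apply, marginal_pair_apply huv, pairMat_sub]
    rw [(pairEquiv huv (Fin d)).sum_comp fun x => ∑ y, Complex.normSq
      (pairMat ρ.mat u v x (pairEquiv huv _ y) - pairMat σ.mat u v x (pairEquiv huv _ y))]
    refine Finset.sum_congr rfl fun x _ => ?_
    rw [(pairEquiv huv (Fin d)).sum_comp fun y => Complex.normSq
      (pairMat ρ.mat u v x y - pairMat σ.mat u v x y)]
  rw [h1, Fintype.card_congr (pairEquiv huv (Fin d)), Fintype.card_prod, Fintype.card_fin,
    Nat.cast_mul, Real.sqrt_mul (by positivity), Real.sqrt_mul_self (by positivity)]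

end Pairs

section ClusterState

variable {V : Type*} [Fintype V] [DecidableEq V] {d : ℕ}

/-- The state after measuring the sites of `C` with the outcomes `z`. -/
def postState (ρ : State (V → Fin d)) (o : Fin d) (C : Finset V) (z : V → Fin d → Phase) :
    State (V → Fin d) :=
  if h : dens ρ C z = 0 then ρ else
    { mat := ((dens ρ C z)⁻¹ : ℝ) • post ρ o C z
      posSemidef := (post_posSemidef ρ o C z).smul (inv_nonneg.2 (dens_nonneg ρ C z))
      trace_eq_one := by
        rw [Matrix.trace_smul, trace_post, Complex.real_smul, ← Complex.ofReal_mul,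
          inv_mul_cancel₀ h, Complex.ofReal_one] }

/-- Holds also at density zero, where the normalised state has a default value: both sides then
vanish. -/
lemma dens_mul_ev_postState (ρ : State (V → Fin d)) (o : Fin d) (C : Finset V)
    (z : V → Fin d → Phase) (O : V → Matrix (Fin d) (Fin d) ℂ) :
    dens ρ C z * ev (postState ρ o C z).mat O = ev (post ρ o C z) O := by
  unfold postState
  split_ifs with h
  · rw [post_eq_zero o h, ev_zero, h, Complex.ofReal_zero, zero_mul]
  · have : (((dens ρ C z)⁻¹ : ℝ) • post ρ o C z) = (((dens ρ C z)⁻¹ : ℝ) : ℂ) • post ρ o C z := by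
      ext; simp
    change (dens ρ C z : ℂ) * ev (((dens ρ C z)⁻¹ : ℝ) • post ρ o C z) O = _
    rw [this, ev_smul, ← mul_assoc, ← Complex.ofReal_mul, mul_inv_cancel₀ h, Complex.ofReal_one,
      one_mul]

/-- The probability of the outcomes `z` when measuring the sites in `C`. -/
def outcomeWeight (ρ : State (V → Fin d)) (C : Finset V) (z : V → Fin d → Phase) : ℝ :=
  dens ρ C z / numOutcomes V d

lemma outcomeWeight_nonneg (ρ : State (V → Fin d)) (C : Finset V) (z : V → Fin d → Phase) :
    0 ≤ outcomeWeight ρ C z := div_nonneg (dens_nonneg ρ C z) numOutcomes_pos.le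

lemma sum_outcomeWeight (ρ : State (V → Fin d)) (C : Finset V) :
    ∑ z, outcomeWeight ρ C z = 1 := by
  simp only [outcomeWeight]
  rw [← Finset.sum_div, numOutcomes, ← Fintype.expect_eq_sum_div_card, expect_dens]

lemma trace_blockProduct (P : Finpartition (univ : Finset V))
    (τ : (p : {p // p ∈ P.parts}) → State ({v // v ∈ p.1} → Fin d)) :
    (blockProduct P τ).trace = 1 := by
  rw [← ev_one, ev_blockProduct]
  simp only [ev_one, State.trace_eq_one, Finset.prod_const_one]

/-- The mixture of the product states obtained by measuring the sites in `C`. -/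
def clusterState (ρ : State (V → Fin d)) (o : Fin d) (C : Finset V)
    (P : Finpartition (univ : Finset V)) : State (V → Fin d) where
  mat := ∑ z, (outcomeWeight ρ C z : ℂ) •
    blockProduct P fun p => (postState ρ o C z).marginal p
  posSemidef := Matrix.posSemidef_sum _ fun z _ =>
    (blockProduct_posSemidef P _).smul (by exact_mod_cast outcomeWeight_nonneg ρ C z)
  trace_eq_one := by
    simp only [Matrix.trace_sum, Matrix.trace_smul, trace_blockProduct, smul_eq_mul, mul_one]
    exact_mod_cast sum_outcomeWeight ρ C

lemma clusterState_isSeparable (ρ : State (V → Fin d)) (o : Fin d) (C : Finset V)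
    (P : Finpartition (univ : Finset V)) : (clusterState ρ o C P).IsSeparable P := by
  let e := Fintype.equivFin (V → Fin d → Phase)
  refine ⟨_, fun k => outcomeWeight ρ C (e.symm k),
    fun k p => (postState ρ o C (e.symm k)).marginal p, fun k => outcomeWeight_nonneg _ _ _, ?_, ?_⟩
  · rw [e.symm.sum_comp fun z => outcomeWeight ρ C z, sum_outcomeWeight]
  · exact (e.symm.sum_comp fun z => (outcomeWeight ρ C z : ℂ) •
      blockProduct P fun p => (postState ρ o C z).marginal p).symm

/-- `O` on `p`, and the identity elsewhere. -/
def onPart (p : Finset V) (O : V → Matrix (Fin d) (Fin d) ℂ) (v : V) : Matrix (Fin d) (Fin d) ℂ :=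
  if v ∈ p then O v else 1

lemma ev_clusterState (ρ : State (V → Fin d)) (o : Fin d) (C : Finset V)
    (P : Finpartition (univ : Finset V)) (O : V → Matrix (Fin d) (Fin d) ℂ) :
    ev (clusterState ρ o C P).mat O = 𝔼 z, (dens ρ C z : ℂ) *
      ∏ p : {p // p ∈ P.parts}, ev (postState ρ o C z).mat (onPart p O) := by
  rw [Fintype.expect_eq_sum_div_card, clusterState, ev_sum, Finset.sum_div]
  refine Finset.sum_congr rfl fun z _ => ?_
  rw [ev_smul, ev_blockProduct, outcomeWeight, numOutcomes, Complex.ofReal_div,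
    Complex.ofReal_natCast, div_mul_eq_mul_div]
  simp only [ev_marginal]
  rfl

lemma expect_ev_measOn (M : Matrix (V → Fin d) (V → Fin d) ℂ) {C : Finset V}
    {O : V → Matrix (Fin d) (Fin d) ℂ} (hO : ∀ v ∈ C, O v = 1) :
    𝔼 z, ev M (measOn C z O) = ev M O := by
  refine expect_ev M (Q := fun v g => if v ∈ C then gop g else O v) fun v i j => ?_
  by_cases hv : v ∈ C
  · simp only [hv, if_true, expect_gop, hO v hv]
  · simp only [hv, if_false]
    exact Fintype.expect_const (O v i j)

lemma onPart_eq_one {p : Finset V} {O : V → Matrix (Fin d) (Fin d) ℂ} (hO : ∀ v ∈ p, O v = 1) :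
    onPart p O = fun _ => 1 := by
  ext v : 1
  unfold onPart
  split_ifs with h
  · exact hO v h
  · rfl

/-- The other blocks contribute trace one, and averaging over outcomes undoes the measurement of
sites on which the operator is trivial. So the marginal of each block off `C` is preserved. -/
lemma ev_clusterState_of_supported (ρ : State (V → Fin d)) (o : Fin d) {C : Finset V}
    (P : Finpartition (univ : Finset V)) {p : Finset V} (hp : p ∈ P.parts)
    {O : V → Matrix (Fin d) (Fin d) ℂ} (hOp : ∀ v ∉ p, O v = 1) (hOC : ∀ v ∈ C, O v = 1) :
    ev (clusterState ρ o C P).mat O = ev ρ.mat O := by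
  rw [ev_clusterState, ← expect_ev_measOn ρ.mat hOC]
  refine Finset.expect_congr rfl fun z _ => ?_
  rw [Finset.prod_eq_single ⟨p, hp⟩]
  · have : onPart p O = O := by
      ext v : 1
      unfold onPart
      split_ifs with h
      · rfl
      · exact (hOp v h).symm
    rw [this, dens_mul_ev_postState, ev_post_of_one]
    intro v hv
    rw [hOC v hv, Matrix.one_apply_eq]
  · intro q _ hq
    rw [onPart_eq_one, ev_one, State.trace_eq_one]
    intro v hv
    refine hOp v fun hvp => hq (Subtype.ext ?_)
    exact P.eq_of_mem_parts q.2 hp hv hvp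
  · simp

lemma dens_insert_update_eq_ev_post (ρ : State (V → Fin d)) (o : Fin d) {C : Finset V} {u : V}
    (hu : u ∉ C) (z : V → Fin d → Phase) (g : Fin d → Phase) :
    (dens ρ (insert u C) (Function.update z u g) : ℂ) =
      ev (post ρ o C z) (Function.update (fun _ => 1) u (gop g)) := by
  rw [ofReal_dens, measOn_insert_update hu, ev_post_of_one]
  · congr 1
    ext w : 1
    by_cases hw : w = u
    · subst hw; simp [measOn, hu]
    · simp [measOn, hw]
  · intro v hv
    rw [Function.update_of_ne (ne_of_mem_of_not_mem hv hu), Matrix.one_apply_eq]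

lemma ev_pairOp_gop (ρ : State (V → Fin d)) {C : Finset V} {u v : V} (huv : u ≠ v) (hu : u ∉ C)
    (hv : v ∉ C) (g h : Fin d → Phase) :
    ev ρ.mat (pairOp u v (gop g) (gop h)) =
      𝔼 z, (dens ρ (insert u (insert v C)) (Function.update (Function.update z v h) u g) : ℂ) := by
  rw [← expect_ev_measOn (C := C)]
  · refine Finset.expect_congr rfl fun z _ => ?_
    rw [ofReal_dens, measOn_insert_update (by simp [huv, hu]), measOn_insert_update hv]
    congr 1
    ext w : 1
    by_cases hw : w = u
    · subst hw; simp [measOn, hu, pairOp, huv]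
    · by_cases hw' : w = v
      · subst hw'; simp [measOn, hv, pairOp, hw]
      · simp [measOn, pairOp, hw, hw']
  · intro w hw
    rw [pairOp, Function.update_of_ne (ne_of_mem_of_not_mem hw hv),
      Function.update_of_ne (ne_of_mem_of_not_mem hw hu)]

/-- Given the outcomes on `C`, sites in different blocks are independent in the cluster state, so
measuring both yields the product of the two conditional densities. -/
lemma ev_clusterState_pairOp_gop (ρ : State (V → Fin d)) (o : Fin d) {C : Finset V}
    (P : Finpartition (univ : Finset V)) {u v : V} (huv : P.part u ≠ P.part v) (hu : u ∉ C)
    (hv : v ∉ C) (g h : Fin d → Phase) :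
    ev (clusterState ρ o C P).mat (pairOp u v (gop g) (gop h)) =
      𝔼 z, (prodDens ρ C u v (Function.update (Function.update z v h) u g) : ℂ) := by
  have hne : u ≠ v := fun h => huv (by rw [h])
  have hpu := P.mem_part (Finset.mem_univ u)
  have hpv := P.mem_part (Finset.mem_univ v)
  have hPu := P.part_mem.2 (Finset.mem_univ u)
  have hPv := P.part_mem.2 (Finset.mem_univ v)
  have huv' : u ∉ P.part v := fun hm => huv (P.part_eq_of_mem hPv hm)
  have hvu' : v ∉ P.part u := fun hm => huv (P.part_eq_of_mem hPu hm).symm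
  rw [ev_clusterState]
  refine Finset.expect_congr rfl fun z _ => ?_
  rw [Fintype.prod_eq_mul (⟨P.part u, hPu⟩ : {p // p ∈ P.parts}) ⟨P.part v, hPv⟩
    (fun he => huv (congrArg Subtype.val he))]
  · have h1 : onPart (P.part u) (pairOp u v (gop g) (gop h)) =
        Function.update (fun _ => 1) u (gop g) := by
      ext w : 1
      by_cases hw : w = u
      · subst hw; simp [onPart, hpu, pairOp, hne]
      · by_cases hw' : w = v
        · subst hw'; simp [onPart, hvu', hw]
        · simp [onPart, pairOp, hw, hw']
    have h2 : onPart (P.part v) (pairOp u v (gop g) (gop h)) =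
        Function.update (fun _ => 1) v (gop h) := by
      ext w : 1
      by_cases hw' : w = v
      · subst hw'; simp [onPart, hpv, pairOp]
      · by_cases hw : w = u
        · subst hw; simp [onPart, huv', hw']
        · simp [onPart, pairOp, hw, hw']
    rw [h1, h2]
    have hz : dens ρ C (Function.update (Function.update z v h) u g) = dens ρ C z := by
      rw [dens_update_of_notMem ρ hu, dens_update_of_notMem ρ hv]
    have hU : dens ρ (insert u C) (Function.update (Function.update z v h) u g) =
        dens ρ (insert u C) (Function.update z u g) := by
      rw [Function.update_comm hne.symm, dens_update_of_notMem ρ (by simp [hne.symm, hv])]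
    have hV : dens ρ (insert v C) (Function.update (Function.update z v h) u g) =
        dens ρ (insert v C) (Function.update z v h) := by
      rw [dens_update_of_notMem ρ (by simp [hne, hu])]
    rw [prodDens, hz, hU, hV, Complex.ofReal_div, Complex.ofReal_mul,
      dens_insert_update_eq_ev_post ρ o hu, dens_insert_update_eq_ev_post ρ o hv,
      ← dens_mul_ev_postState, ← dens_mul_ev_postState]
    by_cases h0 : dens ρ C z = 0
    · simp [h0]
    · have h0' : (dens ρ C z : ℂ) ≠ 0 := by exact_mod_cast h0
      field_simp
  · rintro q ⟨hq1, hq2⟩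
    rw [onPart_eq_one, ev_one, State.trace_eq_one]
    intro w hw
    have hwu : w ≠ u := by
      rintro rfl
      exact hq1 (Subtype.ext (P.part_eq_of_mem q.2 hw).symm)
    have hwv : w ≠ v := by
      rintro rfl
      exact hq2 (Subtype.ext (P.part_eq_of_mem q.2 hw).symm)
    simp [pairOp, hwu, hwv]

lemma traceNorm_clusterState_same (ρ : State (V → Fin d)) (o : Fin d) {C : Finset V}
    (P : Finpartition (univ : Finset V)) {u v : V} (hne : u ≠ v) (huv : P.part u = P.part v)
    (hu : u ∉ C) (hv : v ∉ C) :
    traceNorm ((ρ.marginal {u, v}).mat - ((clusterState ρ o C P).marginal {u, v}).mat) ≤ 0 := by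
  refine (traceNorm_marginal_pair_le hne _ _).trans (le_of_eq ?_)
  have h : pairMat (ρ.mat - (clusterState ρ o C P).mat) u v = 0 := by
    ext x y
    rw [pairMat, Matrix.of_apply, ev_sub,
      ev_clusterState_of_supported ρ o P (P.part_mem.2 (Finset.mem_univ u)), sub_self,
      Matrix.zero_apply]
    · intro w hw
      have hwu : w ≠ u := by
        rintro rfl
        exact hw (P.mem_part (Finset.mem_univ w))
      have hwv : w ≠ v := by
        rintro rfl
        exact hw (huv ▸ P.mem_part (Finset.mem_univ w))
      simp [pairOp, hwu, hwv]
    · intro w hw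
      simp [pairOp, ne_of_mem_of_not_mem hw hu, ne_of_mem_of_not_mem hw hv]
  simp [h, frobSq]

/-- The product measurement on u, v sees the joint density for ρ and the conditional product density
for the cluster state. The distortion bound and Pinsker convert their L¹ distance into trace norm.
-/
lemma traceNorm_clusterState_cross (ρ : State (V → Fin d)) (o : Fin d) {C : Finset V}
    (P : Finpartition (univ : Finset V)) {u v : V} (huv : P.part u ≠ P.part v)
    (hu : u ∉ C) (hv : v ∉ C) :
    traceNorm ((ρ.marginal {u, v}).mat - ((clusterState ρ o C P).marginal {u, v}).mat) ≤
      14 * d * √(2 * discDeriv u (discDeriv v (outcomeInfo ρ)) C) := by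
  have hne : u ≠ v := fun h => huv (by rw [h])
  refine (traceNorm_marginal_pair_le hne _ _).trans ?_
  set σ := clusterState ρ o C P with hσ
  -- Both states have the same one-site marginals off `C`; these are the vanishing partial traces
  -- required by the distortion bound.
  have hone : ∀ (w : V) (hw : w ∉ C) (X : Matrix (Fin d) (Fin d) ℂ),
      ev (ρ.mat - σ.mat) (Function.update (fun _ => 1) w X) = 0 := by
    intro w hw X
    rw [ev_sub, hσ, ev_clusterState_of_supported ρ o P (P.part_mem.2 (Finset.mem_univ w)), sub_self]
    · intro x hx
      rw [Function.update_of_ne]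
      rintro rfl
      exact hx (P.mem_part (Finset.mem_univ x))
    · intro x hx
      rw [Function.update_of_ne (ne_of_mem_of_not_mem hx hw)]
  have h1 := frobSq_le_expect_abs_biform
    (isHermitian_pairMat (ρ.posSemidef.isHermitian.sub σ.posSemidef.isHermitian) u v)
    (fun b b' => by rw [sum_pairMat_left hne, hone v hv])
    (fun a a' => by rw [sum_pairMat_right u v _ hne, hone u hu])
  set F : (V → Fin d → Phase) → ℝ := fun z =>
    |dens ρ (insert u (insert v C)) z - prodDens ρ C u v z| with hF
  have h2 : 𝔼 g, 𝔼 h, |(biform (pairMat (ρ.mat - σ.mat) u v) g h).re| ≤ 𝔼 z, F z := by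
    have h3 : ∀ g h, |(biform (pairMat (ρ.mat - σ.mat) u v) g h).re| ≤
        𝔼 z, F (Function.update (Function.update z v h) u g) := by
      intro g h
      rw [biform_pairMat hne, ev_sub, ev_pairOp_gop ρ hne hu hv,
        ev_clusterState_pairOp_gop ρ o P huv hu hv, ← Finset.expect_sub_distrib, re_expect]
      simp only [Complex.sub_re, Complex.ofReal_re]
      exact Finset.abs_expect_le _ _
    calc _ ≤ 𝔼 g, 𝔼 h, 𝔼 z, F (Function.update (Function.update z v h) u g) :=
          Finset.expect_le_expect fun g _ => Finset.expect_le_expect fun h _ => h3 g h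
      _ = 𝔼 z, F z := by
        exact expect_resample_two u v F
  have h4 : 𝔼 z, F z ≤ √(2 * discDeriv u (discDeriv v (outcomeInfo ρ)) C) :=
    Real.le_sqrt_of_sq_le (sq_expect_abs_dens_sub_le_discDeriv ρ hne hu hv)
  have h5 : √(frobSq (pairMat (ρ.mat - σ.mat) u v)) ≤
      14 * 𝔼 g, 𝔼 h, |(biform (pairMat (ρ.mat - σ.mat) u v) g h).re| := by
    refine (Real.sqrt_le_sqrt h1).trans_eq (Real.sqrt_sq ?_)
    exact mul_nonneg (by norm_num) (Finset.expect_nonneg fun g _ => Finset.expect_nonneg fun h _ =>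
      abs_nonneg _)
  calc _ ≤ (d : ℝ) * (14 * √(2 * discDeriv u (discDeriv v (outcomeInfo ρ)) C)) := by
        gcongr; linarith
    _ = _ := by ring

end ClusterState

end
end QuditGraph

/-! ### Edge sums and the total error. -/

namespace QuditGraph
open scoped ComplexOrder
noncomputable section
open scoped BigOperators ComplexConjugate
open Finset

section Graph

variable {V : Type*} [Fintype V] [DecidableEq V]

/-- Ordered adjacent pairs are darts, and every edge carries two of them. -/
lemma sum_adj_eq_two_mul_sum_edges (G : SimpleGraph V) [DecidableRel G.Adj] (f : Sym2 V → ℝ) :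
    ∑ u, ∑ v, (if G.Adj u v then f s(u, v) else 0) = 2 * ∑ e ∈ G.edgeFinset, f e := by
  have h1 : ∑ u, ∑ v, (if G.Adj u v then f s(u, v) else 0) = ∑ a : G.Dart, f a.edge := by
    rw [← Fintype.sum_prod_type' fun u v => if G.Adj u v then f s(u, v) else 0,
      ← Finset.sum_filter]
    refine (Finset.sum_bij (fun (a : G.Dart) _ => a.toProd) ?_ ?_ ?_ ?_).symm
    · intro a _; simpa using a.adj
    · intro a _ b _ h; exact SimpleGraph.Dart.toProd_injective h
    · rintro ⟨u, v⟩ h; exact ⟨⟨(u, v), by simpa using h⟩, Finset.mem_univ _, rfl⟩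
    · intro a _; rfl
  rw [h1, ← Finset.sum_fiberwise_of_maps_to (s := univ) (t := G.edgeFinset)
    (g := fun a : G.Dart => a.edge) (fun a _ => by simp), Finset.mul_sum]
  refine Finset.sum_congr rfl fun e he => ?_
  rw [Finset.sum_congr rfl fun a ha => by rw [(Finset.mem_filter.1 ha).2], Finset.sum_const,
    G.dart_edge_fiber_card e (by simpa using he), nsmul_eq_mul]
  norm_num

lemma sum_adj_of_regular {G : SimpleGraph V} [DecidableRel G.Adj] {D : ℕ}
    (hG : G.IsRegularOfDegree D) (u : V) : ∑ v, (if G.Adj u v then (1 : ℝ) else 0) = D := by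
  rw [← hG u, ← G.card_neighborFinset_eq_degree, Finset.sum_boole, G.neighborFinset_eq_filter]

lemma sum_adj_of_regular' {G : SimpleGraph V} [DecidableRel G.Adj] {D : ℕ}
    (hG : G.IsRegularOfDegree D) (v : V) : ∑ u, (if G.Adj u v then (1 : ℝ) else 0) = D := by
  rw [← sum_adj_of_regular hG v]
  exact Finset.sum_congr rfl fun u _ => by simp only [G.adj_comm]

lemma two_mul_card_edgeFinset {G : SimpleGraph V} [DecidableRel G.Adj] {D : ℕ}
    (hG : G.IsRegularOfDegree D) :
    2 * (G.edgeFinset.card : ℝ) = Fintype.card V * D := by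
  have h := sum_adj_eq_two_mul_sum_edges G fun _ => 1
  simp only [sum_adj_of_regular hG, Finset.sum_const, Finset.card_univ, nsmul_eq_mul, mul_one] at h
  exact h.symm

lemma card_interedges_eq_sum (G : SimpleGraph V) [DecidableRel G.Adj] (S T : Finset V) :
    ((G.interedges S T).card : ℝ) = ∑ u ∈ S, ∑ v ∈ T, (if G.Adj u v then 1 else 0) := by
  rw [← Finset.sum_product', SimpleGraph.interedges_def, Finset.sum_boole]

lemma sum_parts (P : Finpartition (univ : Finset V)) (f : V → ℝ) :
    ∑ v, f v = ∑ p ∈ P.parts, ∑ v ∈ p, f v := by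
  have h : ∑ v ∈ P.parts.biUnion id, f v = ∑ p ∈ P.parts, ∑ v ∈ p, f v :=
    Finset.sum_biUnion P.disjoint
  rwa [P.biUnion_parts] at h

lemma card_parts_mul {P : Finpartition (univ : Finset V)} {m : ℕ}
    (hP : ∀ p ∈ P.parts, p.card = m) : (P.parts.card : ℝ) * m = Fintype.card V := by
  have h := sum_parts P fun _ => 1
  have h2 : ∑ p ∈ P.parts, ∑ v ∈ p, (1 : ℝ) = ∑ p ∈ P.parts, (m : ℝ) :=
    Finset.sum_congr rfl fun p hp => by rw [Finset.sum_const, hP p hp, nsmul_eq_mul, mul_one]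
  rw [h2] at h
  simpa using h.symm

lemma sum_card_interedges {G : SimpleGraph V} [DecidableRel G.Adj] {D : ℕ} (hD : D ≠ 0)
    (hG : G.IsRegularOfDegree D) {m : ℕ} (hm : 0 < m) [Nonempty V]
    {P : Finpartition (univ : Finset V)} (hP : ∀ p ∈ P.parts, p.card = m) :
    ∑ p ∈ P.parts, ((G.interedges p pᶜ).card : ℝ) = Fintype.card V * D * avgExpansion G P := by
  have h1 : ∀ p ∈ P.parts, expansion G p = ((G.interedges p pᶜ).card : ℝ) / (m * D) := by
    intro p hp
    rw [expansion, card_interedges_eq_sum G p univ]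
    simp only [sum_adj_of_regular hG, Finset.sum_const, hP p hp, nsmul_eq_mul]
  have hn := card_parts_mul hP
  have hn0 : (Fintype.card V : ℝ) ≠ 0 := by exact_mod_cast Fintype.card_ne_zero
  have hN : (P.parts.card : ℝ) ≠ 0 := by
    rintro h0
    rw [h0, zero_mul] at hn
    exact hn0 hn.symm
  have hm' : (m : ℝ) ≠ 0 := by exact_mod_cast hm.ne'
  have hD' : (D : ℝ) ≠ 0 := by exact_mod_cast hD
  rw [avgExpansion, Finset.sum_congr rfl h1, ← Finset.sum_div, ← hn]
  field_simp

end Graph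

section Error

variable {V : Type*} [Fintype V] [DecidableEq V] {d : ℕ}

lemma avgEdgeError_le_two (G : SimpleGraph V) [DecidableRel G.Adj] (ρ σ : State (V → Fin d)) :
    avgEdgeError G ρ σ ≤ 2 := by
  rw [avgEdgeError]
  refine div_le_of_le_mul₀ (Nat.cast_nonneg _) zero_le_two ?_
  refine (Finset.sum_le_card_nsmul _ _ 2 fun e _ => traceNorm_sub_le_two _ _).trans_eq ?_
  rw [nsmul_eq_mul, mul_comm]

lemma avgEdgeError_eq {G : SimpleGraph V} [DecidableRel G.Adj] {D : ℕ}
    (hG : G.IsRegularOfDegree D) (ρ σ : State (V → Fin d)) :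
    avgEdgeError G ρ σ = (∑ u, ∑ v, if G.Adj u v then
      traceNorm ((ρ.marginal {u, v}).mat - (σ.marginal {u, v}).mat) else 0) /
        (Fintype.card V * D) := by
  obtain ⟨t, ht⟩ : ∃ t : Finset V → ℝ, ∀ S, t S =
    traceNorm ((ρ.marginal S).mat - (σ.marginal S).mat) := ⟨_, fun _ => rfl⟩
  have h := sum_adj_eq_two_mul_sum_edges G fun e => t e.toFinset
  simp only [Sym2.toFinset_mk_eq] at h
  simp only [← ht]
  rw [h, ← two_mul_card_edgeFinset hG, mul_div_mul_left _ _ two_ne_zero, avgEdgeError]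
  simp only [ht]

/-- Linearising the root with a free slope lets the constant be charged to crossing edges only and
the linear part to all crossing pairs. -/
lemma sqrt_two_mul_le {x θ : ℝ} (hx : 0 ≤ x) (hθ : 0 < θ) : √(2 * x) ≤ θ / 2 + x / θ := by
  refine Real.sqrt_le_iff.2 ⟨by positivity, ?_⟩
  have h1 : x = (x / θ) * θ := by field_simp
  nlinarith [sq_nonneg (θ / 2 - x / θ)]

lemma traceNorm_edge_le (ρ : State (V → Fin d)) (o : Fin d) (C : Finset V)
    (P : Finpartition (univ : Finset V)) {u v : V} (hne : u ≠ v) {θ : ℝ} (hθ : 0 < θ) :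
    traceNorm ((ρ.marginal {u, v}).mat - ((clusterState ρ o C P).marginal {u, v}).mat) ≤
      2 * (if u ∈ C then 1 else 0) + 2 * (if v ∈ C then 1 else 0) +
        if P.part v ≠ P.part u then
          14 * d * (θ / 2 + discDeriv u (discDeriv v (outcomeInfo ρ)) C / θ) else 0 := by
  have hdd := discDeriv_discDeriv_outcomeInfo_nonneg ρ hne C
  have hc : (0 : ℝ) ≤ if P.part v ≠ P.part u then
      14 * d * (θ / 2 + discDeriv u (discDeriv v (outcomeInfo ρ)) C / θ) else 0 := by
    by_cases hp : P.part v ≠ P.part u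
    · rw [if_pos hp]; positivity
    · rw [if_neg hp]
  have h2 := traceNorm_sub_le_two (ρ.marginal {u, v}) ((clusterState ρ o C P).marginal {u, v})
  by_cases hu : u ∈ C
  · have : (0 : ℝ) ≤ 2 * (if v ∈ C then 1 else 0) := by positivity
    rw [if_pos hu]
    linarith
  · by_cases hv : v ∈ C
    · rw [if_neg hu, if_pos hv]
      linarith
    · rw [if_neg hu, if_neg hv, mul_zero, zero_add, zero_add]
      by_cases hP : P.part u = P.part v
      · rw [if_neg (by simp [hP])]
        exact traceNorm_clusterState_same ρ o P hne hP hu hv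
      · rw [if_pos (fun h => hP h.symm)]
        refine (traceNorm_clusterState_cross ρ o P hP hu hv).trans ?_
        gcongr
        exact sqrt_two_mul_le hdd hθ

lemma sum_crossing (P : Finpartition (univ : Finset V)) (f : V → V → ℝ) :
    ∑ u, ∑ v, (if P.part v ≠ P.part u then f u v else 0) =
      ∑ p ∈ P.parts, ∑ u ∈ p, ∑ v ∈ pᶜ, f u v := by
  rw [sum_parts P]
  refine Finset.sum_congr rfl fun p hp => Finset.sum_congr rfl fun u hu => ?_
  rw [← Finset.sum_filter]
  refine Finset.sum_congr ?_ fun _ _ => rfl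
  ext v
  rw [Finset.mem_filter, Finset.mem_compl, P.part_eq_of_mem hp hu, ne_eq, P.part_eq_iff_mem hp]
  simp

lemma avgEdgeError_clusterState_le [Nonempty V] {G : SimpleGraph V} [DecidableRel G.Adj] {D : ℕ}
    (hD : D ≠ 0) (hG : G.IsRegularOfDegree D) {m : ℕ} (hm : 0 < m)
    {P : Finpartition (univ : Finset V)} (hP : ∀ p ∈ P.parts, p.card = m)
    (ρ : State (V → Fin d)) (o : Fin d) (C : Finset V) {θ : ℝ} (hθ : 0 < θ) :
    avgEdgeError G ρ (clusterState ρ o C P) ≤ 4 / Fintype.card V * C.card +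
      7 * d * avgExpansion G P * θ + 14 * d / (Fintype.card V * D * θ) *
        ∑ p ∈ P.parts, crossDiff (outcomeInfo ρ) p C := by
  have hn : (0 : ℝ) < Fintype.card V := by exact_mod_cast Fintype.card_pos
  have hD' : (0 : ℝ) < D := by exact_mod_cast Nat.pos_of_ne_zero hD
  rw [avgEdgeError_eq hG, div_le_iff₀ (by positivity)]
  set A : V → V → ℝ := fun u v => if G.Adj u v then 1 else 0 with hA
  have hA0 : ∀ u v, 0 ≤ A u v := fun u v => by simp only [hA]; positivity
  have hA1 : ∀ u v, A u v ≤ 1 := fun u v => by simp only [hA]; split_ifs <;> norm_num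
  have hbound : ∀ u v, (if G.Adj u v then
      traceNorm ((ρ.marginal {u, v}).mat - ((clusterState ρ o C P).marginal {u, v}).mat) else 0) ≤
      2 * ((if u ∈ C then 1 else 0) * A u v) + 2 * ((if v ∈ C then 1 else 0) * A u v) +
        if P.part v ≠ P.part u then 7 * d * θ * A u v +
          14 * d / θ * discDeriv u (discDeriv v (outcomeInfo ρ)) C else 0 := by
    intro u v
    by_cases hp : P.part v ≠ P.part u
    · have hne : u ≠ v := fun h => hp (by rw [h])
      have hdd := discDeriv_discDeriv_outcomeInfo_nonneg ρ hne C
      have h := traceNorm_edge_le ρ o C P hne hθ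
      rw [if_pos hp] at h ⊢
      by_cases hadj : G.Adj u v
      · simp only [hA, if_pos hadj, mul_one]
        refine h.trans (le_of_eq ?_)
        ring
      -- Non-adjacent crossing pairs keep their nonnegative information term, so that the sum
      -- becomes the full `crossDiff`. The θ term carries the factor `A` and disappears.
      · simp only [hA, if_neg hadj, mul_zero, zero_add]
        positivity
    · rw [if_neg hp, add_zero]
      by_cases hadj : G.Adj u v
      · have h := traceNorm_edge_le ρ o C P hadj.ne hθ
        rw [if_neg hp, add_zero] at h
        simpa only [hA, if_pos hadj, mul_one] using h
      · simp only [hA, if_neg hadj, mul_zero, zero_add, le_refl]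
  refine (Finset.sum_le_sum fun u _ => Finset.sum_le_sum fun v _ => hbound u v).trans ?_
  simp only [Finset.sum_add_distrib, sum_crossing]
  have e1 : ∑ u, ∑ v, 2 * ((if u ∈ C then 1 else 0) * A u v) = 2 * (D * C.card) := by
    simp only [← Finset.mul_sum]
    simp only [hA, sum_adj_of_regular hG]
    simp [mul_comm]
  have e2 : ∑ u, ∑ v, 2 * ((if v ∈ C then 1 else 0) * A u v) = 2 * (D * C.card) := by
    rw [Finset.sum_comm]
    simp only [← Finset.mul_sum]
    simp only [hA, sum_adj_of_regular' hG]
    simp [mul_comm]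
  have e3 : ∑ p ∈ P.parts, ∑ u ∈ p, ∑ v ∈ pᶜ, 7 * d * θ * A u v =
      7 * d * θ * (Fintype.card V * D * avgExpansion G P) := by
    rw [← sum_card_interedges hD hG hm hP]
    simp only [card_interedges_eq_sum, Finset.mul_sum, hA]
  have e4 : ∑ p ∈ P.parts, ∑ u ∈ p, ∑ v ∈ pᶜ,
      14 * d / θ * discDeriv u (discDeriv v (outcomeInfo ρ)) C =
      14 * d / θ * ∑ p ∈ P.parts, crossDiff (outcomeInfo ρ) p C := by
    simp only [crossDiff, Finset.mul_sum]
  rw [e1, e2, e3, e4]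
  refine le_of_eq ?_
  field_simp
  ring

end Error

end
end QuditGraph

/-! ### Optimisation of the parameters and conclusion. -/

namespace QuditGraph
open scoped ComplexOrder
noncomputable section
open scoped BigOperators ComplexConjugate
open Finset

/-- Optimising θ and then ε gives order x^(1/4). Below the threshold of `hsmall`, a further factor
x^(1/12) < 0.4715 turns this into x^(1/6) with constant 9. The slack `s` matters only at x = 0,
where the infimum need not be attained. -/
lemma exists_density_and_slope {A B x s : ℝ} (hA : 0 ≤ A) (hB : 0 ≤ B) (hx : 0 ≤ x)
    (hAB : A * B = 98 * x) (hs : 0 < s) (hsmall : 9 * x ^ ((1 : ℝ) / 6) < 2) :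
    ∃ ε θ : ℝ, 0 < ε ∧ ε ≤ 1 / 2 ∧ 0 < θ ∧
      4 * ε + A * θ + B / (θ * ε ^ 2) ≤ 9 * x ^ ((1 : ℝ) / 6) + s := by
  rcases hx.eq_or_lt with rfl | hx
  · rw [Real.zero_rpow (by norm_num), mul_zero, zero_add]
    set ε := min (1 / 2) (s / 8) with hε
    have hε0 : 0 < ε := by positivity
    have hε8 : ε ≤ s / 8 := min_le_right _ _
    rw [mul_zero, mul_eq_zero] at hAB
    rcases hAB with h | h
    -- With A = 0 a large θ is free; in the other case B = 0 and a small θ is free. The slack is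
    -- split as s/2 for 4ε and s/2 for the remaining term.
    · refine ⟨ε, B / ε ^ 2 * (2 / s) + 1, hε0, min_le_left _ _, by positivity, ?_⟩
      have h1 : B / ((B / ε ^ 2 * (2 / s) + 1) * ε ^ 2) ≤ s / 2 := by
        rw [div_le_iff₀ (by positivity)]
        have : s / 2 * ((B / ε ^ 2 * (2 / s) + 1) * ε ^ 2) = B + s / 2 * ε ^ 2 := by
          field_simp
        rw [this]
        have : 0 ≤ s / 2 * ε ^ 2 := by positivity
        linarith
      rw [h, zero_mul]
      linarith
    · refine ⟨ε, (s / 2) / (A + 1), hε0, min_le_left _ _, by positivity, ?_⟩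
      have h1 : A * ((s / 2) / (A + 1)) ≤ s / 2 := by
        rw [mul_div_assoc', div_le_iff₀ (by positivity)]
        nlinarith
      rw [h, zero_div]
      linarith
  · set t := x ^ ((1 : ℝ) / 12) with ht
    have ht0 : 0 < t := Real.rpow_pos_of_pos hx _
    have hx' : x = t ^ 12 := by
      rw [ht, ← Real.rpow_natCast, ← Real.rpow_mul hx.le]
      norm_num
    have hy : x ^ ((1 : ℝ) / 6) = t ^ 2 := by
      rw [ht, ← Real.rpow_natCast, ← Real.rpow_mul hx.le]
      norm_num
    rw [hy] at hsmall ⊢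
    -- From 9t² < 2, that is t < √2/3.
    have ht1 : t ≤ 4715 / 10000 := by nlinarith
    have hA' : 0 < A := by
      refine lt_of_le_of_ne hA fun h => ?_
      rw [← h, zero_mul] at hAB
      linarith
    -- Near-optimal values, with 99/10 in place of √98, the value that balances the last two terms.
    -- The sum is 8 + 99/20 + 980/198 < 18 times t³, and 18 · 0.4715 < 9.
    refine ⟨2 * t ^ 3, 99 / 10 * t ^ 6 / (A * (2 * t ^ 3)), by positivity, ?_, by positivity, ?_⟩
    · have : t ^ 3 ≤ (4715 / 10000) ^ 3 := by gcongr
      norm_num at this ⊢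
      linarith
    · have e1 : A * (99 / 10 * t ^ 6 / (A * (2 * t ^ 3))) = 99 / 20 * t ^ 3 := by
        field_simp
        ring
      have e2 : B / (99 / 10 * t ^ 6 / (A * (2 * t ^ 3)) * (2 * t ^ 3) ^ 2) =
          (980 / 198) * t ^ 3 := by
        have : B = 98 * t ^ 12 / A := by
          rw [eq_div_iff hA'.ne', mul_comm, hAB, hx']
        rw [this]
        field_simp
        ring
      rw [e1, e2]
      have : t ^ 3 ≤ 4715 / 10000 * t ^ 2 := by nlinarith [sq_nonneg t]
      nlinarith [sq_nonneg t]

section Main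

variable {V : Type*} [Fintype V] [DecidableEq V] {d : ℕ}

lemma sum_parts_eq_sum_fiber (P : Finpartition (univ : Finset V)) (f : Finset V → ℝ) :
    ∑ p ∈ P.parts, f p = ∑ p : {p // p ∈ P.parts},
      f (fiber (fun v => ⟨P.part v, P.part_mem.2 (Finset.mem_univ v)⟩ :
        V → {p // p ∈ P.parts}) p) := by
  rw [← Finset.sum_coe_sort]
  refine Finset.sum_congr rfl fun p _ => ?_
  congr 1
  ext v
  rw [fiber, Finset.mem_filter, Subtype.ext_iff, P.part_eq_iff_mem p.2]
  simp

lemma exists_sparse_set_of_state (ρ : State (V → Fin d)) (P : Finpartition (univ : Finset V))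
    {ε : ℝ} (hε : 0 < ε) (hε' : ε ≤ 1 / 2) {c₁ c₂ : ℝ} (hc₂ : 0 ≤ c₂) :
    ∃ C : Finset V, c₁ * C.card + c₂ * ∑ p ∈ P.parts, crossDiff (outcomeInfo ρ) p C ≤
      c₁ * (ε * Fintype.card V) + c₂ * ((ε ^ 2)⁻¹ * ∑ p ∈ P.parts, ρ.mutualInfo p) := by
  obtain ⟨C, hC⟩ := exists_sparse_set
    (fun v => ⟨P.part v, P.part_mem.2 (Finset.mem_univ v)⟩ : V → {p // p ∈ P.parts})
    (fun u v huv S => discDeriv_discDeriv_outcomeInfo_nonneg ρ huv S) hε hε' (c₁ := c₁) hc₂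
  refine ⟨C, ?_⟩
  rw [sum_parts_eq_sum_fiber P fun p => crossDiff (outcomeInfo ρ) p C,
    sum_parts_eq_sum_fiber P fun p => ρ.mutualInfo p]
  refine hC.trans ?_
  gcongr
  exact outcomeInfo_cut_le_mutualInfo ρ _

lemma crossDiff_outcomeInfo_nonneg (ρ : State (V → Fin d)) (p C : Finset V) :
    0 ≤ crossDiff (outcomeInfo ρ) p C :=
  Finset.sum_nonneg fun u hu => Finset.sum_nonneg fun v hv =>
    discDeriv_discDeriv_outcomeInfo_nonneg ρ
      (ne_of_mem_of_not_mem hu (Finset.mem_compl.1 hv)) C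

/-- Falls out of the sparse-set bound with no weight on the size of C: nonnegative mixed differences
are bounded by a multiple of the mutual information. -/
lemma avgMutualInfo_nonneg (ρ : State (V → Fin d)) (P : Finpartition (univ : Finset V)) :
    0 ≤ ρ.avgMutualInfo P := by
  refine div_nonneg ?_ (Nat.cast_nonneg _)
  obtain ⟨C, hC⟩ := exists_sparse_set_of_state ρ P (ε := 1 / 2) (by norm_num) le_rfl (c₁ := 0)
    zero_le_one
  have : 0 ≤ ∑ p ∈ P.parts, crossDiff (outcomeInfo ρ) p C :=
    Finset.sum_nonneg fun p _ => crossDiff_outcomeInfo_nonneg ρ p C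
  norm_num at hC
  linarith

lemma avgExpansion_nonneg (G : SimpleGraph V) [DecidableRel G.Adj]
    (P : Finpartition (univ : Finset V)) : 0 ≤ avgExpansion G P :=
  div_nonneg (Finset.sum_nonneg fun _ _ => div_nonneg (Nat.cast_nonneg _) (Nat.cast_nonneg _))
    (Nat.cast_nonneg _)

lemma isSeparable_of_isEmpty [IsEmpty V] (ρ : State (V → Fin d))
    (P : Finpartition (univ : Finset V)) : ρ.IsSeparable P := by
  refine ⟨1, fun _ => 1, fun _ p => ρ.marginal p, fun _ => zero_le_one, by simp, ?_⟩
  refine matrix_eq_of_ev fun O => ?_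
  have h : O = fun _ => 1 := funext fun v => isEmptyElim v
  rw [Fin.sum_univ_one, ev_smul, h, ev_one, ev_one, trace_blockProduct, ρ.trace_eq_one]
  simp

lemma exists_isSeparable_avgEdgeError_le [Nonempty V] {G : SimpleGraph V} [DecidableRel G.Adj]
    {D : ℕ} (hD : D ≠ 0) (hG : G.IsRegularOfDegree D) {m : ℕ} (hm : 0 < m)
    {P : Finpartition (univ : Finset V)} (hP : ∀ p ∈ P.parts, p.card = m)
    (ρ : State (V → Fin d)) {ε θ : ℝ} (hε : 0 < ε) (hε' : ε ≤ 1 / 2) (hθ : 0 < θ) :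
    ∃ σ : State (V → Fin d), σ.IsSeparable P ∧ avgEdgeError G ρ σ ≤
      4 * ε + 7 * d * avgExpansion G P * θ +
        14 * d * ρ.avgMutualInfo P / (m * D) / (θ * ε ^ 2) := by
  obtain ⟨o⟩ := nonempty_site_of_state ρ (Classical.arbitrary V)
  have hn : (0 : ℝ) < Fintype.card V := by exact_mod_cast Fintype.card_pos
  have hD' : (0 : ℝ) < D := by exact_mod_cast Nat.pos_of_ne_zero hD
  have hm' : (0 : ℝ) < m := by exact_mod_cast hm
  obtain ⟨C, hC⟩ := exists_sparse_set_of_state ρ P hε hε' (c₁ := 4 / Fintype.card V)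
    (c₂ := 14 * d / (Fintype.card V * D * θ)) (by positivity)
  refine ⟨clusterState ρ o C P, clusterState_isSeparable ρ o C P,
    (avgEdgeError_clusterState_le hD hG hm hP ρ o C hθ).trans ?_⟩
  have hN := card_parts_mul hP
  have hN0 : (P.parts.card : ℝ) ≠ 0 := by
    rintro h0
    rw [h0, zero_mul] at hN
    exact hn.ne hN
  have hI : ∑ p ∈ P.parts, ρ.mutualInfo p = P.parts.card * ρ.avgMutualInfo P := by
    rw [State.avgMutualInfo]
    field_simp
  have e1 : 4 / (Fintype.card V : ℝ) * (ε * Fintype.card V) = 4 * ε := by field_simp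
  have e2 : 14 * d / (Fintype.card V * D * θ) *
      ((ε ^ 2)⁻¹ * (P.parts.card * ρ.avgMutualInfo P)) =
      14 * d * ρ.avgMutualInfo P / (m * D) / (θ * ε ^ 2) := by
    rw [← hN]
    field_simp
  rw [hI, e1, e2] at hC
  linarith

end Main

end
end QuditGraph

theorem mainTheorem2 {V : Type*} [Fintype V] [DecidableEq V]
    (G : SimpleGraph V) [DecidableRel G.Adj] (D : ℕ) (hG : G.IsRegularOfDegree D)
    (m : ℕ) (hm : 0 < m)
    (P : Finpartition (Finset.univ : Finset V)) (hP : ∀ p ∈ P.parts, p.card = m)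
    (d : ℕ) (ρ : QuditGraph.State (V → Fin d)) :
    ∃ σ : QuditGraph.State (V → Fin d),
      σ.IsSeparable P ∧
      QuditGraph.avgEdgeError G ρ σ ≤
        9 * ((d : ℝ) ^ 2 * QuditGraph.avgExpansion G P / (D : ℝ) *
              (ρ.avgMutualInfo P / (m : ℝ))) ^ ((1 : ℝ) / 6)
          + 1 / (m : ℝ) + (m : ℝ) / (Fintype.card V : ℝ) := by
  have hΦ := QuditGraph.avgExpansion_nonneg G P
  have hI := QuditGraph.avgMutualInfo_nonneg ρ P
  have hm' : (0 : ℝ) < m := by exact_mod_cast hm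
  set x : ℝ := (d : ℝ) ^ 2 * QuditGraph.avgExpansion G P / (D : ℝ) *
    (ρ.avgMutualInfo P / (m : ℝ)) with hx
  have hx0 : 0 ≤ x := by positivity
  have hy0 : 0 ≤ x ^ ((1 : ℝ) / 6) := Real.rpow_nonneg hx0 _
  have hs : (0 : ℝ) < 1 / m := by positivity
  have hmn : (0 : ℝ) ≤ (m : ℝ) / (Fintype.card V : ℝ) := by positivity
  rcases isEmpty_or_nonempty V with hV | hV
  · refine ⟨ρ, QuditGraph.isSeparable_of_isEmpty ρ P, ?_⟩
    have h0 : QuditGraph.avgEdgeError G ρ ρ = 0 := by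
      simp [QuditGraph.avgEdgeError, QuditGraph.traceNorm_zero]
    rw [h0]
    linarith
  · obtain ⟨o⟩ := QuditGraph.nonempty_site_of_state ρ (Classical.arbitrary V)
    -- For D = 0 there are no edges and the average error is 0/0 = 0, so any separable state will
    -- do.
    rcases Nat.eq_zero_or_pos D with hD | hD
    · refine ⟨QuditGraph.clusterState ρ o ∅ P, QuditGraph.clusterState_isSeparable ρ o ∅ P, ?_⟩
      have h0 := QuditGraph.avgEdgeError_eq hG ρ (QuditGraph.clusterState ρ o ∅ P)
      rw [hD, Nat.cast_zero, mul_zero, div_zero] at h0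
      rw [h0]
      linarith
    · by_cases hsmall : 9 * x ^ ((1 : ℝ) / 6) < 2
      · have hD' : (0 : ℝ) < D := by exact_mod_cast hD
        -- The two coefficients multiply to 7d·14d = 98d² times the remaining factors, i.e. 98x. The
        -- term 1/m serves as the slack, and m/n is simply dropped.
        obtain ⟨ε, θ, hε, hε', hθ, h⟩ := QuditGraph.exists_density_and_slope
          (A := 7 * d * QuditGraph.avgExpansion G P)
          (B := 14 * d * ρ.avgMutualInfo P / (m * D)) (by positivity) (by positivity) hx0
          (by rw [hx]; field_simp; ring) hs hsmall
        obtain ⟨σ, hσ, hle⟩ := QuditGraph.exists_isSeparable_avgEdgeError_le hD.ne' hG hm hP ρ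
          hε hε' hθ
        exact ⟨σ, hσ, by linarith⟩
      -- Here the right-hand side is at least 2, which bounds the trace distance of any two states.
      · refine ⟨QuditGraph.clusterState ρ o ∅ P, QuditGraph.clusterState_isSeparable ρ o ∅ P, ?_⟩
        have := QuditGraph.avgEdgeError_le_two G ρ (QuditGraph.clusterState ρ o ∅ P)
        linarith
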